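/- Let $k\ge 2$ be an integer and let $\alpha_*(k)$ be the smallest positive root of $\kappa(\alpha)=1$, where $$\kappa(\alpha)=k(k-1)\,\alpha\Big(1-\tfrac14 e^{-k\alpha/2}\Big)\Big(1-\tfrac12 e^{-k\alpha/2}\Big)^{k-2}.$$ Let $0\le\alpha<\alpha_*(k)$ and $\beta\in[0,\infty)$. Let $\mathcal D$ be the set of Borel probability measures on $\mathbb R$ and let $$f(x_1,\dots,x_{k-1})=-\tfrac12\log\Big\{1-\frac{1-e^{-\beta}}{2^{k-1}}\prod_{i=1}^{k-1}(1-\tanh x_i)\Big\}.$$ For $\nu\in\mathcal D$ let $S_1(\nu)$ be the law of $f(h_1,\dots,h_{k-1})$ with $h_1,\dots,h_{k-1}$ i.i.d. of law $\nu$. For $\mu\in\mathcal D$ let $S_2(\mu)$ be the law of $\sum_{a=1}^{\ell_+}u^+_a-\sum_{b=1}^{\ell_-}u^-_b$, where $\ell_+,\ell_-$ are Poisson of mean $k\alpha/2$, all $u^\pm_a$ have law $\mu$, and all these variables are independent. Let $S=S_1\circ S_2:\mathcal D\to\mathcal D$. Then $S$ has a unique fixed point $\mu^*\in\mathcal D$.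 Put $\nu^*=S_2(\mu^*)$ and $$\phi(\beta)=-k\alpha\,\mathbb E\log[1+\tanh h\tanh u]+\alpha\,\mathbb E\log\Big\{1-\frac{1-e^{-\beta}}{2^k}\prod_{i=1}^k(1-\tanh h_i)\Big\}$$ $$\qquad+\mathbb E\log\Big\{\prod_{i=1}^{\ell_+}(1+\tanh u^+_i)\prod_{i=1}^{\ell_-}(1-\tanh u^-_i)+\prod_{i=1}^{\ell_+}(1-\tanh u^+_i)\prod_{i=1}^{\ell_-}(1+\tanh u^-_i)\Big\},$$ where $u,u^\pm_i$ have law $\mu^*$, $h,h_i$ have law $\nu^*$, $\ell_\pm$ are Poisson of mean $k\alpha/2$, and all these variables are independent; the three random variables under the expectations are integrable. Let $M_N$ be nonnegative integers with $M_N/N\to\alpha$ as $N\to\infty$ (for instance $M_N=\lfloor\alpha N\rfloor$). For each $N\ge k$ let $F_N$ be a random $k$-SAT formula consisting of $M_N$ clauses over $N$ Boolean variables, chosen independently and uniformly among the $2^k\binom Nk$ clauses made of $k$ literals on $k$ distinct variables; the $F_N$ are defined on one probability space, with an arbitrary joint distribution. Let $Z(\beta,F_N)=\sum_{x\in\{0,1\}^N}e^{-\beta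 E(x)}$, where $E(x)$ is the number of clauses of $F_N$ that $x$ does not satisfy. Then $$\frac1N\log Z(\beta,F_N)\ \longrightarrow\ \phi(\beta)\qquad\text{almost surely as } N\to\infty .$$ -/

import Mathlib

open MeasureTheory ProbabilityTheory Filter Topology
open scoped NNReal

noncomputable section

namespace RandomKSAT

/-! ### Formulas and the partition function -/

/-- A literal over `N` Boolean variables: `(i, true)` is the literal `x i`, and `(i, false)` is its
negation. -/
abbrev Literal (N : ℕ) : Type := Fin N × Bool

/-- A clause is the disjunction of a finite set of literals. -/
abbrev Clause (N : ℕ) : Type := Finset (Literal N)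

/-- The clause `c` is violated by the assignment `x` if each of its literals is false. -/
def Violated {N : ℕ} (c : Clause N) (x : Fin N → Bool) : Prop :=
  ∀ l ∈ c, x l.1 ≠ l.2

open Classical in
/-- The number of clauses of the formula `F` that the assignment `x` does not satisfy. -/
def energy {N M : ℕ} (F : Fin M → Clause N) (x : Fin N → Bool) : ℕ :=
  (Finset.univ.filter fun a : Fin M => Violated (F a) x).card

/-- The partition function `∑ₓ exp (-β E(x))`. -/
def partitionFunction {N M : ℕ} (β : ℝ) (F : Fin M → Clause N) : ℝ :=
  ∑ x : Fin N → Bool, Real.exp (-β * (energy F x : ℝ))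

/-! ### Random formulas -/

/-- The `2 ^ k * N.choose k` clauses made of `k` literals on `k` distinct variables. -/
def kClauses (k N : ℕ) : Set (Clause N) :=
  {c | c.card = k ∧ Set.InjOn Prod.fst (c : Set (Literal N))}

/-- The law of a random formula: `M` clauses, independent and uniform among the `k`-clauses over `N`
variables. (It is a probability measure for `k ≤ N`.) -/
def formulaLaw (k N M : ℕ) : Measure (Fin M → Clause N) :=
  Measure.pi fun _ => uniformOn (kClauses k N)

/-! ### The threshold -/

/-- The contraction rate (for `k ≥ 2`). -/
def contractionRate (k : ℕ) (a : ℝ) : ℝ :=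
  (k : ℝ) * ((k : ℝ) - 1) * a * (1 - 1 / 4 * Real.exp (-((k : ℝ) * a / 2))) *
    (1 - 1 / 2 * Real.exp (-((k : ℝ) * a / 2))) ^ (k - 2)

/-- The smallest positive root of `contractionRate k a = 1` (for `k ≥ 2`). -/
def alphaStar (k : ℕ) : ℝ := sInf {a : ℝ | 0 < a ∧ contractionRate k a = 1}

/-- For `k ≥ 2` the smallest positive root exists, so that `alphaStar` is what it should be. -/
theorem isLeast_alphaStar {k : ℕ} (hk : 2 ≤ k) :
    IsLeast {a : ℝ | 0 < a ∧ contractionRate k a = 1} (alphaStar k) := by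
  have hc : Continuous (contractionRate k) := by
    unfold contractionRate
    fun_prop
  have h0 : contractionRate k 0 = 0 := by simp [contractionRate]
  have hk' : (2 : ℝ) ≤ k := by exact_mod_cast hk
  have hbig : 1 ≤ contractionRate k (2 ^ (k - 2)) := by
    have he1 : Real.exp (-((k : ℝ) * 2 ^ (k - 2) / 2)) ≤ 1 :=
      Real.exp_le_one_iff.2 (neg_nonpos.2 (by positivity))
    unfold contractionRate
    set e := Real.exp (-((k : ℝ) * 2 ^ (k - 2) / 2))
    have h1 : ((1 : ℝ) / 2) ^ (k - 2) ≤ (1 - 1 / 2 * e) ^ (k - 2) :=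
      pow_le_pow_left₀ (by norm_num) (by linarith) _
    have h2 : (2 : ℝ) ^ (k - 2) * (1 / 2) ^ (k - 2) = 1 := by
      rw [← mul_pow]; norm_num
    have h3 : (1 : ℝ) ≤ 2 ^ (k - 2) * (1 - 1 / 2 * e) ^ (k - 2) := by
      calc (1 : ℝ) = 2 ^ (k - 2) * (1 / 2) ^ (k - 2) := h2.symm
        _ ≤ _ := mul_le_mul_of_nonneg_left h1 (by positivity)
    have h4 : (2 : ℝ) ≤ k * ((k : ℝ) - 1) := by nlinarith
    have h5 : (1 : ℝ) ≤ k * ((k : ℝ) - 1) * (1 - 1 / 4 * e) := by nlinarith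
    calc (1 : ℝ) ≤ (k * ((k : ℝ) - 1) * (1 - 1 / 4 * e)) *
          (2 ^ (k - 2) * (1 - 1 / 2 * e) ^ (k - 2)) := one_le_mul_of_one_le_of_one_le h5 h3
      _ = _ := by ring
  have hset : {a : ℝ | 0 < a ∧ contractionRate k a = 1} =
      Set.Ici 0 ∩ contractionRate k ⁻¹' {1} := by
    ext a
    simp only [Set.mem_ofPred_eq, Set.mem_inter_iff, Set.mem_Ici, Set.mem_preimage,
      Set.mem_singleton_iff]
    refine ⟨fun h => ⟨h.1.le, h.2⟩, fun h => ⟨lt_of_le_of_ne h.1 ?_, h.2⟩⟩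
    rintro rfl
    exact zero_ne_one (h0.symm.trans h.2)
  have hclosed : IsClosed {a : ℝ | 0 < a ∧ contractionRate k a = 1} := by
    rw [hset]
    exact isClosed_Ici.inter (isClosed_singleton.preimage hc)
  have hbdd : BddBelow {a : ℝ | 0 < a ∧ contractionRate k a = 1} :=
    ⟨0, fun a ha => ha.1.le⟩
  have hne : {a : ℝ | 0 < a ∧ contractionRate k a = 1}.Nonempty := by
    obtain ⟨a, ha, ha'⟩ := intermediate_value_Icc (by positivity : (0 : ℝ) ≤ 2 ^ (k - 2))
      hc.continuousOn (⟨h0.le.trans zero_le_one, hbig⟩ : (1 : ℝ) ∈ Set.Icc _ _)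
    rw [hset]
    exact ⟨a, ha.1, ha'⟩
  exact ⟨hclosed.csInf_mem hne hbdd, fun a ha => csInf_le hbdd ha⟩

/-! ### The distributional operators -/

/-- The function `f` that maps `k - 1` incoming messages to an outgoing one. -/
def bpFun (k : ℕ) (β : ℝ) (x : Fin (k - 1) → ℝ) : ℝ :=
  -(1 / 2) * Real.log (1 - (1 - Real.exp (-β)) / 2 ^ (k - 1) * ∏ i, (1 - Real.tanh (x i)))

theorem continuous_tanh : Continuous Real.tanh := by
  rw [show Real.tanh = fun x => Real.sinh x / Real.cosh x from
    funext fun x => Real.tanh_eq_sinh_div_cosh x]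
  exact Real.continuous_sinh.div Real.continuous_cosh fun x => (Real.cosh_pos x).ne'

theorem measurable_bpFun (k : ℕ) (β : ℝ) : Measurable (bpFun k β) := by
  have h : Measurable Real.tanh := continuous_tanh.measurable
  unfold bpFun
  fun_prop

/-- The law of `f (h₁, …, h_{k-1})` for i.i.d. `hᵢ` with law `μ`. -/
def S₁ (k : ℕ) (β : ℝ) (μ : ProbabilityMeasure ℝ) : ProbabilityMeasure ℝ :=
  ⟨(Measure.pi fun _ : Fin (k - 1) => (μ : Measure ℝ)).map (bpFun k β),
    Measure.isProbabilityMeasure_map (measurable_bpFun k β).aemeasurable⟩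

/-- A sample `((ℓ₊, ℓ₋), (u⁺, u⁻))` of two numbers and two sequences of reals. -/
abbrev PoissonSample : Type := (ℕ × ℕ) × ((ℕ → ℝ) × (ℕ → ℝ))

/-- The law of a sample for which `ℓ₊`, `ℓ₋` are Poisson of mean `k α / 2`, the `u⁺ᵢ`, `u⁻ᵢ` have
law `ν`, and everything is independent. -/
def poissonSampleLaw (k : ℕ) (α : ℝ≥0) (ν : ProbabilityMeasure ℝ) : Measure PoissonSample :=
  ((poissonMeasure (k * α / 2)).prod (poissonMeasure (k * α / 2))).prod
    ((Measure.infinitePi fun _ : ℕ => (ν : Measure ℝ)).prod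
      (Measure.infinitePi fun _ : ℕ => (ν : Measure ℝ)))

instance (k : ℕ) (α : ℝ≥0) (ν : ProbabilityMeasure ℝ) :
    IsProbabilityMeasure (poissonSampleLaw k α ν) := by
  unfold poissonSampleLaw
  infer_instance

/-- The field `∑_{i < ℓ₊} u⁺ᵢ - ∑_{i < ℓ₋} u⁻ᵢ`. -/
def field (s : PoissonSample) : ℝ :=
  ∑ i ∈ Finset.range s.1.1, s.2.1 i - ∑ i ∈ Finset.range s.1.2, s.2.2 i

theorem measurable_field : Measurable field := by
  refine measurable_from_prod_countable_right fun n => ?_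
  change Measurable fun y : (ℕ → ℝ) × (ℕ → ℝ) =>
    ∑ i ∈ Finset.range n.1, y.1 i - ∑ i ∈ Finset.range n.2, y.2 i
  fun_prop

/-- The law of `∑_{a ≤ ℓ₊} u_a - ∑_{b ≤ ℓ₋} u_b` for independent Poisson `ℓ₊`, `ℓ₋` of mean
`k α / 2` and i.i.d. `u_a`, `u_b` with law `ν`. -/
def S₂ (k : ℕ) (α : ℝ≥0) (ν : ProbabilityMeasure ℝ) : ProbabilityMeasure ℝ :=
  ⟨(poissonSampleLaw k α ν).map field,
    Measure.isProbabilityMeasure_map measurable_field.aemeasurable⟩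

/-- The operator `S = S₁ ∘ S₂`. -/
def S (k : ℕ) (α : ℝ≥0) (β : ℝ) (μ : ProbabilityMeasure ℝ) : ProbabilityMeasure ℝ :=
  S₁ k β (S₂ k α μ)

/-! ### The limiting free entropy -/

/-- `log (1 + tanh h tanh u)`, as a function of `(h, u)`. -/
def edgeTerm (p : ℝ × ℝ) : ℝ := Real.log (1 + Real.tanh p.1 * Real.tanh p.2)

/-- `log (1 - 2⁻ᵏ (1 - exp (-β)) ∏ᵢ (1 - tanh hᵢ))`. -/
def clauseTerm (k : ℕ) (β : ℝ) (h : Fin k → ℝ) : ℝ :=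
  Real.log (1 - 1 / 2 ^ k * (1 - Real.exp (-β)) * ∏ i, (1 - Real.tanh (h i)))

/-- `log (∏ (1 + tanh u⁺ᵢ) ∏ (1 - tanh u⁻ᵢ) + ∏ (1 - tanh u⁺ᵢ) ∏ (1 + tanh u⁻ᵢ))`, the products
being over `i < ℓ₊` for `u⁺ᵢ` and over `i < ℓ₋` for `u⁻ᵢ`. -/
def variableTerm (s : PoissonSample) : ℝ :=
  Real.log
    ((∏ i ∈ Finset.range s.1.1, (1 + Real.tanh (s.2.1 i))) *
        ∏ i ∈ Finset.range s.1.2, (1 - Real.tanh (s.2.2 i)) +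
      (∏ i ∈ Finset.range s.1.1, (1 - Real.tanh (s.2.1 i))) *
        ∏ i ∈ Finset.range s.1.2, (1 + Real.tanh (s.2.2 i)))

/-- The Bethe free entropy at the laws `μ` (of `u`) and `ν` (of `h`). -/
def bethe (k : ℕ) (α : ℝ≥0) (β : ℝ) (μ ν : ProbabilityMeasure ℝ) : ℝ :=
  -((k : ℝ) * α) * ∫ p, edgeTerm p ∂((ν : Measure ℝ).prod (μ : Measure ℝ)) +
    α * ∫ h, clauseTerm k β h ∂(Measure.pi fun _ : Fin k => (ν : Measure ℝ)) +
    ∫ s, variableTerm s ∂(poissonSampleLaw k α μ)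

end RandomKSAT

end

/-!
The proof analyses Poissonian formulas, in which every `k`-tuple of literals occurs as a clause with
an independent Poisson multiplicity, repetitions of variables included. Removing a variable from such
a formula leaves independent Poisson numbers of clauses that contain it positively and negatively,
whose other literals are independent and uniform, and a Poissonian formula over the other variables
(`abs_integral_sub_removeVertex_le`). In particular, the joint marginals of some literals under the
Gibbs measure are determined by those of the literals that share a clause with the removed variable
in the smaller formula. Iteration explores the local tree of the literals.

No assumption on the correlations of the literals at the boundary of the explored tree is needed. The
joint distribution at the boundary, whatever it is, is a mixture of point masses, and attaching a
variable maps mixtures of product measures to mixtures of product measures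
(`attachVertex_mem_mixtures`). The fields of these product measures follow the message passing
recursion of the tree, with different boundary values. So it suffices to control, for the recursion
on a random tree, how far the fields can be from reference fields that are computed with one fixed
choice of the boundary values (`dominatedByTree`). A message is Lipschitz in the incoming fields, and
the Lipschitz constant gains a factor `1 / 2` for every incoming literal whose variable has no
negative occurrences, since its field is nonnegative for all boundary values
(`abs_message_sub_le`). The mean distance therefore contracts by the factor `contractionRate` at each
level of the tree (`meanDataRadius_succ_le`), which is less than `1` below `alphaStar`
(`contractionRate_lt_one`).

It follows that the law of the field of a literal in a large formula is close to every late iterate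
of `S₂ ∘ S₁`, for every initial law. Hence there is at most one fixed point, and limit points of the
iterates are fixed points (`existsUnique_fixed`). Moreover, literals of distinct variables have
asymptotically independent fields with the law of the fixed point
(`eventually_abs_integral_sub_le_of_fixed`).

The free entropy per variable is the Cesàro limit of the effect of adding a variable at a constant
density of clauses (`tendsto_meanLog_div`). This is the effect of adding a variable with its
`k α` clauses (`tendsto_meanLog_addVertex`) less the effect of the `(k - 1) α` clauses in excess
(`tendsto_meanLog_addClauses`), and both are means of logarithms of local partition functions, to
which the local limit applies. The Bethe formula at the fixed point is the same expression, written
with normalised messages (`bethe_eq`).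

Finally, the repeated variables and the fluctuations of the number of clauses of a Poissonian formula
change the mean of `log Z` by `o(N)` (`abs_meanLog_sub_clausesMeanLog_le`), and `log Z` is concentrated
by the bounded difference inequality (`measureReal_le_abs_sub_integral`), so that the Borel–Cantelli
lemma gives almost sure convergence (`ae_tendsto_log_partitionFunction`).
-/

noncomputable section

namespace RandomKSAT

open scoped ENNReal BigOperators

/-! ### Poisson variables -/

theorem hasSum_mul_poisson (r : ℝ≥0) :
    HasSum (fun n : ℕ => Real.exp (-r) * (r : ℝ) ^ n / n.factorial * n) r := by
  rw [← hasSum_nat_add_iff' 1]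
  have h := (hasSum_one_poissonMeasure r).mul_left (r : ℝ)
  simp only [Finset.range_one, Finset.sum_singleton, Nat.cast_zero, mul_zero, sub_zero]
  rw [mul_one] at h
  refine h.congr_fun fun n => ?_
  rw [Nat.factorial_succ]
  push_cast
  field_simp
  ring

theorem hasSum_mul_pred_poisson (r : ℝ≥0) :
    HasSum (fun n : ℕ => Real.exp (-r) * (r : ℝ) ^ n / n.factorial * (n * (n - 1))) (r ^ 2 : ℝ) := by
  rw [← hasSum_nat_add_iff' 1]
  have h := (hasSum_mul_poisson r).mul_left (r : ℝ)
  simp only [Finset.range_one, Finset.sum_singleton, Nat.cast_zero, zero_mul, mul_zero, sub_zero]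
  rw [← pow_two] at h
  refine h.congr_fun fun n => ?_
  rw [Nat.factorial_succ]
  push_cast
  field_simp
  ring

theorem integrable_natCast_poisson (r : ℝ≥0) :
    Integrable (fun n : ℕ => (n : ℝ)) (poissonMeasure r) := by
  rw [integrable_poissonMeasure_iff]
  simpa using (hasSum_mul_poisson r).summable

theorem integral_natCast_poisson (r : ℝ≥0) : ∫ n : ℕ, (n : ℝ) ∂(poissonMeasure r) = r := by
  rw [integral_poissonMeasure]
  simpa using (hasSum_mul_poisson r).tsum_eq

theorem integrable_sq_poisson (r : ℝ≥0) :
    Integrable (fun n : ℕ => ((n : ℝ) - r) ^ 2) (poissonMeasure r) := by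
  rw [integrable_poissonMeasure_iff]
  have := ((hasSum_mul_pred_poisson r).add (((hasSum_mul_poisson r).mul_left (1 - 2 * (r : ℝ))).add
    ((hasSum_one_poissonMeasure r).mul_left ((r : ℝ) ^ 2)))).summable
  refine this.congr fun n => ?_
  rw [Real.norm_of_nonneg (sq_nonneg _)]
  ring

theorem integral_sq_poisson (r : ℝ≥0) :
    ∫ n : ℕ, ((n : ℝ) - r) ^ 2 ∂(poissonMeasure r) = r := by
  rw [integral_poissonMeasure]
  have := ((hasSum_mul_pred_poisson r).add (((hasSum_mul_poisson r).mul_left (1 - 2 * (r : ℝ))).add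
    ((hasSum_one_poissonMeasure r).mul_left ((r : ℝ) ^ 2)))).tsum_eq
  refine Eq.trans ?_ (this.trans (by ring))
  refine tsum_congr fun n => ?_
  rw [smul_eq_mul]
  ring

/-- The mean deviation is at most the standard deviation. -/
theorem integral_abs_sub_poisson_le (r : ℝ≥0) :
    ∫ n : ℕ, |(n : ℝ) - r| ∂(poissonMeasure r) ≤ Real.sqrt r := by
  have hi : Integrable (fun n : ℕ => |(n : ℝ) - r|) (poissonMeasure r) :=
    ((integrable_natCast_poisson r).sub (integrable_const _)).abs
  refine Real.le_sqrt_of_sq_le ?_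
  -- the variance of `|n - r|` is nonnegative
  have h0 : 0 ≤ ∫ n : ℕ, (|(n : ℝ) - r| - ∫ n : ℕ, |(n : ℝ) - r| ∂(poissonMeasure r)) ^ 2
      ∂(poissonMeasure r) := integral_nonneg fun n => sq_nonneg _
  set m := ∫ n : ℕ, |(n : ℝ) - r| ∂(poissonMeasure r)
  have h1 : ∫ n : ℕ, (|(n : ℝ) - r| - m) ^ 2 ∂(poissonMeasure r) = r - m ^ 2 := by
    calc _ = ∫ n : ℕ, (((n : ℝ) - r) ^ 2 - 2 * m * |(n : ℝ) - r| + m ^ 2) ∂(poissonMeasure r) := by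
          refine integral_congr_ae (.of_forall fun n => ?_)
          simp only
          rw [← sq_abs ((n : ℝ) - r)]
          ring
      _ = _ := by
          have h2 : Integrable (fun n : ℕ => ((n : ℝ) - r) ^ 2 - 2 * m * |(n : ℝ) - r|)
              (poissonMeasure r) := (integrable_sq_poisson r).sub (hi.const_mul _)
          rw [integral_add h2 (integrable_const _),
            integral_sub (integrable_sq_poisson r) (hi.const_mul _), integral_sq_poisson,
            integral_const_mul]
          simp only [integral_const, probReal_univ, smul_eq_mul, one_mul]
          change (r : ℝ) - 2 * m * m + m ^ 2 = _
          ring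
  linarith

theorem summable_poisson_weight_mul (L A B : ℝ) (hL : 0 ≤ L) :
    Summable fun n : ℕ => L ^ n / n.factorial * (A + B * n) := by
  have h1 := Real.summable_pow_div_factorial L
  have h2 : Summable fun n : ℕ => L ^ n / n.factorial * n := by
    refine Summable.of_nonneg_of_le (fun n => by positivity) (fun n => ?_)
      (Real.summable_pow_div_factorial (2 * L))
    rw [mul_pow, mul_comm, ← mul_div_assoc]
    gcongr
    exact_mod_cast Nat.lt_two_pow_self.le
  refine ((h1.mul_left A).add (h2.mul_left B)).congr fun n => ?_
  ring

theorem integrable_poisson_of_le {r : ℝ≥0} {f : ℕ → ℝ} {A B : ℝ} (h : ∀ n, |f n| ≤ A + B * n) :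
    Integrable f (poissonMeasure r) :=
  ((integrable_const A).add ((integrable_natCast_poisson r).const_mul B)).mono'
    Measurable.of_discrete.aestronglyMeasurable (.of_forall h)

theorem integrable_poisson_prod_of_le {r : ℝ≥0} {f : ℕ × ℕ → ℝ} {A B : ℝ}
    (h : ∀ ℓ : ℕ × ℕ, |f ℓ| ≤ A + B * (ℓ.1 + ℓ.2)) :
    Integrable f ((poissonMeasure r).prod (poissonMeasure r)) := by
  have h1 : Integrable (fun ℓ : ℕ × ℕ => (ℓ.1 : ℝ)) ((poissonMeasure r).prod (poissonMeasure r)) :=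
    (integrable_natCast_poisson r).comp_fst _
  have h2 : Integrable (fun ℓ : ℕ × ℕ => (ℓ.2 : ℝ)) ((poissonMeasure r).prod (poissonMeasure r)) :=
    (integrable_natCast_poisson r).comp_snd _
  exact ((integrable_const A).add ((h1.add h2).const_mul B)).mono'
    Measurable.of_discrete.aestronglyMeasurable (.of_forall h)

/-- Dominated convergence for Poisson expectations whose rate varies. -/
theorem tendsto_integral_poisson {σ : Type*} {l : Filter σ}
    {r : σ → ℝ≥0} {r₀ : ℝ≥0}
    (hr : Tendsto r l (𝓝 r₀)) {f : σ → ℕ → ℝ} {f₀ : ℕ → ℝ} {A B : ℝ}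
    (hf : ∀ n, Tendsto (fun p => f p n) l (𝓝 (f₀ n)))
    (hb : ∀ᶠ p in l, ∀ n, |f p n| ≤ A + B * n) :
    Tendsto (fun p => ∫ n, f p n ∂(poissonMeasure (r p))) l
      (𝓝 (∫ n, f₀ n ∂(poissonMeasure r₀))) := by
  simp_rw [integral_poissonMeasure]
  refine tendsto_tsum_of_dominated_convergence
    (bound := fun n => ((r₀ : ℝ) + 1) ^ n / n.factorial * (A + B * n))
    (summable_poisson_weight_mul _ A B (by positivity)) (fun n => ?_) ?_
  · have hr' : Tendsto (fun p => (r p : ℝ)) l (𝓝 r₀) := (NNReal.tendsto_coe.2 hr)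
    simp only [smul_eq_mul]
    exact (((Real.continuous_exp.tendsto _).comp hr'.neg).mul (hr'.pow n)).div_const _ |>.mul (hf n)
  · have h1 : ∀ᶠ p in l, r p ≤ r₀ + 1 :=
      (hr.eventually_lt_const (show r₀ < r₀ + 1 by simp)).mono fun p hp => hp.le
    filter_upwards [h1, hb] with p hp hb n
    rw [norm_smul, Real.norm_eq_abs, Real.norm_eq_abs, abs_of_nonneg (by positivity)]
    have hp' : (r p : ℝ) ≤ r₀ + 1 := by exact_mod_cast hp
    refine mul_le_mul ?_ (hb n) (abs_nonneg _) (by positivity)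
    gcongr
    calc Real.exp (-(r p)) * (r p : ℝ) ^ n ≤ 1 * (r p : ℝ) ^ n := by
          gcongr
          simp
      _ ≤ _ := by rw [one_mul]; gcongr

/-- Dominated convergence for a pair of independent Poisson variables whose rate varies. The
functions may grow linearly. -/
theorem tendsto_integral_poisson_prod {σ : Type*} {l : Filter σ}
    {r : σ → ℝ≥0} {r₀ : ℝ≥0} (hr : Tendsto r l (𝓝 r₀)) {f : σ → ℕ × ℕ → ℝ} {f₀ : ℕ × ℕ → ℝ}
    {A B : ℝ} (hB : 0 ≤ B)
    (hf : ∀ ℓ, Tendsto (fun p => f p ℓ) l (𝓝 (f₀ ℓ)))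
    (hb : ∀ p, ∀ ℓ : ℕ × ℕ, |f p ℓ| ≤ A + B * (ℓ.1 + ℓ.2))
    (hb₀ : ∀ ℓ : ℕ × ℕ, |f₀ ℓ| ≤ A + B * (ℓ.1 + ℓ.2)) :
    Tendsto (fun p => ∫ ℓ, f p ℓ ∂((poissonMeasure (r p)).prod (poissonMeasure (r p)))) l
      (𝓝 (∫ ℓ, f₀ ℓ ∂((poissonMeasure r₀).prod (poissonMeasure r₀)))) := by
  rw [integral_prod _ (integrable_poisson_prod_of_le hb₀)]
  simp_rw [fun p => integral_prod _ (integrable_poisson_prod_of_le (r := r p) (hb p))]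
  refine tendsto_integral_poisson hr (A := A + B * (r₀ + 1)) (B := B) (fun n => ?_) ?_
  · exact tendsto_integral_poisson hr (A := A + B * n) (B := B) (fun m => hf (n, m))
      (.of_forall fun p m => (hb p (n, m)).trans (le_of_eq (by ring)))
  · have h1 : ∀ᶠ p in l, r p ≤ r₀ + 1 :=
      (hr.eventually_lt_const (show r₀ < r₀ + 1 by simp)).mono fun p hp => hp.le
    filter_upwards [h1] with p hp n
    have hp' : (r p : ℝ) ≤ r₀ + 1 := by exact_mod_cast hp
    have h2 (m : ℕ) : |f p (n, m)| ≤ A + B * n + B * m := (hb p (n, m)).trans (le_of_eq (by ring))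
    refine abs_integral_le_integral_abs.trans ((integral_mono (integrable_poisson_of_le h2).abs
      ((integrable_const _).add ((integrable_natCast_poisson _).const_mul _)) h2).trans ?_)
    simp only [Pi.add_apply]
    rw [integral_add (integrable_const _) ((integrable_natCast_poisson _).const_mul _),
      integral_const_mul, integral_natCast_poisson]
    simp only [integral_const, probReal_univ, smul_eq_mul, one_mul]
    nlinarith

/-! ### Independent Poisson variables indexed by a finite set -/

/-- The law of independent Poisson variables of rate `γ` indexed by `T`. -/
def poissonPi (T : Type*) [Fintype T] (γ : ℝ≥0) : Measure (T → ℕ) :=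
  Measure.pi fun _ => poissonMeasure γ

instance (T : Type*) [Fintype T] (γ : ℝ≥0) : IsProbabilityMeasure (poissonPi T γ) := by
  unfold poissonPi
  infer_instance

section PoissonPi

variable {T : Type*} [Fintype T] {γ : ℝ≥0}

theorem measurePreserving_eval_poissonPi (c : T) :
    MeasurePreserving (fun η : T → ℕ => η c) (poissonPi T γ) (poissonMeasure γ) :=
  measurePreserving_eval _ c

theorem integrable_count (c : T) : Integrable (fun η : T → ℕ => (η c : ℝ)) (poissonPi T γ) :=
  (measurePreserving_eval_poissonPi c).integrable_comp_of_integrable (integrable_natCast_poisson γ)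

theorem integrable_sum_count : Integrable (fun η : T → ℕ => ∑ c, (η c : ℝ)) (poissonPi T γ) :=
  integrable_finsetSum _ fun c _ => integrable_count c

theorem integral_sum_count :
    ∫ η : T → ℕ, ∑ c, (η c : ℝ) ∂(poissonPi T γ) = γ * Fintype.card T := by
  rw [integral_finsetSum _ fun c _ => integrable_count c]
  have h (c : T) : ∫ η : T → ℕ, (η c : ℝ) ∂(poissonPi T γ) = γ := by
    rw [← integral_natCast_poisson γ, ← (measurePreserving_eval_poissonPi (γ := γ) c).map_eq,
      integral_map (measurable_pi_apply c).aemeasurable (by fun_prop)]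
  simp [h, mul_comm]

theorem integrable_poissonPi_of_le {H : (T → ℕ) → ℝ} {A B : ℝ}
    (hH : ∀ η, |H η| ≤ A + B * ∑ c, (η c : ℝ)) : Integrable H (poissonPi T γ) :=
  ((integrable_const A).add (integrable_sum_count.const_mul B)).mono'
    Measurable.of_discrete.aestronglyMeasurable (.of_forall hH)

/-- A sub-family of independent Poisson variables. -/
theorem measurePreserving_comp_injective {A : Type*} [Fintype A] {f : A → T}
    (hf : Function.Injective f) :
    MeasurePreserving (fun η : T → ℕ => η ∘ f) (poissonPi T γ) (poissonPi A γ) := by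
  classical
  let e : A ⊕ {c // c ∈ (Set.range f)ᶜ} ≃ T :=
    ((Equiv.ofInjective f hf).sumCongr (Equiv.refl _)).trans (Equiv.Set.sumCompl (Set.range f))
  have h1 := (measurePreserving_piCongrLeft (α := fun _ : T => ℕ)
    (fun _ => poissonMeasure γ) e).symm
  have h2 := measurePreserving_sumPiEquivProdPi
    (X := fun _ : A ⊕ {c // c ∈ (Set.range f)ᶜ} => ℕ) (fun _ => poissonMeasure γ)
  exact measurePreserving_fst.comp (h2.comp h1)

/-- Discarding the coordinates outside the range of an injective map changes the expectation of a
function of independent Poisson variables by at most its Lipschitz constant in these coordinates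
times their expected sum. -/
theorem abs_integral_sub_integral_extend_le {A : Type*} [Fintype A] {f : A → T}
    (hf : Function.Injective f) {H : (T → ℕ) → ℝ} {a b C : ℝ}
    (hH : ∀ η, |H η| ≤ a + b * ∑ c, (η c : ℝ)) {R : Finset T}
    (hR : ∀ η, |H η - H (Function.extend f (η ∘ f) 0)| ≤ C * ∑ c ∈ R, (η c : ℝ)) (hb : 0 ≤ b) :
    |∫ η, H η ∂(poissonPi T γ) - ∫ η, H (Function.extend f η 0) ∂(poissonPi A γ)| ≤
      C * (γ * R.card) := by
  have h1 : ∫ η, H (Function.extend f η 0) ∂(poissonPi A γ) =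
      ∫ η, H (Function.extend f (η ∘ f) 0) ∂(poissonPi T γ) := by
    rw [← (measurePreserving_comp_injective (γ := γ) hf).map_eq,
      integral_map Measurable.of_discrete.aemeasurable
        Measurable.of_discrete.aestronglyMeasurable]
  have hi : Integrable (fun η => H (Function.extend f (η ∘ f) 0)) (poissonPi T γ) := by
    refine integrable_poissonPi_of_le (A := a) (B := b) fun η => (hH _).trans ?_
    gcongr with c
    by_cases hc : ∃ x, f x = c
    · obtain ⟨x, rfl⟩ := hc
      simp [hf.extend_apply]
    · simp [Function.extend_apply' _ _ _ hc]
  have hs : Integrable (fun η : T → ℕ => C * ∑ c ∈ R, (η c : ℝ)) (poissonPi T γ) :=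
    (integrable_finsetSum _ fun c _ => integrable_count c).const_mul C
  rw [h1, ← integral_sub (integrable_poissonPi_of_le hH) hi]
  calc _ ≤ ∫ η, |H η - H (Function.extend f (η ∘ f) 0)| ∂(poissonPi T γ) :=
        abs_integral_le_integral_abs
    _ ≤ ∫ η, C * ∑ c ∈ R, (η c : ℝ) ∂(poissonPi T γ) :=
        integral_mono ((integrable_poissonPi_of_le hH).sub hi).abs hs hR
    _ = _ := by
        rw [integral_const_mul, integral_finsetSum _ fun c _ => integrable_count c]
        have h (c : T) : ∫ η : T → ℕ, (η c : ℝ) ∂(poissonPi T γ) = γ := by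
          rw [← integral_natCast_poisson γ, ← (measurePreserving_eval_poissonPi (γ := γ) c).map_eq,
            integral_map (measurable_pi_apply c).aemeasurable (by fun_prop)]
        simp [h, mul_comm]

/-- Sums of independent Poisson families. -/
theorem measurePreserving_add_poissonPi (γ₁ γ₂ : ℝ≥0) :
    MeasurePreserving (fun p : (T → ℕ) × (T → ℕ) => p.1 + p.2)
      ((poissonPi T γ₁).prod (poissonPi T γ₂)) (poissonPi T (γ₁ + γ₂)) := by
  have h1 := (measurePreserving_arrowProdEquivProdArrow ℕ ℕ T
    (fun _ => poissonMeasure γ₁) (fun _ => poissonMeasure γ₂)).symm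
  have h2 : MeasurePreserving (fun (x : T → ℕ × ℕ) i => (x i).1 + (x i).2)
      (Measure.pi fun _ => (poissonMeasure γ₁).prod (poissonMeasure γ₂))
      (poissonPi T (γ₁ + γ₂)) := by
    refine measurePreserving_pi (f := fun _ (p : ℕ × ℕ) => p.1 + p.2) _ _
      fun _ => ⟨Measurable.of_discrete, ?_⟩
    rw [← poissonMeasure_conv_poissonMeasure]
    rfl
  exact h2.comp h1

/-- How often each element occurs among the values of `d`. -/
def counts {J : Type*} [Fintype J] (d : J → T) (c : T) : ℕ :=
  open Classical in (Finset.univ.filter fun j => d j = c).card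

theorem prod_pow_counts {J : Type*} [Fintype J] (d : J → T) {M : Type*} [CommMonoid M]
    (g : T → M) : ∏ c, g c ^ counts d c = ∏ j, g (d j) := by
  classical
  rw [← Finset.prod_fiberwise (s := Finset.univ) (g := d)]
  refine Finset.prod_congr rfl fun c _ => ?_
  rw [counts, ← Finset.prod_const]
  refine Finset.prod_congr (by congr!) fun j hj => ?_
  rw [(Finset.mem_filter.1 hj).2]

theorem sum_counts_mul {J : Type*} [Fintype J] (d : J → T) (g : T → ℝ) :
    ∑ c, (counts d c : ℝ) * g c = ∑ j, g (d j) := by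
  classical
  rw [← Finset.sum_fiberwise (s := Finset.univ) (g := d)]
  refine Finset.sum_congr rfl fun c _ => ?_
  rw [counts, ← nsmul_eq_mul, ← Finset.sum_const]
  refine Finset.sum_congr (by congr!) fun j hj => ?_
  rw [(Finset.mem_filter.1 hj).2]

theorem sum_counts {J : Type*} [Fintype J] (d : J → T) :
    ∑ c, counts d c = Fintype.card J := by
  have := sum_counts_mul d fun _ => 1
  simp only [mul_one, Finset.sum_const, Finset.card_univ, nsmul_eq_mul] at this
  exact_mod_cast this

/-- The number of sequences with given counts is a multinomial coefficient. Both count the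
occurrences of a monomial in a power of the sum of the indeterminates. -/
theorem card_counts_eq [DecidableEq T] (m : ℕ) (η : T → ℕ) (hη : ∑ c, η c = m) :
    (Finset.univ.filter fun d : Fin m → T => counts d = η).card =
      Nat.multinomial Finset.univ η := by
  classical
  have h1 := Finset.sum_pow_eq_sum_piAntidiag (R := MvPolynomial T ℕ) Finset.univ MvPolynomial.X m
  have h2 : (∑ c, (MvPolynomial.X c : MvPolynomial T ℕ)) ^ m =
      ∑ d : Fin m → T, ∏ j, MvPolynomial.X (d j) := by
    rw [Fintype.sum_pow]
  have hm (θ : T → ℕ) : ∏ c, (MvPolynomial.X c : MvPolynomial T ℕ) ^ θ c =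
      MvPolynomial.monomial (Finsupp.equivFunOnFinite.symm θ) 1 := by
    rw [MvPolynomial.monomial_eq, Finsupp.prod_fintype _ _ (by simp)]
    simp
  have h3 := congrArg (MvPolynomial.coeff (Finsupp.equivFunOnFinite.symm η)) (h2.symm.trans h1)
  simp_rw [← prod_pow_counts, hm, MvPolynomial.coeff_sum] at h3
  simp only [MvPolynomial.coeff_monomial, EmbeddingLike.apply_eq_iff_eq, ← nsmul_eq_mul,
    MvPolynomial.coeff_smul, smul_eq_mul, mul_ite, mul_one, mul_zero] at h3
  rw [Finset.sum_ite_eq_of_mem' _ _ _ (by simp [hη])] at h3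
  rw [← h3, Finset.card_filter]

theorem poissonPi_real_singleton (η : T → ℕ) :
    (poissonPi T γ).real {η} = Real.exp (-(γ * Fintype.card T)) * γ ^ (∑ c, η c) /
      ∏ c, ((η c).factorial : ℝ) := by
  rw [poissonPi, measureReal_def, Measure.pi_singleton, ENNReal.toReal_prod]
  simp_rw [← measureReal_def, poissonMeasure_real_singleton]
  rw [Finset.prod_div_distrib, Finset.prod_mul_distrib, Finset.prod_pow_eq_pow_sum]
  simp [← Real.exp_nat_mul, mul_comm]

theorem sum_counts_eq_sum_piAntidiag [DecidableEq T] (m : ℕ) (H : (T → ℕ) → ℝ) :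
    ∑ d : Fin m → T, H (counts d) =
      ∑ η ∈ Finset.piAntidiag Finset.univ m, (Nat.multinomial Finset.univ η : ℝ) * H η := by
  rw [← Finset.sum_fiberwise_of_maps_to (s := Finset.univ) (g := fun d : Fin m → T => counts d)
    (t := Finset.piAntidiag Finset.univ m) (fun d _ => by simp [sum_counts])]
  refine Finset.sum_congr rfl fun η hη => ?_
  rw [← card_counts_eq m η (by simpa using hη), ← nsmul_eq_mul, ← Finset.sum_const]
  exact Finset.sum_congr rfl fun d hd => by rw [(Finset.mem_filter.1 hd).2]

/-- Independent Poisson variables indexed by `T` arise by drawing a Poisson number of independent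
uniform elements of `T` and counting the occurrences of each. -/
theorem integral_poissonPi {H : (T → ℕ) → ℝ} (hH : Integrable H (poissonPi T γ)) :
    ∫ η, H η ∂(poissonPi T γ) =
      ∫ m, (𝔼 d : Fin m → T, H (counts d)) ∂(poissonMeasure (γ * Fintype.card T)) := by
  classical
  rw [integral_countable hH, integral_poissonMeasure]
  have hs : Summable fun η => (poissonPi T γ).real {η} • H η := by
    have h := hH
    rw [← Measure.sum_smul_dirac (poissonPi T γ)] at h
    refine (hasSum_integral_measure h).summable.congr fun η => ?_
    rw [integral_smul_measure, integral_dirac, measureReal_def]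
  refine (hs.hasSum.tsum_fiberwise fun η => ∑ c, η c).tsum_eq.symm.trans (tsum_congr fun m => ?_)
  have hset : (fun η : T → ℕ => ∑ c, η c) ⁻¹' {m} =
      ((Finset.piAntidiag Finset.univ m : Finset (T → ℕ)) : Set (T → ℕ)) := by
    ext η
    simp
  rw [hset, Finset.tsum_subtype' _ (fun η => (poissonPi T γ).real {η} • H η)]
  rw [Fintype.expect_eq_sum_div_card, sum_counts_eq_sum_piAntidiag, Finset.sum_div, Finset.smul_sum]
  refine Finset.sum_congr rfl fun η hη => ?_
  have hη : ∑ c, η c = m := by simpa using hη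
  rw [poissonPi_real_singleton, hη]
  have h1 : ((∏ c, ((η c).factorial : ℝ)) * Nat.multinomial Finset.univ η) = m.factorial := by
    rw [← hη]
    exact_mod_cast Nat.multinomial_spec Finset.univ η
  have h2 : (∏ c, ((η c).factorial : ℝ)) ≠ 0 := by positivity
  have h3 : ((m.factorial : ℕ) : ℝ) ≠ 0 := by positivity
  simp only [Fintype.card_pi, Finset.prod_const, Finset.card_univ, Fintype.card_fin, smul_eq_mul]
  push_cast
  rcases Nat.eq_zero_or_pos (Fintype.card T) with hT | hT
  · have : IsEmpty T := Fintype.card_eq_zero_iff.1 hT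
    have hm : m = 0 := by rw [← hη]; simp
    subst hm
    simp
  · have h4 : (Fintype.card T : ℝ) ≠ 0 := by positivity
    rw [mul_pow]
    field_simp
    rw [← h1]
    ring

end PoissonPi

/-! ### Poissonian formulas and the removal of a variable -/

/-- The truth value of a literal under an assignment of the variables in `V`. -/
def litVal {V : Type*} (x : V → Bool) (l : V × Bool) : Bool := x l.1 == l.2

/-- The Gibbs weight of a single clause, as a function of the truth values of its literals: it is
`exp (-β)` if all of them are false, and `1` otherwise. -/
def penalty (β : ℝ) {n : ℕ} (z : Fin n → Bool) : ℝ :=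
  if ∀ j, z j = false then Real.exp (-β) else 1

theorem penalty_pos (β : ℝ) {n : ℕ} (z : Fin n → Bool) : 0 < penalty β z := by
  unfold penalty
  split_ifs
  · exact Real.exp_pos _
  · exact one_pos

theorem penalty_le_one {β : ℝ} (hβ : 0 ≤ β) {n : ℕ} (z : Fin n → Bool) : penalty β z ≤ 1 := by
  unfold penalty
  split_ifs
  · simpa using hβ
  · exact le_rfl

theorem exp_le_penalty {β : ℝ} (hβ : 0 ≤ β) {n : ℕ} (z : Fin n → Bool) :
    Real.exp (-β) ≤ penalty β z := by
  unfold penalty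
  split_ifs
  · exact le_rfl
  · simpa using hβ

/-- The clauses of a Poissonian formula: `k`-tuples of literals, with repetitions allowed. -/
abbrev Tuple (k : ℕ) (V : Type*) : Type _ := Fin k → V × Bool

/-- The Gibbs weight of an assignment for a formula in which the clause `c` occurs `η c` times. -/
def weight (β : ℝ) {k : ℕ} {V : Type*} [Fintype V] (η : Tuple k V → ℕ) (x : V → Bool) : ℝ :=
  ∏ c, penalty β (fun j => litVal x (c j)) ^ η c

theorem weight_pos (β : ℝ) {k : ℕ} {V : Type*} [Fintype V] (η : Tuple k V → ℕ) (x : V → Bool) :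
    0 < weight β η x :=
  Finset.prod_pos fun _ _ => pow_pos (penalty_pos _ _) _

theorem weight_le_one {β : ℝ} (hβ : 0 ≤ β) {k : ℕ} {V : Type*} [Fintype V] (η : Tuple k V → ℕ)
    (x : V → Bool) : weight β η x ≤ 1 :=
  Finset.prod_le_one (fun _ _ => (pow_pos (penalty_pos _ _) _).le)
    fun _ _ => pow_le_one₀ (penalty_pos _ _).le (penalty_le_one hβ _)

/-- The literals of the clauses in which a given variable occurs, without that variable: the
variable occurs positively in `ℓ.1` clauses and negatively in `ℓ.2` clauses, and each of them has
`K` further literals. -/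
abbrev Nbr (K : ℕ) (ℓ : ℕ × ℕ) : Type := (Fin ℓ.1 ⊕ Fin ℓ.2) × Fin K

/-- The Gibbs weight of the clauses that contain a given variable, as a function of the value `y` of
that variable and of the truth values `z` of their other literals. -/
def branchWeight (β : ℝ) {K : ℕ} (ℓ : ℕ × ℕ) (y : Bool) (z : Nbr K ℓ → Bool) : ℝ :=
  ∏ a : Fin ℓ.1 ⊕ Fin ℓ.2, if a.isLeft = y then 1 else penalty β fun j => z (a, j)

theorem branchWeight_pos (β : ℝ) {K : ℕ} (ℓ : ℕ × ℕ) (y : Bool) (z : Nbr K ℓ → Bool) :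
    0 < branchWeight β ℓ y z := by
  refine Finset.prod_pos fun a _ => ?_
  split_ifs
  · exact one_pos
  · exact penalty_pos _ _

theorem branchWeight_le_one {β : ℝ} (hβ : 0 ≤ β) {K : ℕ} (ℓ : ℕ × ℕ) (y : Bool)
    (z : Nbr K ℓ → Bool) : branchWeight β ℓ y z ≤ 1 := by
  refine Finset.prod_le_one (fun a _ => ?_) fun a _ => ?_
  · split_ifs
    · exact zero_le_one
    · exact (penalty_pos _ _).le
  · split_ifs
    · exact le_rfl
    · exact penalty_le_one hβ _

/-! #### Averages over finite sets -/

theorem abs_expect_le {X : Type*} [Fintype X] {f : X → ℝ} {C : ℝ} (hC : 0 ≤ C)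
    (h : ∀ x, |f x| ≤ C) : |𝔼 x, f x| ≤ C := by
  rw [Fintype.expect_eq_sum_div_card, abs_div, Nat.abs_cast]
  refine div_le_of_le_mul₀ (by positivity) hC ((Finset.abs_sum_le_sum_abs _ _).trans ?_)
  refine (Finset.sum_le_sum fun x _ => h x).trans (by simp [mul_comm])

theorem integral_expect {X α : Type*} [Fintype X] [MeasurableSpace α] {μ : Measure α}
    {f : X → α → ℝ} (hf : ∀ x, Integrable (f x) μ) :
    ∫ a, (𝔼 x, f x a) ∂μ = 𝔼 x, ∫ a, f x a ∂μ := by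
  simp_rw [Fintype.expect_eq_sum_div_card]
  rw [integral_div, integral_finsetSum _ fun x _ => hf x]

theorem expect_prod_type {X Y : Type*} [Fintype X] [Fintype Y] (f : X × Y → ℝ) :
    𝔼 p, f p = 𝔼 x, 𝔼 y, f (x, y) := by
  rw [← Finset.univ_product_univ, Finset.expect_product]

/-- Averaging over components that do not matter has no effect. -/
theorem expect_snd_comp {P X : Type*} [Fintype P] [Nonempty P] [Fintype X] (m : ℕ)
    (g : (Fin m → X) → ℝ) :
    𝔼 d : Fin m → P × X, g (fun j => (d j).2) = 𝔼 d : Fin m → X, g d := by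
  refine (Fintype.expect_equiv (Equiv.arrowProdEquivProdArrow (Fin m) (fun _ => P) fun _ => X) _
    (fun p => g p.2) fun d => rfl).trans ?_
  rw [expect_prod_type]
  simp

theorem expect_nbr {X : Type*} [Fintype X] (K : ℕ) (ℓ : ℕ × ℕ) (g : (Nbr K ℓ → X) → ℝ) :
    𝔼 d : Nbr K ℓ → X, g d = 𝔼 d₁ : Fin ℓ.1 → Fin K → X, 𝔼 d₂ : Fin ℓ.2 → Fin K → X,
      g fun a => Sum.elim d₁ d₂ a.1 a.2 := by
  rw [← expect_prod_type fun p : (Fin ℓ.1 → Fin K → X) × (Fin ℓ.2 → Fin K → X) =>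
    g fun a => Sum.elim p.1 p.2 a.1 a.2]
  refine Fintype.expect_equiv ((Equiv.curry _ _ _).trans
    (Equiv.sumArrowEquivProdArrow _ _ _)) _ _ fun d => ?_
  congr 1
  ext ⟨a | a, j⟩ <;> rfl

theorem integral_add_mul_sum_count {T : Type*} [Fintype T] {γ : ℝ≥0} (a b : ℝ) :
    ∫ η : T → ℕ, (a + b * ∑ c, (η c : ℝ)) ∂(poissonPi T γ) = a + b * (γ * Fintype.card T) := by
  rw [integral_add (integrable_const _) (integrable_sum_count.const_mul b),
    integral_const_mul, integral_sum_count]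
  simp

theorem abs_integral_poissonPi_le {T : Type*} [Fintype T] {γ : ℝ≥0} {H : (T → ℕ) → ℝ} {a b : ℝ}
    (hH : ∀ η, |H η| ≤ a + b * ∑ c, (η c : ℝ)) :
    |∫ η, H η ∂(poissonPi T γ)| ≤ a + b * (γ * Fintype.card T) := by
  rw [← integral_add_mul_sum_count]
  exact abs_integral_le_integral_abs.trans (integral_mono (integrable_poissonPi_of_le hH).abs
    ((integrable_const _).add (integrable_sum_count.const_mul b)) hH)

theorem integral_poissonPi_sumType {A D : Type*} [Fintype A] [Fintype D] {γ : ℝ≥0}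
    {H : (A ⊕ D → ℕ) → ℝ} {a b : ℝ} (hH : ∀ θ, |H θ| ≤ a + b * ∑ c, (θ c : ℝ)) :
    ∫ θ, H θ ∂(poissonPi (A ⊕ D) γ) =
      ∫ θ', ∫ η, H (Sum.elim η θ') ∂(poissonPi A γ) ∂(poissonPi D γ) := by
  have hp := measurePreserving_sumPiEquivProdPi_symm
      (X := fun _ : A ⊕ D => ℕ) (fun _ => poissonMeasure γ)
  have hi := integrable_poissonPi_of_le (γ := γ) hH
  have he : ∀ p : (A → ℕ) × (D → ℕ),
      (MeasurableEquiv.sumPiEquivProdPi (fun _ : A ⊕ D => ℕ)).symm p = Sum.elim p.1 p.2 := by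
    intro p
    ext (c | c) <;> rfl
  rw [poissonPi, ← hp.map_eq, integral_map_equiv]
  simp_rw [he]
  refine integral_prod_symm _ ?_
  have := hp.integrable_comp_of_integrable hi
  simp_rw [Function.comp_def, he] at this
  exact this

/-- The expectation over independent Poisson variables indexed by `A`, `D` and `D` again, when the
variables indexed by the two copies of `D` are generated by sampling Poisson numbers of uniform
elements of `D`. -/
theorem integral_poissonPi_sum {A D : Type*} [Fintype A] [Fintype D] {γ : ℝ≥0}
    {H : (A ⊕ (D ⊕ D) → ℕ) → ℝ} {a b : ℝ} (ha : 0 ≤ a) (hb : 0 ≤ b)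
    (hH : ∀ θ, |H θ| ≤ a + b * ∑ c, (θ c : ℝ)) :
    ∫ θ, H θ ∂(poissonPi (A ⊕ (D ⊕ D)) γ) =
      ∫ ℓ, (𝔼 d₁ : Fin ℓ.1 → D, 𝔼 d₂ : Fin ℓ.2 → D,
        ∫ η, H (Sum.elim η (Sum.elim (counts d₁) (counts d₂))) ∂(poissonPi A γ))
        ∂((poissonMeasure (γ * Fintype.card D)).prod (poissonMeasure (γ * Fintype.card D))) := by
  set S : ℝ := γ * Fintype.card A with hS
  set Q : (D ⊕ D → ℕ) → ℝ := fun θ => ∫ η, H (Sum.elim η θ) ∂(poissonPi A γ) with hQ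
  have hQb (θ) : |Q θ| ≤ (a + b * S) + b * ∑ c, (θ c : ℝ) := by
    refine (abs_integral_poissonPi_le (a := a + b * ∑ c, (θ c : ℝ)) (b := b)
      fun η => (hH _).trans (le_of_eq ?_)).trans (le_of_eq ?_)
    · simp only [Fintype.sum_sum_type, Sum.elim_inl, Sum.elim_inr]
      ring
    · rw [hS]
      ring
  have hQe (η₁ η₂ : D → ℕ) : |Q (Sum.elim η₁ η₂)| ≤
      ((a + b * S) + b * ∑ c, (η₂ c : ℝ)) + b * ∑ c, (η₁ c : ℝ) :=
    (hQb _).trans (le_of_eq (by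
      simp only [Fintype.sum_sum_type, Sum.elim_inl, Sum.elim_inr]; ring))
  set R : (D → ℕ) → ℝ := fun η₂ => ∫ η₁, Q (Sum.elim η₁ η₂) ∂(poissonPi D γ) with hR
  have hRb (η₂) : |R η₂| ≤ (a + b * S + b * (γ * Fintype.card D)) + b * ∑ c, (η₂ c : ℝ) :=
    (abs_integral_poissonPi_le fun η₁ => hQe η₁ η₂).trans (le_of_eq (by ring))
  rw [integral_poissonPi_sumType hH, integral_poissonPi_sumType hQb]
  change ∫ η₂, R η₂ ∂(poissonPi D γ) = _
  rw [integral_poissonPi (integrable_poissonPi_of_le hRb)]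
  have hQc {m₁ m₂ : ℕ} (d₁ : Fin m₁ → D) (d₂ : Fin m₂ → D) :
      |Q (Sum.elim (counts d₁) (counts d₂))| ≤ (a + b * S) + b * (m₁ + m₂) := by
    refine (hQb _).trans (le_of_eq ?_)
    have h1 := sum_counts d₁
    have h2 := sum_counts d₂
    simp only [Fintype.card_fin] at h1 h2
    simp only [Fintype.sum_sum_type, Sum.elim_inl, Sum.elim_inr]
    rw [← Nat.cast_sum, ← Nat.cast_sum, h1, h2]
  have hS0 : 0 ≤ S := by positivity
  have hint (m : ℕ) (d₂ : Fin m → D) : Integrable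
      (fun m₁ : ℕ => 𝔼 d₁ : Fin m₁ → D, Q (Sum.elim (counts d₁) (counts d₂)))
      (poissonMeasure (γ * Fintype.card D)) := by
    refine integrable_poisson_of_le (A := a + b * S + b * m) (B := b) fun m₁ => ?_
    exact abs_expect_le (by positivity) fun d₁ => (hQc d₁ d₂).trans (le_of_eq (by ring))
  have hF : Integrable (fun ℓ : ℕ × ℕ => 𝔼 d₁ : Fin ℓ.1 → D, 𝔼 d₂ : Fin ℓ.2 → D,
      Q (Sum.elim (counts d₁) (counts d₂)))
      ((poissonMeasure (γ * Fintype.card D)).prod (poissonMeasure (γ * Fintype.card D))) := by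
    refine integrable_poisson_prod_of_le (A := a + b * S) (B := b) fun ℓ => ?_
    exact abs_expect_le (by positivity) fun d₁ => abs_expect_le (by positivity) fun d₂ => hQc d₁ d₂
  rw [integral_prod_symm _ hF]
  refine integral_congr_ae (.of_forall fun m₂ => ?_)
  simp only
  calc 𝔼 d₂ : Fin m₂ → D, R (counts d₂)
      = 𝔼 d₂ : Fin m₂ → D, ∫ m₁, (𝔼 d₁ : Fin m₁ → D, Q (Sum.elim (counts d₁) (counts d₂)))
        ∂(poissonMeasure (γ * Fintype.card D)) := by
        refine Finset.expect_congr rfl fun d₂ _ => ?_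
        exact integral_poissonPi (integrable_poissonPi_of_le fun η₁ => hQe η₁ _)
    _ = _ := by
        rw [← integral_expect fun d₂ => hint m₂ d₂]
        refine integral_congr_ae (.of_forall fun m₁ => ?_)
        exact Finset.expect_comm _ _ _

/-! #### The decomposition -/

section OneVertex

variable {K : ℕ} {V : Type} [Fintype V] [DecidableEq V]

/-- The literals that do not involve the variable `v₀`, as literals over all variables. -/
def liftLit {v₀ : V} (l : {v // v ≠ v₀} × Bool) : V × Bool := (l.1, l.2)

omit [Fintype V] [DecidableEq V] in
theorem liftLit_injective {v₀ : V} : Function.Injective (liftLit (v₀ := v₀)) := by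
  rintro ⟨⟨a, ha⟩, b⟩ ⟨⟨c, hc⟩, d⟩ h
  simpa [liftLit] using h

/-- The position of a variable in a clause together with the remaining literals. -/
abbrev Slot (K : ℕ) (V : Type) (v₀ : V) : Type := Fin (K + 1) × (Fin K → {v // v ≠ v₀} × Bool)

/-- The clauses in which the variable of the literal `l₀` occurs at most once: those without it,
those that contain `l₀`, and those that contain the negation of `l₀`. -/
def simpleClause (K : ℕ) (l₀ : V × Bool) :
    Tuple (K + 1) {v // v ≠ l₀.1} ⊕ (Slot K V l₀.1 ⊕ Slot K V l₀.1) → Tuple (K + 1) V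
  | .inl c => fun j => liftLit (c j)
  | .inr (.inl d) => d.1.insertNth l₀ fun j => liftLit (d.2 j)
  | .inr (.inr d) => d.1.insertNth (l₀.1, !l₀.2) fun j => liftLit (d.2 j)

omit [Fintype V] [DecidableEq V] in
theorem insertNth_liftLit_inj {v₀ : V} {s t : Bool} {d e : Slot K V v₀}
    (h : (d.1.insertNth (v₀, s) fun j => liftLit (d.2 j) : Tuple (K + 1) V) =
      e.1.insertNth (v₀, t) fun j => liftLit (e.2 j)) : s = t ∧ d = e := by
  obtain ⟨p, d⟩ := d
  obtain ⟨q, e⟩ := e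
  simp only at h
  have hpq : p = q := by
    by_contra hne
    obtain ⟨j, hj⟩ := Fin.exists_succAbove_eq hne
    have := congrFun h p
    rw [Fin.insertNth_apply_same, ← hj, Fin.insertNth_apply_succAbove] at this
    exact (e j).1.2 (congrArg Prod.fst this).symm
  subst hpq
  rw [Fin.insertNth_inj] at h
  obtain ⟨h1, h2⟩ := h
  refine ⟨congrArg Prod.snd h1, ?_⟩
  congr 1
  ext1 j
  exact liftLit_injective (congrFun h2 j)

omit [Fintype V] [DecidableEq V] in
theorem simpleClause_injective (l₀ : V × Bool) : Function.Injective (simpleClause K l₀) := by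
  have key (c : Tuple (K + 1) {v // v ≠ l₀.1}) (d : Slot K V l₀.1) (s : Bool) :
      (fun j => liftLit (c j)) ≠
        (d.1.insertNth (l₀.1, s) fun j => liftLit (d.2 j) : Tuple (K + 1) V) := by
    intro h
    have := congrFun h d.1
    rw [Fin.insertNth_apply_same] at this
    exact (c d.1).1.2 (congrArg Prod.fst this)
  rintro (c | d | d) (c' | d' | d') h
  · rw [show c = c' from funext fun j => liftLit_injective (congrFun h j)]
  · exact (key _ _ _ h).elim
  · exact (key _ _ _ h).elim
  · exact (key _ _ _ h.symm).elim
  · rw [(insertNth_liftLit_inj (s := l₀.2) (t := l₀.2) h).2]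
  · exact absurd (insertNth_liftLit_inj (s := l₀.2) (t := !l₀.2) h).1 (by simp)
  · exact (key _ _ _ h.symm).elim
  · exact absurd (insertNth_liftLit_inj (s := !l₀.2) (t := l₀.2) h).1 (by simp)
  · rw [(insertNth_liftLit_inj (s := !l₀.2) (t := !l₀.2) h).2]

/-- The clauses in which the variable `l₀.1` occurs at least twice. -/
def multiClauses (K : ℕ) (l₀ : V × Bool) : Finset (Tuple (K + 1) V) :=
  (Finset.univ.image (simpleClause K l₀))ᶜ

theorem card_multiClauses (l₀ : V × Bool) {N : ℕ} (hN : Fintype.card V = N + 1) :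
    ((multiClauses K l₀).card : ℝ) =
      (2 * (N + 1)) ^ (K + 1) - (2 * N) ^ (K + 1) - 2 * ((K + 1) * (2 * N) ^ K) := by
  have hN' : Fintype.card {v // v ≠ l₀.1} = N := by
    rw [Fintype.card_subtype_compl, hN, Fintype.card_subtype_eq]
    rfl
  have h := Finset.card_compl (Finset.univ.image (simpleClause K l₀))
  have h2 := Finset.card_le_univ (Finset.univ.image (simpleClause K l₀))
  rw [multiClauses, h, Nat.cast_sub h2,
    Finset.card_image_of_injective _ (simpleClause_injective l₀)]
  simp only [Finset.card_univ, Fintype.card_sum, Fintype.card_pi, Fintype.card_prod, hN, hN',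
    Finset.prod_const, Fintype.card_fin, Fintype.card_bool]
  push_cast
  ring

omit [DecidableEq V] in
theorem sum_extend {A : Type*} [Fintype A] {f : A → Tuple (K + 1) V}
    (hf : Function.Injective f) (η : A → ℕ) :
    ∑ c, ((Function.extend f η 0 c : ℕ) : ℝ) = ∑ a, (η a : ℝ) := by
  refine (Fintype.sum_of_injective f hf _ _ (fun c hc => ?_) fun a => ?_).symm
  · rw [Function.extend_apply' _ _ _ (by simpa using hc)]
    simp
  · rw [hf.extend_apply]

/-- If the variable of `l₀` occurs at most once in every clause, then the weight of a formula is the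
weight of the formula without this variable times the weight of the clauses that contain it. -/
theorem weight_extend (β : ℝ) (l₀ : V × Bool)
    (η : Tuple (K + 1) {v // v ≠ l₀.1} → ℕ) {ℓ : ℕ × ℕ} (d₁ : Fin ℓ.1 → Slot K V l₀.1)
    (d₂ : Fin ℓ.2 → Slot K V l₀.1) (x : V → Bool) :
    weight β (Function.extend (simpleClause K l₀)
      (Sum.elim η (Sum.elim (counts d₁) (counts d₂))) 0) x =
      weight β η (fun v => x v) * branchWeight β ℓ (litVal x l₀)
        fun a => litVal (fun v : {v // v ≠ l₀.1} => x v)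
          (Sum.elim (fun i => (d₁ i).2) (fun i => (d₂ i).2) a.1 a.2) := by
  have h := Fintype.prod_of_injective (simpleClause K l₀) (simpleClause_injective l₀)
    (fun a => penalty β (fun j => litVal x (simpleClause K l₀ a j)) ^
      Sum.elim η (Sum.elim (counts d₁) (counts d₂)) a)
    (fun c => penalty β (fun j => litVal x (c j)) ^ Function.extend (simpleClause K l₀)
      (Sum.elim η (Sum.elim (counts d₁) (counts d₂))) 0 c) (fun c hc => ?_) fun a => ?_
  -- a clause that contains a true literal has weight `1`
  · have hp (s : Bool) (d : Slot K V l₀.1) :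
        penalty β (fun j => litVal x
          ((d.1.insertNth (l₀.1, s) fun j => liftLit (d.2 j) : Tuple (K + 1) V) j)) =
        if litVal x (l₀.1, s) = true then 1 else
          penalty β fun j => litVal (fun v : {v // v ≠ l₀.1} => x v) (d.2 j) := by
      unfold penalty
      simp only [d.1.forall_iff_succAbove, Fin.insertNth_apply_same, Fin.insertNth_apply_succAbove]
      cases hs : litVal x (l₀.1, s)
      · simp only [true_and, Bool.false_eq_true, if_false]
        rfl
      · simp
    rw [weight, ← h, Fintype.prod_sum_type, Fintype.prod_sum_type]
    simp only [Sum.elim_inl, Sum.elim_inr]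
    rw [prod_pow_counts d₁ fun d => penalty β (fun j => litVal x (simpleClause K l₀ (.inr (.inl d)) j)),
      prod_pow_counts d₂ fun d => penalty β (fun j => litVal x (simpleClause K l₀ (.inr (.inr d)) j))]
    rw [branchWeight, Fintype.prod_sum_type]
    congr 1
    congr 1
    · refine Finset.prod_congr rfl fun i _ => ?_
      refine (hp l₀.2 (d₁ i)).trans ?_
      simp only [Sum.isLeft_inl, @eq_comm Bool true]
      rfl
    · refine Finset.prod_congr rfl fun i _ => ?_
      refine (hp (!l₀.2) (d₂ i)).trans ?_
      have : litVal x (l₀.1, !l₀.2) = true ↔ false = litVal x l₀ := by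
        simp only [litVal]
        cases x l₀.1 <;> cases l₀.2 <;> simp
      simp [this]
  · rw [Function.extend_apply' _ _ _ (by simpa using hc)]
    simp
  · rw [(simpleClause_injective l₀).extend_apply]

/-- The expectation of a function of a random formula is computed by revealing the clauses that
contain a given variable: Poisson numbers of clauses contain it positively and negatively, their
other literals are uniform and independent, and what remains is a random formula over the other
variables. The error comes from the clauses that contain the variable twice. -/
theorem abs_integral_sub_removeVertex_le {β : ℝ} (l₀ : V × Bool) (γ : ℝ≥0)
    {G : ((V → Bool) → ℝ) → ℝ} {a b C : ℝ} (ha : 0 ≤ a) (hb : 0 ≤ b)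
    (hG : ∀ η : Tuple (K + 1) V → ℕ, |G (weight β η)| ≤ a + b * ∑ c, (η c : ℝ))
    (hC : ∀ η η' : Tuple (K + 1) V → ℕ, (∀ c, η' c ≤ η c) →
      (∀ c ∉ multiClauses K l₀, η' c = η c) →
      |G (weight β η) - G (weight β η')| ≤ C * ∑ c ∈ multiClauses K l₀, (η c : ℝ)) :
    |∫ η, G (weight β η) ∂(poissonPi (Tuple (K + 1) V) γ) -
      ∫ ℓ, (𝔼 d : Nbr K ℓ → {v // v ≠ l₀.1} × Bool,
        ∫ η, G (fun x => weight β η (fun v => x v) * branchWeight β ℓ (litVal x l₀)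
            fun a => litVal (fun v : {v // v ≠ l₀.1} => x v) (d a))
          ∂(poissonPi (Tuple (K + 1) {v // v ≠ l₀.1}) γ))
        ∂((poissonMeasure (γ * Fintype.card (Slot K V l₀.1))).prod
          (poissonMeasure (γ * Fintype.card (Slot K V l₀.1))))| ≤
      C * (γ * (multiClauses K l₀).card) := by
  have hinj := simpleClause_injective (K := K) l₀
  set f := simpleClause K l₀ with hf
  refine le_trans (le_of_eq ?_) (abs_integral_sub_integral_extend_le (γ := γ) hinj hG
    (R := multiClauses K l₀) (C := C) (fun η => hC η _ (fun c => ?_) fun c hc => ?_) hb)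
  · congr 2
    rw [integral_poissonPi_sum (H := fun θ => G (weight β (Function.extend f θ 0)))
      ha hb fun θ => (hG _).trans (le_of_eq (by rw [sum_extend hinj]))]
    refine integral_congr_ae (.of_forall fun ℓ => ?_)
    simp only
    rw [expect_nbr, ← expect_snd_comp (P := Fin (K + 1))]
    refine Finset.expect_congr rfl fun d₁ _ => ?_
    rw [← expect_snd_comp (P := Fin (K + 1))]
    refine Finset.expect_congr rfl fun d₂ _ => integral_congr_ae (.of_forall fun η => ?_)
    simp only [hf]
    congr 1
    funext x
    exact (weight_extend β l₀ η d₁ d₂ x).symm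
  · by_cases h : ∃ x, f x = c
    · obtain ⟨x, rfl⟩ := h
      simp [hinj.extend_apply]
    · simp [Function.extend_apply' _ _ _ h]
  · have h : ∃ x, f x = c := by simpa only [multiClauses, Finset.mem_compl, not_not, Finset.mem_image,
      Finset.mem_univ, true_and] using hc
    obtain ⟨x, rfl⟩ := h
    simp [hinj.extend_apply]

end OneVertex

/-! ### Messages and fields -/

/-- The probability that a literal with field `h` is false. -/
def probFalse (h : ℝ) : ℝ := (1 + Real.exp (2 * h))⁻¹

theorem probFalse_eq_tanh (h : ℝ) : probFalse h = (1 - Real.tanh h) / 2 := by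
  rw [probFalse, Real.tanh_eq]
  have h1 : Real.exp (2 * h) = Real.exp h * Real.exp h := by rw [← Real.exp_add]; ring_nf
  have h2 : Real.exp (-h) = (Real.exp h)⁻¹ := Real.exp_neg h
  have h3 := Real.exp_pos h
  rw [h1, h2]
  field_simp
  ring

theorem probFalse_pos (h : ℝ) : 0 < probFalse h := by unfold probFalse; positivity

theorem probFalse_lt_one (h : ℝ) : probFalse h < 1 := by
  unfold probFalse
  refine inv_lt_one_of_one_lt₀ ?_
  linarith [Real.exp_pos (2 * h)]

theorem probFalse_le_half {h : ℝ} (hh : 0 ≤ h) : probFalse h ≤ 1 / 2 := by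
  rw [probFalse, one_div]
  refine inv_anti₀ two_pos ?_
  linarith [Real.one_le_exp (show 0 ≤ 2 * h by linarith)]

theorem one_sub_probFalse (h : ℝ) : 1 - probFalse h = Real.exp (2 * h) * probFalse h := by
  unfold probFalse
  have := Real.exp_pos (2 * h)
  field_simp
  ring

theorem continuous_probFalse : Continuous probFalse := by
  unfold probFalse
  refine Continuous.inv₀ (by fun_prop) fun h => ?_
  positivity

/-- The message sent by a clause whose other literals are independently false with probabilities
`p`. -/
def message (β : ℝ) {n : ℕ} (p : Fin n → ℝ) : ℝ :=
  -(1 / 2) * Real.log (1 - (1 - Real.exp (-β)) * ∏ i, p i)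

theorem bpFun_succ (K : ℕ) (β : ℝ) (h : Fin K → ℝ) :
    bpFun (K + 1) β h = message β fun j => probFalse (h j) := by
  unfold bpFun message
  have : (∏ j, probFalse (h j)) = (∏ j, (1 - Real.tanh (h j))) / 2 ^ K := by
    simp [probFalse_eq_tanh, Finset.prod_div_distrib]
  rw [this]
  have h2 : K + 1 - 1 = K := rfl
  congr 3
  change _ / 2 ^ K * ∏ i : Fin K, (1 - Real.tanh (h i)) = _
  ring

section Message

variable {β : ℝ} {n : ℕ}

theorem one_sub_exp_neg_mem (hβ : 0 ≤ β) :
    0 ≤ 1 - Real.exp (-β) ∧ 1 - Real.exp (-β) < 1 :=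
  ⟨by simpa using hβ, by linarith [Real.exp_pos (-β)]⟩

theorem exp_neg_le_one_sub (hβ : 0 ≤ β) {q : ℝ} (hq : q ≤ 1) :
    Real.exp (-β) ≤ 1 - (1 - Real.exp (-β)) * q := by
  nlinarith [(one_sub_exp_neg_mem hβ).1]

theorem exp_message (hβ : 0 ≤ β) {p : Fin n → ℝ} (hp : ∀ j, 0 ≤ p j ∧ p j ≤ 1) :
    Real.exp (-2 * message β p) = 1 - (1 - Real.exp (-β)) * ∏ i, p i := by
  have h1 : ∏ i, p i ≤ 1 := Finset.prod_le_one (fun i _ => (hp i).1) fun i _ => (hp i).2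
  rw [message, show ∀ x : ℝ, -2 * (-(1 / 2) * x) = x by intro x; ring,
    Real.exp_log ((Real.exp_pos _).trans_le (exp_neg_le_one_sub hβ h1))]

theorem message_nonneg (hβ : 0 ≤ β) {p : Fin n → ℝ} (hp : ∀ j, 0 ≤ p j ∧ p j ≤ 1) :
    0 ≤ message β p := by
  have h0 : 0 ≤ ∏ i, p i := Finset.prod_nonneg fun i _ => (hp i).1
  have h := exp_message hβ hp
  have h2 : Real.exp (-2 * message β p) ≤ 1 := by
    rw [h]
    nlinarith [(one_sub_exp_neg_mem hβ).1]
  linarith [Real.exp_le_one_iff.1 h2]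

theorem message_le (hβ : 0 ≤ β) {p : Fin n → ℝ} (hp : ∀ j, 0 ≤ p j ∧ p j ≤ 1) :
    message β p ≤ β / 2 := by
  have h1 : ∏ i, p i ≤ 1 := Finset.prod_le_one (fun i _ => (hp i).1) fun i _ => (hp i).2
  have h := exp_message hβ hp
  have h2 := exp_neg_le_one_sub hβ h1
  rw [← h, Real.exp_le_exp] at h2
  linarith

/-- The mean weight of a clause whose literals are independently false with probabilities `p`. -/
theorem sum_penalty_mul (p : Fin n → ℝ) :
    ∑ z : Fin n → Bool, penalty β z * ∏ j, (if z j then 1 - p j else p j) =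
      1 - (1 - Real.exp (-β)) * ∏ j, p j := by
  have h1 : ∑ z : Fin n → Bool, ∏ j, (if z j then 1 - p j else p j) = 1 := by
    rw [← Fintype.prod_sum fun j (b : Bool) => if b then 1 - p j else p j]
    simp
  have h2 (z : Fin n → Bool) : penalty β z * ∏ j, (if z j then 1 - p j else p j) =
      (∏ j, (if z j then 1 - p j else p j)) -
        if z = fun _ => false then (1 - Real.exp (-β)) * ∏ j, p j else 0 := by
    unfold penalty
    by_cases hz : z = fun _ => false
    · subst hz
      simp
      ring
    · rw [if_neg hz, if_neg fun h => hz (funext h)]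
      ring
  simp_rw [h2, Finset.sum_sub_distrib, h1]
  simp

/-- The message is Lipschitz in the incoming fields. The Lipschitz constant is a bound on the
probability that all incoming literals are false, along the segment from `h` to `h'`: a literal with
a nonnegative field, as granted by the flag `s j`, is false with probability at most `1 / 2`. -/
theorem abs_message_sub_le (hβ : 0 ≤ β) {h h' : Fin n → ℝ} {s : Fin n → Bool}
    (hs : ∀ j, s j = true → 0 ≤ h j) (hs' : ∀ j, s j = true → 0 ≤ h' j) :
    |message β (fun j => probFalse (h' j)) - message β (fun j => probFalse (h j))| ≤
      (∏ j, if s j then (1 / 2 : ℝ) else 1) * ∑ j, |h' j - h j| := by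
  set c := 1 - Real.exp (-β) with hc
  obtain ⟨hc0, hc1⟩ := one_sub_exp_neg_mem hβ
  rw [← hc] at hc0 hc1
  let y : ℝ → Fin n → ℝ := fun t j => h j + t * (h' j - h j)
  let P : ℝ → ℝ := fun t => ∏ j, probFalse (y t j)
  have hP (t : ℝ) : P t = Real.exp (∑ j, -Real.log (1 + Real.exp (2 * y t j))) := by
    rw [Real.exp_sum]
    refine Finset.prod_congr rfl fun j _ => ?_
    rw [Real.exp_neg, Real.exp_log (by positivity), probFalse]
  have hP0 (t : ℝ) : 0 < P t := Finset.prod_pos fun j _ => probFalse_pos _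
  have hPj (t : ℝ) (j : Fin n) : P t ≤ probFalse (y t j) := by
    change ∏ i, _ ≤ _
    rw [← Finset.mul_prod_erase _ _ (Finset.mem_univ j)]
    exact mul_le_of_le_one_right (probFalse_pos _).le
      (Finset.prod_le_one (fun i _ => (probFalse_pos _).le) fun i _ => (probFalse_lt_one _).le)
  have hPlt (t : ℝ) : P t ≤ 1 :=
    Finset.prod_le_one (fun j _ => (probFalse_pos _).le) fun j _ => (probFalse_lt_one _).le
  have hcP (t : ℝ) : 0 < 1 - c * P t := by nlinarith [hP0 t, hPlt t]
  have hd (t : ℝ) : HasDerivAt (fun t => message β fun j => probFalse (y t j))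
      (-(1 / 2) * (-(c * (P t * ∑ j, -(2 * (1 - probFalse (y t j)) * (h' j - h j)))) /
        (1 - c * P t))) t := by
    have h1 (j : Fin n) : HasDerivAt (fun t => -Real.log (1 + Real.exp (2 * y t j)))
        (-(2 * (1 - probFalse (y t j)) * (h' j - h j))) t := by
      have hy : HasDerivAt (fun t => y t j) (h' j - h j) t := by
        have := ((hasDerivAt_id t).mul_const (h' j - h j)).const_add (h j)
        rw [one_mul] at this
        exact this
      have h2 := (((hy.const_mul 2).exp).const_add 1).log (by positivity)
      refine h2.neg.congr_deriv ?_
      rw [one_sub_probFalse, probFalse]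
      field_simp
    have h3 : HasDerivAt P (P t * ∑ j, -(2 * (1 - probFalse (y t j)) * (h' j - h j))) t := by
      have h4 := (HasDerivAt.fun_sum fun j (_ : j ∈ Finset.univ) => h1 j).exp
      rw [← hP t] at h4
      exact h4.congr_of_eventuallyEq (.of_forall hP)
    exact (((h3.const_mul c).const_sub 1).log (hcP t).ne').const_mul _
  -- the derivative along the segment is `P t` times a combination of the differences of the fields
  -- whose coefficients are at most `1` in absolute value
  have hbound (t : ℝ) (ht : t ∈ Set.Icc (0 : ℝ) 1) :
      ‖-(1 / 2) * (-(c * (P t * ∑ j, -(2 * (1 - probFalse (y t j)) * (h' j - h j)))) /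
        (1 - c * P t))‖ ≤ (∏ j, if s j then (1 / 2 : ℝ) else 1) * ∑ j, |h' j - h j| := by
    have hq : P t ≤ ∏ j, if s j then (1 / 2 : ℝ) else 1 := by
      refine Finset.prod_le_prod (fun j _ => (probFalse_pos _).le) fun j _ => ?_
      by_cases hj : s j = true
      · rw [if_pos hj]
        refine probFalse_le_half ?_
        have h1 := hs j hj
        have h2 := hs' j hj
        have : y t j = (1 - t) * h j + t * h' j := by simp only [y]; ring
        rw [this]
        have := ht.1
        have := ht.2
        have : 0 ≤ 1 - t := by linarith
        positivity
      · rw [if_neg hj]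
        exact (probFalse_lt_one _).le
    have he : -(1 / 2) * (-(c * (P t * ∑ j, -(2 * (1 - probFalse (y t j)) * (h' j - h j)))) /
        (1 - c * P t)) =
        -(P t * ∑ j, (c * (1 - probFalse (y t j)) / (1 - c * P t)) * (h' j - h j)) := by
      have := (hcP t).ne'
      rw [Finset.sum_neg_distrib]
      simp_rw [mul_assoc (2 : ℝ)]
      rw [← Finset.mul_sum]
      have : ∑ j, (c * (1 - probFalse (y t j)) / (1 - c * P t)) * (h' j - h j) =
          c / (1 - c * P t) * ∑ j, (1 - probFalse (y t j)) * (h' j - h j) := by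
        rw [Finset.mul_sum]
        refine Finset.sum_congr rfl fun j _ => ?_
        ring
      rw [this]
      field_simp
    rw [he, norm_neg, norm_mul, Real.norm_of_nonneg (hP0 t).le]
    refine mul_le_mul hq ?_ (norm_nonneg _) ((hP0 t).le.trans hq)
    refine (norm_sum_le _ _).trans (Finset.sum_le_sum fun j _ => ?_)
    rw [norm_mul, Real.norm_eq_abs, Real.norm_eq_abs]
    refine mul_le_of_le_one_left (abs_nonneg _) ?_
    have h1 := probFalse_lt_one (y t j)
    -- `c * (1 - q) ≤ 1 - c * P` for the probability `q` that the literal `j` is false, since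
    -- `P ≤ q` and `c ≤ 1`
    have h2 := hPj t j
    rw [abs_of_nonneg (div_nonneg (mul_nonneg hc0 (by linarith)) (hcP t).le),
      div_le_one (hcP t)]
    nlinarith
  have := (convex_Icc (0 : ℝ) 1).norm_image_sub_le_of_norm_hasDerivWithin_le
    (fun t _ => (hd t).hasDerivWithinAt) hbound (Set.left_mem_Icc.2 zero_le_one)
    (Set.right_mem_Icc.2 zero_le_one)
  simpa [y] using this

end Message

/-! ### Product measures with fields in prescribed intervals -/

/-- What is recorded about a literal of the local tree: a reference field `h`, a flag that is set if
the clauses of its variable force all possible fields to be nonnegative, and a bound on the distance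
of the possible fields from `h`. The bound `⊤` allows arbitrary marginals of the literal. -/
abbrev FieldData : Type := ℝ × Bool × ℝ≥0∞

/-- The probabilities of being false that are compatible with the data `z`. If the radius is `⊤`,
these are all numbers in `[0, 1]`, including `0` and `1`, which no finite field yields. Otherwise the
set is empty if the flag is set while the reference field is negative. -/
def allowed (z : FieldData) : Set ℝ :=
  {p | 0 ≤ p ∧ p ≤ 1 ∧ (z.2.2 = ⊤ ∨ (z.2.1 = true → 0 ≤ z.1) ∧
    ∃ h', p = probFalse h' ∧ (z.2.1 = true → 0 ≤ h') ∧ ENNReal.ofReal |h' - z.1| ≤ z.2.2)}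

/-- A bound on the probability that a literal is false: `1 / 2` if its field is known to be
nonnegative, and the trivial bound otherwise. -/
def falseBound (s : Bool) : ℝ≥0∞ := if s then 2⁻¹ else 1

/-- The weights of independent truth values that are false with probabilities `p`. -/
def prodWeight {ι : Type*} [Fintype ι] (p : ι → ℝ) (y : ι → Bool) : ℝ :=
  ∏ i, if y i then 1 - p i else p i

theorem prodWeight_nonneg {ι : Type*} [Fintype ι] {p : ι → ℝ} (hp : ∀ i, 0 ≤ p i ∧ p i ≤ 1)
    (y : ι → Bool) : 0 ≤ prodWeight p y := by
  refine Finset.prod_nonneg fun i _ => ?_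
  have := hp i
  split_ifs <;> linarith

theorem sum_prodWeight {ι : Type*} [Fintype ι] [DecidableEq ι] (p : ι → ℝ) :
    ∑ y, prodWeight p y = 1 := by
  unfold prodWeight
  rw [← Fintype.prod_sum fun j (b : Bool) => if b then 1 - p j else p j]
  simp

/-- The mixtures of product measures whose marginals are compatible with the data `z`, up to
normalisation. Nonnegative multiples and sums of mixtures are mixtures, which is expressed by a
submodule over the nonnegative reals. -/
def mixtures {ι : Type*} [Fintype ι] (z : ι → FieldData) : Submodule ℝ≥0 ((ι → Bool) → ℝ) :=
  Submodule.span ℝ≥0 {m | ∃ p : ι → ℝ, (∀ i, p i ∈ allowed (z i)) ∧ m = prodWeight p}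

theorem mixtures_nonneg {ι : Type*} [Fintype ι] {z : ι → FieldData} {m : (ι → Bool) → ℝ}
    (hm : m ∈ mixtures z) : 0 ≤ m := by
  induction hm using Submodule.span_induction with
  | mem m hm =>
    obtain ⟨p, hp, rfl⟩ := hm
    exact fun y => prodWeight_nonneg (fun i => ⟨(hp i).1, (hp i).2.1⟩) y
  | zero => exact le_rfl
  | add m m' _ _ h h' => exact add_nonneg h h'
  | smul a m _ h => exact smul_nonneg a.2 h

/-- Without constraints on the marginals, every nonnegative function is a mixture. -/
theorem mem_mixtures_of_top {ι : Type*} [Fintype ι] [DecidableEq ι] {z : ι → FieldData}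
    (hz : ∀ i, (z i).2.2 = ⊤) {m : (ι → Bool) → ℝ} (hm : 0 ≤ m) : m ∈ mixtures z := by
  have h : m = ∑ y, (m y).toNNReal • prodWeight fun i => if y i then 0 else 1 := by
    ext y'
    rw [Finset.sum_apply, Finset.sum_eq_single y']
    · have : prodWeight (fun i => if y' i then 0 else 1) y' = 1 :=
        Finset.prod_eq_one fun i _ => by cases h : y' i <;> simp [h]
      rw [Pi.smul_apply, this, NNReal.smul_def, smul_eq_mul, mul_one, Real.coe_toNNReal _ (hm y')]
    · intro y _ hy
      obtain ⟨i, hi⟩ := Function.ne_iff.1 hy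
      have : prodWeight (fun i => if y i then 0 else 1) y' = 0 := by
        refine Finset.prod_eq_zero (Finset.mem_univ i) ?_
        cases h : y i <;> cases h' : y' i <;> simp_all
      rw [Pi.smul_apply, this, smul_zero]
    · simp
  rw [h]
  refine Submodule.sum_mem _ fun y _ => Submodule.smul_mem _ _ (Submodule.subset_span ⟨_, ?_, rfl⟩)
  intro i
  refine ⟨?_, ?_, Or.inl (hz i)⟩ <;> (split_ifs <;> norm_num)

section Vertex

variable {K : ℕ}

/-- The message of a clause, for reference fields. -/
def dataMessage (β : ℝ) (z : Fin K → FieldData) : ℝ := message β fun j => probFalse (z j).1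

/-- A bound on the distance of the possible messages of a clause from the reference message. All
messages lie in `[0, β / 2]`, so that the bound is finite even if nothing is known about the fields
of the other literals. -/
def dataRadius (β : ℝ) (z : Fin K → FieldData) : ℝ≥0∞ :=
  min (ENNReal.ofReal (β / 2)) ((∏ j, falseBound (z j).2.1) * ∑ j, (z j).2.2)

/-- The data of a variable, computed from the data of the other variables in its clauses. -/
def vertexData (β : ℝ) (ℓ : ℕ × ℕ) (z : Nbr K ℓ → FieldData) : FieldData :=
  (∑ i, dataMessage β (fun j => z (.inl i, j)) - ∑ i, dataMessage β (fun j => z (.inr i, j)),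
    decide (ℓ.2 = 0), ∑ a, dataRadius β fun j => z (a, j))

theorem abs_message_sub_dataMessage_le {β : ℝ} (hβ : 0 ≤ β) {z : Fin K → FieldData} {p : Fin K → ℝ}
    (hp : ∀ j, p j ∈ allowed (z j)) :
    ENNReal.ofReal |message β p - dataMessage β z| ≤ dataRadius β z := by
  refine le_min (ENNReal.ofReal_le_ofReal ?_) ?_
  · have h0 : ∀ j, 0 ≤ p j ∧ p j ≤ 1 := fun j => ⟨(hp j).1, (hp j).2.1⟩
    have h1 : ∀ j, 0 ≤ probFalse (z j).1 ∧ probFalse (z j).1 ≤ 1 :=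
      fun j => ⟨(probFalse_pos _).le, (probFalse_lt_one _).le⟩
    have := message_nonneg hβ h0
    have := message_le hβ h0
    have := message_nonneg hβ h1
    have := message_le hβ h1
    unfold dataMessage
    rw [abs_le]
    constructor <;> linarith
  · by_cases htop : ∃ j, (z j).2.2 = ⊤
    · obtain ⟨j, hj⟩ := htop
      have h1 : ∑ j, (z j).2.2 = ⊤ := ENNReal.sum_eq_top.2 ⟨j, Finset.mem_univ j, hj⟩
      have h2 : ∏ j, falseBound (z j).2.1 ≠ 0 :=
        Finset.prod_ne_zero_iff.2 fun j _ => by unfold falseBound; split_ifs <;> simp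
      rw [h1, ENNReal.mul_top h2]
      exact le_top
    · push Not at htop
      have h1 (j) := ((hp j).2.2.resolve_left (htop j))
      choose hs h' hph hs' hr using h1
      obtain rfl : p = fun j => probFalse (h' j) := funext hph
      refine (ENNReal.ofReal_le_ofReal (abs_message_sub_le hβ hs hs')).trans ?_
      rw [ENNReal.ofReal_mul (by positivity), ENNReal.ofReal_prod_of_nonneg (by
        intro j _; split_ifs <;> norm_num), ENNReal.ofReal_sum_of_nonneg (by
        intro j _; positivity)]
      refine mul_le_mul' (le_of_eq (Finset.prod_congr rfl fun j _ => ?_))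
        (Finset.sum_le_sum fun j _ => hr j)
      unfold falseBound
      split_ifs <;> simp

/-- A clause with a message `u` contributes a factor `exp (-2 u)` if the given variable does not
satisfy it, and the factor `1` otherwise. -/
theorem sum_prodWeight_mul_branchWeight {β : ℝ} (hβ : 0 ≤ β) {ℓ : ℕ × ℕ} {p : Nbr K ℓ → ℝ}
    (hp : ∀ a, 0 ≤ p a ∧ p a ≤ 1) (y : Bool) :
    ∑ w, prodWeight p w * branchWeight β ℓ y w =
      ∏ a : Fin ℓ.1 ⊕ Fin ℓ.2, if a.isLeft = y then 1 else
        Real.exp (-2 * message β fun j => p (a, j)) := by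
  have h1 (w : Nbr K ℓ → Bool) : prodWeight p w * branchWeight β ℓ y w =
      ∏ a, ((if a.isLeft = y then 1 else penalty β fun j => w (a, j)) *
        ∏ j, if w (a, j) then 1 - p (a, j) else p (a, j)) := by
    rw [Finset.prod_mul_distrib, mul_comm, prodWeight, branchWeight, Fintype.prod_prod_type]
  simp_rw [h1]
  rw [← (Equiv.curry _ _ _).symm.sum_comp]
  simp only [Equiv.curry_symm_apply, Function.uncurry_apply_pair]
  rw [← Fintype.prod_sum fun a (w : Fin K → Bool) =>
    (if a.isLeft = y then 1 else penalty β fun j => w j) *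
        ∏ j, if w j then 1 - p (a, j) else p (a, j)]
  refine Finset.prod_congr rfl fun a _ => ?_
  split_ifs with ha
  · simp only [one_mul]
    exact sum_prodWeight fun j => p (a, j)
  · rw [sum_penalty_mul, exp_message hβ fun j => hp (a, j)]

/-- Summing the clauses of a variable over independent other literals gives a multiple of the weight
of a truth value with the sum of the messages as its field. -/
theorem exists_sum_branchWeight {β : ℝ} (hβ : 0 ≤ β) {ℓ : ℕ × ℕ} {z : Nbr K ℓ → FieldData}
    {p : Nbr K ℓ → ℝ} (hp : ∀ a, p a ∈ allowed (z a)) :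
    ∃ C : ℝ≥0, ∃ q ∈ allowed (vertexData β ℓ z), ∀ y,
      ∑ w, prodWeight p w * branchWeight β ℓ y w = C * if y then 1 - q else q := by
  have h0 : ∀ a, ∀ j, 0 ≤ p (a, j) ∧ p (a, j) ≤ 1 := fun a j => ⟨(hp _).1, (hp _).2.1⟩
  set u : Fin ℓ.1 ⊕ Fin ℓ.2 → ℝ := fun a => message β fun j => p (a, j) with hu
  have hsum (y : Bool) : ∑ w, prodWeight p w * branchWeight β ℓ y w =
      ∏ a, if a.isLeft = y then 1 else Real.exp (-2 * u a) :=
    sum_prodWeight_mul_branchWeight hβ (fun a => ⟨(hp a).1, (hp a).2.1⟩) y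
  set h' : ℝ := ∑ i, u (.inl i) - ∑ i, u (.inr i) with hh'
  set A : ℝ := Real.exp (-2 * ∑ i, u (.inl i)) with hA
  set B : ℝ := Real.exp (-2 * ∑ i, u (.inr i)) with hB
  have htrue : ∑ w, prodWeight p w * branchWeight β ℓ true w = B := by
    rw [hsum, Fintype.prod_sum_type, hB, Finset.mul_sum, Real.exp_sum]
    simp
  have hfalse : ∑ w, prodWeight p w * branchWeight β ℓ false w = A := by
    rw [hsum, Fintype.prod_sum_type, hA, Finset.mul_sum, Real.exp_sum]
    simp
  have hBA : B = Real.exp (2 * h') * A := by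
    rw [hA, hB, ← Real.exp_add, hh']
    ring_nf
  have hA0 : 0 < A := Real.exp_pos _
  have hB0 : 0 < B := Real.exp_pos _
  have hq : probFalse h' = A / (A + B) := by
    rw [probFalse, hBA]
    field_simp
  refine ⟨(A + B).toNNReal, probFalse h', ⟨(probFalse_pos _).le, (probFalse_lt_one _).le,
    Or.inr ⟨fun hs => ?_, h', rfl, fun hs => ?_, ?_⟩⟩, fun y => ?_⟩
  · have hℓ : ℓ.2 = 0 := by simpa [vertexData] using hs
    have : IsEmpty (Fin ℓ.2) := by rw [hℓ]; infer_instance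
    simp only [vertexData, Finset.univ_eq_empty, Finset.sum_empty, sub_zero]
    exact Finset.sum_nonneg fun i _ => message_nonneg hβ fun j =>
      ⟨(probFalse_pos _).le, (probFalse_lt_one _).le⟩
  · have hℓ : ℓ.2 = 0 := by simpa [vertexData] using hs
    have : IsEmpty (Fin ℓ.2) := by rw [hℓ]; infer_instance
    simp only [hh', Finset.univ_eq_empty, Finset.sum_empty, sub_zero]
    exact Finset.sum_nonneg fun i _ => message_nonneg hβ (h0 _)
  · simp only [vertexData]
    refine le_trans (ENNReal.ofReal_le_ofReal (?_ : _ ≤ ∑ a, |u a - dataMessage β fun j => z (a, j)|)) ?_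
    · rw [Fintype.sum_sum_type, hh']
      have h1 := Finset.abs_sum_le_sum_abs (fun i => u (.inl i) - dataMessage β fun j => z (.inl i, j))
        Finset.univ
      have h2 := Finset.abs_sum_le_sum_abs (fun i => u (.inr i) - dataMessage β fun j => z (.inr i, j))
        Finset.univ
      rw [Finset.sum_sub_distrib] at h1 h2
      refine le_trans (le_of_eq (congrArg _ ?_)) ((abs_sub _ _).trans (add_le_add h1 h2))
      ring
    · rw [ENNReal.ofReal_sum_of_nonneg fun _ _ => abs_nonneg _]
      exact Finset.sum_le_sum fun a _ => abs_message_sub_dataMessage_le hβ fun j => hp (a, j)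
  · rw [Real.coe_toNNReal _ (by positivity)]
    cases y
    · rw [hfalse, hq]
      simp only [Bool.false_eq_true, if_false]
      field_simp
    · rw [htrue, hq]
      simp only [if_true]
      field_simp
      ring

variable {ι : Type} [Fintype ι] [DecidableEq ι]

/-- The effect on joint marginals of adding a variable with index `i₀` and its clauses, whose other
literals are indexed by `Nbr K ℓ`. -/
def attachVertex (β : ℝ) (i₀ : ι) (ℓ : ℕ × ℕ) (m : ({i // i ≠ i₀} ⊕ Nbr K ℓ → Bool) → ℝ)
    (y : ι → Bool) : ℝ :=
  ∑ w : Nbr K ℓ → Bool, m (Sum.elim (fun i => y i) w) * branchWeight β ℓ (y i₀) w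

/-- The data of the variables indexed by `ι` if the variable with index `i₀` has the clauses whose
other literals are indexed by `Nbr K ℓ`. -/
def attachData (β : ℝ) (i₀ : ι) (ℓ : ℕ × ℕ) (z : {i // i ≠ i₀} ⊕ Nbr K ℓ → FieldData) (i : ι) :
    FieldData :=
  if h : i = i₀ then vertexData β ℓ fun a => z (.inr a) else z (.inl ⟨i, h⟩)

/-- The image of a product measure under `attachVertex` is a multiple of a product measure, so that
`attachVertex` maps mixtures to mixtures by linearity. -/
theorem attachVertex_mem_mixtures {β : ℝ} (hβ : 0 ≤ β) {i₀ : ι} {ℓ : ℕ × ℕ}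
    {z : {i // i ≠ i₀} ⊕ Nbr K ℓ → FieldData} {m : ({i // i ≠ i₀} ⊕ Nbr K ℓ → Bool) → ℝ}
    (hm : m ∈ mixtures z) : attachVertex β i₀ ℓ m ∈ mixtures (attachData β i₀ ℓ z) := by
  induction hm using Submodule.span_induction with
  | mem m hm =>
    obtain ⟨p, hp, rfl⟩ := hm
    obtain ⟨C, q, hq, hC⟩ := exists_sum_branchWeight hβ (ℓ := ℓ) (z := fun a => z (.inr a))
      (p := fun a => p (.inr a)) fun a => hp _
    have h : attachVertex β i₀ ℓ (prodWeight p) =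
        C • prodWeight fun i => if h : i = i₀ then q else p (.inl ⟨i, h⟩) := by
      ext y
      have h1 (w : Nbr K ℓ → Bool) : prodWeight p (Sum.elim (fun i => y i) w) =
          prodWeight (fun i => p (.inl i)) (fun i : {i // i ≠ i₀} => y i) *
            prodWeight (fun a => p (.inr a)) w := by
        rw [prodWeight, Fintype.prod_sum_type]
        rfl
      simp only [attachVertex, h1, mul_assoc]
      rw [← Finset.mul_sum, hC, Pi.smul_apply, NNReal.smul_def, smul_eq_mul, mul_left_comm]
      congr 1
      rw [prodWeight, prodWeight, mul_comm,
        ← Finset.mul_prod_erase _ _ (Finset.mem_univ i₀)]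
      simp only [dif_pos]
      congr 1
      refine Eq.trans (Finset.prod_congr rfl fun i _ => ?_)
        (Finset.prod_subtype (Finset.univ.erase i₀) (p := fun i => i ≠ i₀) (by simp)
          fun i => if y i then 1 - (if h : i = i₀ then q else p (.inl ⟨i, h⟩)) else
            if h : i = i₀ then q else p (.inl ⟨i, h⟩)).symm
      simp only [dif_neg i.2]
    rw [h]
    refine Submodule.smul_mem _ _ (Submodule.subset_span ⟨_, fun i => ?_, rfl⟩)
    unfold attachData
    split_ifs with hi
    · exact hq
    · exact hp _
  | zero =>
    have : attachVertex (K := K) β i₀ ℓ 0 = 0 := by ext y; simp [attachVertex]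
    rw [this]
    exact Submodule.zero_mem _
  | add m m' _ _ h h' =>
    have : attachVertex β i₀ ℓ (m + m') = attachVertex β i₀ ℓ m + attachVertex β i₀ ℓ m' := by
      ext y
      simp [attachVertex, add_mul, Finset.sum_add_distrib]
    rw [this]
    exact Submodule.add_mem _ h h'
  | smul a m _ h =>
    have : attachVertex β i₀ ℓ (a • m) = a • attachVertex β i₀ ℓ m := by
      ext y
      simp [attachVertex, Finset.smul_sum]
    rw [this]
    exact Submodule.smul_mem _ _ h

omit [Fintype ι] in
theorem attachVertex_ne_zero (β : ℝ) {i₀ : ι} {ℓ : ℕ × ℕ}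
    {m : ({i // i ≠ i₀} ⊕ Nbr K ℓ → Bool) → ℝ} (hm : 0 ≤ m) (hm0 : m ≠ 0) :
    attachVertex β i₀ ℓ m ≠ 0 := by
  obtain ⟨w, hw⟩ := Function.ne_iff.1 hm0
  intro h
  have h1 := congrFun h fun i => if h : i = i₀ then true else w (.inl ⟨i, h⟩)
  simp only [attachVertex, Pi.zero_apply] at h1
  rw [Finset.sum_eq_zero_iff_of_nonneg] at h1
  · rcases mul_eq_zero.1 (h1 (fun a => w (.inr a)) (Finset.mem_univ _)) with h3 | h3
    · refine hw (Eq.trans (congrArg m ?_) h3)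
      funext i
      rcases i with i | a
      · change w (.inl i) = if h : (i : ι) = i₀ then true else w (.inl ⟨i, h⟩)
        rw [dif_neg i.2]
      · rfl
    · exact (branchWeight_pos β ℓ _ _).ne' h3
  · exact fun v _ => mul_nonneg (hm _) (branchWeight_pos β ℓ _ v).le

end Vertex

/-! ### Product measures and Poisson mixtures -/

section ProductMeasures

theorem measurePreserving_pi_comp_injective {A T X : Type*} [Fintype A] [Fintype T]
    [MeasurableSpace X] (μ : T → Measure X) [∀ i, IsProbabilityMeasure (μ i)] {f : A → T}
    (hf : Function.Injective f) :
    MeasurePreserving (fun z : T → X => fun a => z (f a)) (Measure.pi μ)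
      (Measure.pi fun a => μ (f a)) := by
  refine ⟨by fun_prop, (Measure.pi_eq fun s hs => ?_).symm⟩
  classical
  rw [Measure.map_apply (by fun_prop) (.univ_pi hs)]
  have h : (fun (z : T → X) a => z (f a)) ⁻¹' Set.univ.pi s =
      Set.univ.pi fun i => if h : ∃ a, f a = i then s h.choose else Set.univ := by
    ext z
    simp only [Set.mem_preimage, Set.mem_pi, Set.mem_univ, true_imp_iff]
    refine ⟨fun hz i => ?_, fun hz a => ?_⟩
    · split_ifs with h
      · have := hz h.choose
        rwa [h.choose_spec] at this
      · trivial
    · have h : ∃ b, f b = f a := ⟨a, rfl⟩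
      have := hz (f a)
      rw [dif_pos h] at this
      rwa [hf h.choose_spec] at this
  rw [h, Measure.pi_pi]
  refine (Fintype.prod_of_injective f hf _ _ (fun i hi => ?_) fun a => ?_).symm
  · rw [dif_neg (by simpa using hi), measure_univ]
  · have h : ∃ b, f b = f a := ⟨a, rfl⟩
    rw [dif_pos h, hf h.choose_spec]

theorem measurePreserving_curry {A B X : Type*} [Fintype A] [Fintype B] [MeasurableSpace X]
    (μ : Measure X) [IsProbabilityMeasure μ] :
    MeasurePreserving (fun z : A × B → X => fun a b => z (a, b)) (Measure.pi fun _ => μ)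
      (Measure.pi fun _ : A => Measure.pi fun _ : B => μ) := by
  refine ⟨by fun_prop, ?_⟩
  have h := Measure.infinitePi_map_curry (fun (_ : A) (_ : B) => μ)
  simp_rw [Measure.infinitePi_eq_pi] at h
  exact h

theorem lintegral_prod_pi {A X : Type*} [Fintype A] [MeasurableSpace X] (μ : Measure X)
    [IsProbabilityMeasure μ] {g : A → X → ℝ≥0∞} (hg : ∀ a, Measurable (g a)) :
    ∫⁻ z, ∏ a, g a (z a) ∂(Measure.pi fun _ : A => μ) = ∏ a, ∫⁻ x, g a x ∂μ := by
  refine (lintegral_prod_eq_prod_lintegral_of_indepFun (μ := Measure.pi fun _ : A => μ) Finset.univ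
    (fun a (z : A → X) => g a (z a)) (iIndepFun_pi fun a => (hg a).aemeasurable)
    fun a => (hg a).comp (measurable_pi_apply a)).trans ?_
  refine Finset.prod_congr rfl fun a _ => ?_
  exact (measurePreserving_eval (fun _ : A => μ) a).lintegral_comp (hg a)

theorem isProbabilityMeasure_bind {σ X : Type*} [MeasurableSpace σ] [Countable σ]
    [DiscreteMeasurableSpace σ] [MeasurableSpace X] {P : Measure σ} [IsProbabilityMeasure P]
    {κ : σ → Measure X} (hκ : ∀ s, IsProbabilityMeasure (κ s)) :
    IsProbabilityMeasure (P.bind κ) := by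
  refine ⟨?_⟩
  rw [Measure.bind_apply .univ Measurable.of_discrete.aemeasurable]
  simp

theorem integral_bind_of_bounded {σ X : Type*} [MeasurableSpace σ] [Countable σ]
    [DiscreteMeasurableSpace σ] [MeasurableSpace X] {P : Measure σ} [IsProbabilityMeasure P]
    {κ : σ → Measure X} (hκ : ∀ s, IsProbabilityMeasure (κ s)) {B : X → ℝ} (hB : Measurable B)
    {C : ℝ} (hC : ∀ x, |B x| ≤ C) :
    ∫ x, B x ∂(P.bind κ) = ∫ s, ∫ x, B x ∂(κ s) ∂P := by
  have := isProbabilityMeasure_bind (P := P) hκ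
  have key (B : X → ℝ) (hB : Measurable B) (hB0 : 0 ≤ B) (C : ℝ) (hC : ∀ x, |B x| ≤ C) :
      ∫ x, B x ∂(P.bind κ) = ∫ s, ∫ x, B x ∂(κ s) ∂P := by
    have hint (s) : Integrable B (κ s) :=
      .of_bound hB.aestronglyMeasurable C (.of_forall hC)
    rw [integral_eq_lintegral_of_nonneg_ae (.of_forall hB0) hB.aestronglyMeasurable,
      integral_eq_lintegral_of_nonneg_ae (.of_forall fun s => integral_nonneg hB0)
        Measurable.of_discrete.aestronglyMeasurable,
      Measure.lintegral_bind Measurable.of_discrete.aemeasurable (by fun_prop)]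
    congr 1
    refine lintegral_congr fun s => ?_
    rw [ofReal_integral_eq_lintegral_ofReal (hint s) (.of_forall hB0)]
  have hint (s) : Integrable B (κ s) := .of_bound hB.aestronglyMeasurable C (.of_forall hC)
  have hint' : Integrable B (P.bind κ) := .of_bound hB.aestronglyMeasurable C (.of_forall hC)
  have hP : Integrable (fun s => ∫ x, B x ∂(κ s)) P := by
    refine .of_bound Measurable.of_discrete.aestronglyMeasurable C (.of_forall fun s => ?_)
    exact (norm_integral_le_of_norm_le_const (.of_forall hC)).trans (by simp)
  have h := key (fun x => B x + C) (by fun_prop) (fun x => by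
    have := (abs_le.1 (hC x)).1
    simp only [Pi.zero_apply]
    linarith) (C + |C|) fun x => (abs_add_le _ _).trans (by gcongr; exact hC x)
  rw [integral_add hint' (integrable_const _)] at h
  simp_rw [fun s => integral_add (hint s) (integrable_const C)] at h
  simp only [integral_const, probReal_univ, smul_eq_mul, one_mul] at h
  rw [integral_add hP (integrable_const _)] at h
  simpa using h

end ProductMeasures

/-- The law of the numbers of positive and negative occurrences of a variable. -/
abbrev degreeLaw (r : ℝ≥0) : Measure (ℕ × ℕ) := (poissonMeasure r).prod (poissonMeasure r)

/-- The mean number of positive occurrences of a variable. -/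
def occRate (k : ℕ) (α : ℝ≥0) : ℝ≥0 := k * α / 2

section PoissonSample

variable {k : ℕ} {α : ℝ≥0} {μ : ProbabilityMeasure ℝ}

/-- The values of a sample that are relevant for given degrees. -/
def relevant (ℓ : ℕ × ℕ) (p : (ℕ → ℝ) × (ℕ → ℝ)) : Fin ℓ.1 ⊕ Fin ℓ.2 → ℝ :=
  Sum.elim (fun i => p.1 i) fun i => p.2 i

theorem measurePreserving_relevant (ℓ : ℕ × ℕ) :
    MeasurePreserving (relevant ℓ)
      ((Measure.infinitePi fun _ : ℕ => (μ : Measure ℝ)).prod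
        (Measure.infinitePi fun _ : ℕ => (μ : Measure ℝ)))
      (Measure.pi fun _ => (μ : Measure ℝ)) := by
  have hm : Measurable (relevant ℓ) := by
    refine measurable_pi_lambda _ fun i => ?_
    rcases i with i | i
    · exact (measurable_pi_apply (i : ℕ)).comp measurable_fst
    · exact (measurable_pi_apply (i : ℕ)).comp measurable_snd
  have h1 (n : ℕ) (s : Fin n → Set ℝ) (hs : ∀ i, MeasurableSet (s i)) :
      Measure.infinitePi (fun _ : ℕ => (μ : Measure ℝ)) {u | ∀ i : Fin n, u i ∈ s i} =
        ∏ i, (μ : Measure ℝ) (s i) := by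
    have : {u : ℕ → ℝ | ∀ i : Fin n, u i ∈ s i} =
        Set.pi (Finset.range n : Set ℕ) fun i => if h : i < n then s ⟨i, h⟩ else Set.univ := by
      ext u
      simp only [Set.mem_ofPred_eq, Set.mem_pi, Finset.coe_range, Set.mem_Iio]
      refine ⟨fun h i hi => ?_, fun h i => ?_⟩
      · rw [dif_pos hi]
        exact h ⟨i, hi⟩
      · simpa using h i i.2
    rw [this, Measure.infinitePi_pi _ fun i hi => ?_, Finset.prod_range]
    · exact Finset.prod_congr rfl fun i _ => by rw [dif_pos i.2]
    · split_ifs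
      · exact hs _
      · exact .univ
  refine ⟨hm, (Measure.pi_eq fun s hs => ?_).symm⟩
  rw [Measure.map_apply hm (.univ_pi hs)]
  have : relevant ℓ ⁻¹' Set.univ.pi s =
      {u | ∀ i : Fin ℓ.1, u i ∈ s (.inl i)} ×ˢ {u | ∀ i : Fin ℓ.2, u i ∈ s (.inr i)} := by
    ext p
    simp only [Set.mem_preimage, Set.mem_pi, Set.mem_univ, true_imp_iff, Sum.forall, relevant,
      Sum.elim_inl, Sum.elim_inr, Set.mem_prod, Set.mem_ofPred_eq]
  rw [this, Measure.prod_prod, h1 _ _ fun i => hs _, h1 _ _ fun i => hs _, Fintype.prod_sum_type]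

theorem lintegral_poissonSampleLaw {G : (ℓ : ℕ × ℕ) → (Fin ℓ.1 ⊕ Fin ℓ.2 → ℝ) → ℝ≥0∞}
    (hG : ∀ ℓ, Measurable (G ℓ)) :
    ∫⁻ s, G s.1 (relevant s.1 s.2) ∂(poissonSampleLaw k α μ) =
      ∫⁻ ℓ, ∫⁻ u, G ℓ u ∂(Measure.pi fun _ => (μ : Measure ℝ)) ∂(degreeLaw (occRate k α)) := by
  have hm : Measurable fun s : PoissonSample => G s.1 (relevant s.1 s.2) :=
    measurable_from_prod_countable_right fun ℓ =>
      (hG ℓ).comp (measurePreserving_relevant (μ := μ) ℓ).measurable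
  rw [poissonSampleLaw, lintegral_prod _ hm.aemeasurable]
  exact lintegral_congr fun ℓ => (measurePreserving_relevant ℓ).lintegral_comp (hG ℓ)

theorem integral_poissonSampleLaw {G : (ℓ : ℕ × ℕ) → (Fin ℓ.1 ⊕ Fin ℓ.2 → ℝ) → ℝ}
    (hG : ∀ ℓ, Measurable (G ℓ))
    (hi : Integrable (fun s => G s.1 (relevant s.1 s.2)) (poissonSampleLaw k α μ)) :
    ∫ s, G s.1 (relevant s.1 s.2) ∂(poissonSampleLaw k α μ) =
      ∫ ℓ, ∫ u, G ℓ u ∂(Measure.pi fun _ => (μ : Measure ℝ)) ∂(degreeLaw (occRate k α)) := by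
  rw [poissonSampleLaw] at hi ⊢
  rw [integral_prod _ hi]
  refine integral_congr_ae (.of_forall fun ℓ => ?_)
  simp only
  rw [← (measurePreserving_relevant (μ := μ) ℓ).map_eq,
    integral_map (measurePreserving_relevant (μ := μ) ℓ).measurable.aemeasurable
      (hG ℓ).aestronglyMeasurable]

/-- The signed sum of the values of a sample. -/
def signedSum (ℓ : ℕ × ℕ) (u : Fin ℓ.1 ⊕ Fin ℓ.2 → ℝ) : ℝ := ∑ i, u (.inl i) - ∑ i, u (.inr i)

theorem measurable_signedSum (ℓ : ℕ × ℕ) : Measurable (signedSum ℓ) := by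
  unfold signedSum
  fun_prop

theorem field_eq_signedSum (s : PoissonSample) : field s = signedSum s.1 (relevant s.1 s.2) := by
  simp [field, signedSum, relevant, Finset.sum_range]

/-- `S₂` draws the numbers of positive and negative occurrences, and then the messages of these
clauses. -/
theorem S₂_eq_bind : (S₂ k α μ : Measure ℝ) =
    (degreeLaw (occRate k α)).bind fun ℓ =>
      (Measure.pi fun _ => (μ : Measure ℝ)).map (signedSum ℓ) := by
  ext s hs
  rw [Measure.bind_apply hs Measurable.of_discrete.aemeasurable]
  change (poissonSampleLaw k α μ).map field s = _
  rw [← lintegral_indicator_one hs, lintegral_map (measurable_one.indicator hs) measurable_field]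
  simp_rw [field_eq_signedSum]
  rw [lintegral_poissonSampleLaw (G := fun ℓ u => s.indicator 1 (signedSum ℓ u))
    fun ℓ => (measurable_one.indicator hs).comp (measurable_signedSum ℓ)]
  refine lintegral_congr fun ℓ => ?_
  rw [← lintegral_indicator_one hs,
    lintegral_map (measurable_one.indicator hs) (measurable_signedSum ℓ)]

end PoissonSample

/-! ### The law of the data of a variable -/

theorem measurable_falseBound : Measurable fun z : FieldData => falseBound z.2.1 :=
  (Measurable.of_discrete (f := falseBound)).comp (by fun_prop)

theorem continuous_message_probFalse {β : ℝ} (hβ : 0 ≤ β) (K : ℕ) :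
    Continuous fun h : Fin K → ℝ => message β fun j => probFalse (h j) := by
  unfold message
  refine continuous_const.mul (Continuous.log ?_ fun h => ?_)
  · have := continuous_probFalse
    fun_prop
  · have h1 : ∏ j, probFalse (h j) ≤ 1 :=
      Finset.prod_le_one (fun j _ => (probFalse_pos _).le) fun j _ => (probFalse_lt_one _).le
    exact ((Real.exp_pos _).trans_le (exp_neg_le_one_sub hβ h1)).ne'

section DataLaw

variable {K : ℕ}

theorem measurable_dataMessage (β : ℝ) : Measurable (dataMessage (K := K) β) := by
  unfold dataMessage message
  have := continuous_probFalse.measurable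
  fun_prop

theorem measurable_dataRadius (β : ℝ) : Measurable (dataRadius (K := K) β) := by
  unfold dataRadius
  have := measurable_falseBound
  refine measurable_const.min (Measurable.mul ?_ ?_)
  · exact Finset.measurable_fun_prod _ fun j _ => this.comp (measurable_pi_apply j)
  · fun_prop

theorem measurable_vertexData (β : ℝ) (ℓ : ℕ × ℕ) : Measurable (vertexData (K := K) β ℓ) := by
  have h1 := measurable_dataMessage (K := K) β
  have h2 := measurable_dataRadius (K := K) β
  unfold vertexData
  refine Measurable.prodMk ?_ (measurable_const.prodMk ?_)
  · exact Measurable.sub (Finset.measurable_fun_sum _ fun i _ => h1.comp (by fun_prop))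
      (Finset.measurable_fun_sum _ fun i _ => h1.comp (by fun_prop))
  · exact Finset.measurable_fun_sum _ fun i _ => h2.comp (by fun_prop)

variable (K) in
/-- The law of the data of a variable whose local tree is revealed up to depth `t`, if the reference
fields at depth `t` have law `ν₀`. -/
def dataLaw (α : ℝ≥0) (β : ℝ) (ν₀ : ProbabilityMeasure ℝ) : ℕ → Measure FieldData
  -- at depth `0` nothing is known about the variable
  | 0 => (ν₀ : Measure ℝ).map fun h => (h, false, ⊤)
  | t + 1 => (degreeLaw (occRate (K + 1) α)).bind fun ℓ =>
      (Measure.pi fun _ : Nbr K ℓ => dataLaw α β ν₀ t).map (vertexData β ℓ)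

variable {α : ℝ≥0} {β : ℝ} {ν₀ : ProbabilityMeasure ℝ}

instance isProbabilityMeasure_dataLaw (t : ℕ) : IsProbabilityMeasure (dataLaw K α β ν₀ t) := by
  induction t with
  | zero =>
    rw [dataLaw]
    exact Measure.isProbabilityMeasure_map (by fun_prop)
  | succ t _ =>
    rw [dataLaw]
    exact isProbabilityMeasure_bind fun ℓ =>
      Measure.isProbabilityMeasure_map (measurable_vertexData β ℓ).aemeasurable

variable (K) in
/-- The law of the reference field of a variable whose local tree is revealed up to depth `t`. -/
def refLaw (α : ℝ≥0) (β : ℝ) (ν₀ : ProbabilityMeasure ℝ) (t : ℕ) : ProbabilityMeasure ℝ :=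
  (fun ν => S₂ (K + 1) α (S₁ (K + 1) β ν))^[t] ν₀

/-- The reference field of the data evolves by `S₂ ∘ S₁`, whatever the other components are. -/
theorem map_fst_dataLaw (t : ℕ) :
    (dataLaw K α β ν₀ t).map Prod.fst = (refLaw K α β ν₀ t : Measure ℝ) := by
  induction t with
  | zero =>
    rw [dataLaw, Measure.map_map measurable_fst (by fun_prop)]
    exact Measure.map_id
  | succ t ih =>
    rw [refLaw, Function.iterate_succ_apply']
    change _ = (S₂ (K + 1) α (S₁ (K + 1) β (refLaw K α β ν₀ t)) : Measure ℝ)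
    rw [S₂_eq_bind, dataLaw]
    ext s hs
    rw [Measure.map_apply measurable_fst hs, Measure.bind_apply (measurable_fst hs)
      Measurable.of_discrete.aemeasurable, Measure.bind_apply hs Measurable.of_discrete.aemeasurable]
    refine lintegral_congr fun ℓ => ?_
    have h1 : MeasurePreserving (fun (z : Nbr K ℓ → FieldData) a => (z a).1)
        (Measure.pi fun _ => dataLaw K α β ν₀ t)
        (Measure.pi fun _ => (refLaw K α β ν₀ t : Measure ℝ)) :=
      measurePreserving_pi (f := fun _ (z : FieldData) => z.1) _ _
        fun _ => ⟨measurable_fst, ih⟩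
    have h2 := measurePreserving_curry (A := Fin ℓ.1 ⊕ Fin ℓ.2) (B := Fin K)
      (refLaw K α β ν₀ t : Measure ℝ)
    have h3 : MeasurePreserving (fun (w : Fin ℓ.1 ⊕ Fin ℓ.2 → Fin K → ℝ) a => bpFun (K + 1) β (w a))
        (Measure.pi fun _ => Measure.pi fun _ : Fin K => (refLaw K α β ν₀ t : Measure ℝ))
        (Measure.pi fun _ => (S₁ (K + 1) β (refLaw K α β ν₀ t) : Measure ℝ)) :=
      measurePreserving_pi (f := fun _ w => bpFun (K + 1) β w) _ _
        fun _ => ⟨measurable_bpFun (K + 1) β, rfl⟩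
    have h4 := (h3.comp (h2.comp h1)).map_eq
    rw [← h4, Measure.map_map (measurable_signedSum ℓ) (h3.comp (h2.comp h1)).measurable,
      Measure.map_apply (measurable_vertexData β ℓ) (measurable_fst hs), Measure.map_apply
      ((measurable_signedSum ℓ).comp (h3.comp (h2.comp h1)).measurable) hs]
    congr 1
    ext z
    simp only [Set.mem_preimage, Function.comp_apply, signedSum, vertexData, bpFun_succ,
      dataMessage]

end DataLaw

/-! ### Contraction of the radius -/

section Radius

variable {r : ℝ≥0}

theorem integral_falseBound_toReal :
    ∫ n : ℕ, (falseBound (decide (n = 0))).toReal ∂(poissonMeasure r) =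
      1 - 1 / 2 * Real.exp (-r) := by
  have h (n : ℕ) : (falseBound (decide (n = 0))).toReal =
      1 - Set.indicator {0} (fun _ => (1 / 2 : ℝ)) n := by
    unfold falseBound
    by_cases hn : n = 0
    · simp [hn]; norm_num
    · simp [hn]
  simp_rw [h]
  rw [integral_sub (integrable_const _) ((integrable_const _).indicator (by measurability)),
    integral_indicator_const _ (by measurability), poissonMeasure_real_singleton]
  simp [mul_comm]

theorem falseBound_lt_top (s : Bool) : falseBound s < ⊤ := by
  unfold falseBound
  split_ifs <;> simp

theorem falseBound_toReal_le (s : Bool) : (falseBound s).toReal ≤ 1 := by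
  unfold falseBound
  split_ifs <;> norm_num

theorem integrable_falseBound :
    Integrable (fun n : ℕ => (falseBound (decide (n = 0))).toReal) (poissonMeasure r) :=
  .of_bound Measurable.of_discrete.aestronglyMeasurable 1 (.of_forall fun n => by
    rw [Real.norm_of_nonneg ENNReal.toReal_nonneg]
    exact falseBound_toReal_le _)

/-- A variable has no negative occurrences with probability `exp (-r)`, and then its field is
nonnegative. -/
theorem lintegral_falseBound :
    ∫⁻ ℓ : ℕ × ℕ, falseBound (decide (ℓ.2 = 0)) ∂(degreeLaw r) =
      ENNReal.ofReal (1 - 1 / 2 * Real.exp (-r)) := by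
  have h : ∫⁻ ℓ : ℕ × ℕ, falseBound (decide (ℓ.2 = 0)) ∂(degreeLaw r) =
      ∫⁻ n : ℕ, falseBound (decide (n = 0)) ∂(poissonMeasure r) :=
    measurePreserving_snd.lintegral_comp (Measurable.of_discrete (f := fun n : ℕ =>
      falseBound (decide (n = 0))))
  rw [h, ← integral_falseBound_toReal, ofReal_integral_eq_lintegral_ofReal integrable_falseBound
    (.of_forall fun _ => ENNReal.toReal_nonneg)]
  exact lintegral_congr fun n => (ENNReal.ofReal_toReal (falseBound_lt_top _).ne).symm

theorem lintegral_natCast_poisson : ∫⁻ n : ℕ, (n : ℝ≥0∞) ∂(poissonMeasure r) = r := by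
  have h := ofReal_integral_eq_lintegral_ofReal (integrable_natCast_poisson r)
    (.of_forall fun _ => Nat.cast_nonneg _)
  rw [integral_natCast_poisson, ENNReal.ofReal_coe_nnreal] at h
  simpa using h.symm

theorem lintegral_degree_fst : ∫⁻ ℓ : ℕ × ℕ, (ℓ.1 : ℝ≥0∞) ∂(degreeLaw r) = r :=
  (measurePreserving_fst.lintegral_comp
    (Measurable.of_discrete (f := fun n : ℕ => (n : ℝ≥0∞)))).trans lintegral_natCast_poisson

theorem lintegral_degree_snd : ∫⁻ ℓ : ℕ × ℕ, (ℓ.2 : ℝ≥0∞) ∂(degreeLaw r) = r :=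
  (measurePreserving_snd.lintegral_comp
    (Measurable.of_discrete (f := fun n : ℕ => (n : ℝ≥0∞)))).trans lintegral_natCast_poisson

theorem lintegral_degree : ∫⁻ ℓ : ℕ × ℕ, ((ℓ.1 : ℝ≥0∞) + ℓ.2) ∂(degreeLaw r) = 2 * r := by
  rw [lintegral_add_left Measurable.of_discrete, lintegral_degree_fst, lintegral_degree_snd, two_mul]

/-- The improvement by the factor `1 / 2` in the absence of negative occurrences leaves only the
positive occurrences to gain from, hence `1 / 4` instead of `1 / 2`. -/
theorem lintegral_falseBound_mul_degree :
    ∫⁻ ℓ : ℕ × ℕ, falseBound (decide (ℓ.2 = 0)) * ((ℓ.1 : ℝ≥0∞) + ℓ.2) ∂(degreeLaw r) =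
      ENNReal.ofReal (2 * r * (1 - 1 / 4 * Real.exp (-r))) := by
  have he : Real.exp (-(r : ℝ)) ≤ 1 := Real.exp_le_one_iff.2 (neg_nonpos.2 r.2)
  have h (ℓ : ℕ × ℕ) : falseBound (decide (ℓ.2 = 0)) * ((ℓ.1 : ℝ≥0∞) + ℓ.2) =
      ℓ.1 * falseBound (decide (ℓ.2 = 0)) + ℓ.2 := by
    unfold falseBound
    by_cases hn : ℓ.2 = 0
    · simp [hn, mul_comm]
    · simp [hn]
  simp_rw [h]
  rw [lintegral_add_left Measurable.of_discrete, lintegral_degree_snd,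
    lintegral_prod_mul (f := fun n : ℕ => (n : ℝ≥0∞)) (g := fun n => falseBound (decide (n = 0)))
      Measurable.of_discrete.aemeasurable Measurable.of_discrete.aemeasurable,
    lintegral_natCast_poisson]
  have h2 := lintegral_falseBound (r := r)
  rw [show ∫⁻ ℓ : ℕ × ℕ, falseBound (decide (ℓ.2 = 0)) ∂(degreeLaw r) =
      ∫⁻ n : ℕ, falseBound (decide (n = 0)) ∂(poissonMeasure r) from
    measurePreserving_snd.lintegral_comp (Measurable.of_discrete (f := fun n : ℕ =>
      falseBound (decide (n = 0))))] at h2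
  rw [h2, ← ENNReal.ofReal_coe_nnreal, ← ENNReal.ofReal_mul (NNReal.coe_nonneg r),
    ← ENNReal.ofReal_add _ (NNReal.coe_nonneg r)]
  · congr 1
    ring
  · exact mul_nonneg (NNReal.coe_nonneg r) (by linarith)

end Radius

section Contraction

variable {K : ℕ} {α : ℝ≥0} {β : ℝ} {ν₀ : ProbabilityMeasure ℝ}

theorem lintegral_dataLaw_succ (t : ℕ) {g : FieldData → ℝ≥0∞} (hg : Measurable g) :
    ∫⁻ z, g z ∂(dataLaw K α β ν₀ (t + 1)) = ∫⁻ ℓ, ∫⁻ z, g (vertexData β ℓ z)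
      ∂(Measure.pi fun _ : Nbr K ℓ => dataLaw K α β ν₀ t) ∂(degreeLaw (occRate (K + 1) α)) := by
  rw [dataLaw, Measure.lintegral_bind Measurable.of_discrete.aemeasurable hg.aemeasurable]
  exact lintegral_congr fun ℓ => lintegral_map hg (measurable_vertexData β ℓ)

variable (K α β ν₀) in
/-- The mean radius of the message of a clause whose other literals have independent local trees of
depth `t`. -/
def meanDataRadius (t : ℕ) : ℝ≥0∞ :=
  ∫⁻ z, dataRadius β z ∂(Measure.pi fun _ : Fin K => dataLaw K α β ν₀ t)

theorem lintegral_sum_dataRadius (t : ℕ) (ℓ : ℕ × ℕ) :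
    ∫⁻ z : Nbr K ℓ → FieldData, ∑ a, dataRadius β (fun j => z (a, j))
      ∂(Measure.pi fun _ => dataLaw K α β ν₀ t) = (ℓ.1 + ℓ.2) * meanDataRadius K α β ν₀ t := by
  have hm (a : Fin ℓ.1 ⊕ Fin ℓ.2) : Measurable fun z : Nbr K ℓ → FieldData =>
      dataRadius β fun j => z (a, j) := (measurable_dataRadius β).comp (by fun_prop)
  rw [lintegral_finsetSum _ fun a _ => hm a]
  have h (a : Fin ℓ.1 ⊕ Fin ℓ.2) : ∫⁻ z : Nbr K ℓ → FieldData, dataRadius β (fun j => z (a, j))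
      ∂(Measure.pi fun _ => dataLaw K α β ν₀ t) = meanDataRadius K α β ν₀ t :=
    (measurePreserving_pi_comp_injective (fun _ : Nbr K ℓ => dataLaw K α β ν₀ t)
      (f := fun j => (a, j)) (Prod.mk_right_injective a)).lintegral_comp (measurable_dataRadius β)
  simp [h]

theorem lintegral_radius_succ (t : ℕ) :
    ∫⁻ z, z.2.2 ∂(dataLaw K α β ν₀ (t + 1)) =
      2 * occRate (K + 1) α * meanDataRadius K α β ν₀ t := by
  rw [lintegral_dataLaw_succ t (by fun_prop)]
  simp only [vertexData]
  simp_rw [lintegral_sum_dataRadius]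
  rw [lintegral_mul_const _ Measurable.of_discrete, lintegral_degree]

theorem lintegral_falseBound_mul_radius_succ (t : ℕ) :
    ∫⁻ z, falseBound z.2.1 * z.2.2 ∂(dataLaw K α β ν₀ (t + 1)) =
      ENNReal.ofReal (2 * occRate (K + 1) α * (1 - 1 / 4 * Real.exp (-occRate (K + 1) α))) *
        meanDataRadius K α β ν₀ t := by
  have hm : Measurable fun z : FieldData => falseBound z.2.1 * z.2.2 :=
    measurable_falseBound.mul (by fun_prop)
  rw [lintegral_dataLaw_succ t hm]
  simp only [vertexData]
  have h (ℓ : ℕ × ℕ) : ∫⁻ z : Nbr K ℓ → FieldData, falseBound (decide (ℓ.2 = 0)) *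
      ∑ a, dataRadius β (fun j => z (a, j)) ∂(Measure.pi fun _ => dataLaw K α β ν₀ t) =
      falseBound (decide (ℓ.2 = 0)) * (ℓ.1 + ℓ.2) * meanDataRadius K α β ν₀ t := by
    rw [lintegral_const_mul' _ _ (falseBound_lt_top _).ne, lintegral_sum_dataRadius, mul_assoc]
  simp_rw [h]
  rw [lintegral_mul_const _ Measurable.of_discrete, lintegral_falseBound_mul_degree]

theorem lintegral_falseBound_succ (t : ℕ) :
    ∫⁻ z, falseBound z.2.1 ∂(dataLaw K α β ν₀ (t + 1)) =
      ENNReal.ofReal (1 - 1 / 2 * Real.exp (-occRate (K + 1) α)) := by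
  rw [lintegral_dataLaw_succ t measurable_falseBound]
  simp only [vertexData, lintegral_const, measure_univ, mul_one]
  exact lintegral_falseBound

theorem contractionRate_nonneg (hK : 1 ≤ K) : 0 ≤ contractionRate (K + 1) α := by
  have he : Real.exp (-(((K + 1 : ℕ) : ℝ) * α / 2)) ≤ 1 :=
    Real.exp_le_one_iff.2 (neg_nonpos.2 (by positivity))
  unfold contractionRate
  refine mul_nonneg (mul_nonneg (mul_nonneg (mul_nonneg (by positivity) ?_) α.2) (by linarith))
    (pow_nonneg (by linarith) _)
  push_cast
  linarith [(Nat.cast_nonneg K : (0 : ℝ) ≤ K)]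

/-- The mean radius contracts at every level. By independence, one of the other `k - 1` literals of
a clause contributes its radius, the sum of the radii of `k α` messages on average, with the factor
`1 - exp (-k α / 2) / 4`, and each of the remaining `k - 2` literals contributes the factor
`1 - exp (-k α / 2) / 2`. -/
theorem meanDataRadius_succ_le (hK : 1 ≤ K) (t : ℕ) :
    meanDataRadius K α β ν₀ (t + 1) ≤
      ENNReal.ofReal (contractionRate (K + 1) α) * meanDataRadius K α β ν₀ t := by
  set ζ := dataLaw K α β ν₀ (t + 1) with hζ
  have hmf := measurable_falseBound
  have h1 : meanDataRadius K α β ν₀ (t + 1) ≤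
      ∫⁻ z, ∑ i, ∏ j, falseBound (z j).2.1 * (if j = i then (z j).2.2 else 1)
        ∂(Measure.pi fun _ : Fin K => ζ) := by
    refine lintegral_mono fun z => (min_le_right _ _).trans (le_of_eq ?_)
    rw [Finset.mul_sum]
    refine Finset.sum_congr rfl fun i _ => ?_
    rw [Finset.prod_mul_distrib]
    simp
  have hm (i j : Fin K) : Measurable fun z : FieldData =>
      falseBound z.2.1 * (if j = i then z.2.2 else 1) := by
    split_ifs
    · exact hmf.mul (by fun_prop)
    · exact hmf.mul (by fun_prop)
  refine h1.trans ?_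
  have hm' (i : Fin K) : Measurable fun z : Fin K → FieldData =>
      ∏ j, falseBound (z j).2.1 * (if j = i then (z j).2.2 else 1) :=
    Finset.measurable_fun_prod _ fun j _ => (hm i j).comp (measurable_pi_apply j)
  rw [lintegral_finsetSum _ fun i _ => hm' i]
  simp_rw [fun i => lintegral_prod_pi ζ (hm i)]
  set b := ENNReal.ofReal (1 - 1 / 2 * Real.exp (-occRate (K + 1) α)) with hb
  set c := ENNReal.ofReal (2 * occRate (K + 1) α *
    (1 - 1 / 4 * Real.exp (-occRate (K + 1) α))) with hc
  have h2 (i : Fin K) : ∏ j, ∫⁻ z, falseBound z.2.1 * (if j = i then z.2.2 else 1) ∂ζ =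
      c * meanDataRadius K α β ν₀ t * b ^ (K - 1) := by
    rw [← Finset.mul_prod_erase _ _ (Finset.mem_univ i)]
    congr 1
    · simp only [if_true]
      rw [hζ, lintegral_falseBound_mul_radius_succ]
    · rw [Finset.prod_congr rfl (g := fun _ => b) fun j hj => ?_]
      · simp
      · simp only [if_neg (Finset.ne_of_mem_erase hj), mul_one]
        rw [hζ, lintegral_falseBound_succ]
  simp_rw [h2]
  rw [Finset.sum_const, Finset.card_univ, Fintype.card_fin, nsmul_eq_mul]
  have he : Real.exp (-(occRate (K + 1) α : ℝ)) ≤ 1 :=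
    Real.exp_le_one_iff.2 (neg_nonpos.2 (NNReal.coe_nonneg _))
  have h3 : ENNReal.ofReal (contractionRate (K + 1) α) = K * (c * b ^ (K - 1)) := by
    rw [hb, hc, ← ENNReal.ofReal_pow (by linarith), ← ENNReal.ofReal_mul
      (mul_nonneg (by positivity) (by linarith)), ← ENNReal.ofReal_natCast,
      ← ENNReal.ofReal_mul (by positivity)]
    congr 1
    unfold contractionRate occRate
    rw [show K + 1 - 2 = K - 1 by omega]
    push_cast
    ring
  rw [h3]
  exact le_of_eq (by ring)

theorem meanDataRadius_le (hK : 1 ≤ K) (t : ℕ) :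
    meanDataRadius K α β ν₀ t ≤ ENNReal.ofReal (contractionRate (K + 1) α ^ t * (β / 2)) := by
  induction t with
  | zero =>
    refine (lintegral_mono fun z => min_le_left _ _).trans ?_
    simp
  | succ t ih =>
    refine (meanDataRadius_succ_le hK t).trans ((mul_le_mul_right ih _).trans ?_)
    rw [← ENNReal.ofReal_mul (contractionRate_nonneg hK), pow_succ']
    exact le_of_eq (by ring_nf)

theorem lintegral_radius_le (hK : 1 ≤ K) (t : ℕ) :
    ∫⁻ z, z.2.2 ∂(dataLaw K α β ν₀ (t + 1)) ≤
      ENNReal.ofReal (2 * occRate (K + 1) α * (contractionRate (K + 1) α ^ t * (β / 2))) := by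
  rw [lintegral_radius_succ, ENNReal.ofReal_mul (by positivity)]
  refine mul_le_mul' (le_of_eq ?_) (meanDataRadius_le hK t)
  rw [ENNReal.ofReal_mul zero_le_two, ENNReal.ofReal_coe_nnreal]
  simp

/-- `contractionRate` vanishes at `0` and is continuous, so it cannot reach `1` before the smallest
positive root. -/
theorem contractionRate_lt_one (hK : 1 ≤ K) (hα : (α : ℝ) < alphaStar (K + 1)) :
    contractionRate (K + 1) α < 1 := by
  by_contra! h
  have hc : Continuous (contractionRate (K + 1)) := by
    unfold contractionRate
    fun_prop
  have h0 : contractionRate (K + 1) 0 = 0 := by simp [contractionRate]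
  obtain ⟨a, ha, ha'⟩ := intermediate_value_Icc α.2 hc.continuousOn
    (⟨h0.le.trans zero_le_one, h⟩ : (1 : ℝ) ∈ Set.Icc _ _)
  have ha0 : 0 < a := lt_of_le_of_ne ha.1 (by
    rintro rfl
    exact zero_ne_one (h0.symm.trans ha'))
  exact absurd ((isLeast_alphaStar (by omega)).2 ⟨ha0, ha'⟩) (not_le.2 (ha.2.trans_lt hα))

end Contraction

/-! ### Attaching a vertex to the local tree -/

section Attach

variable {K : ℕ} {α : ℝ≥0} {β : ℝ} {ν₀ : ProbabilityMeasure ℝ}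
  {ι : Type} [Fintype ι] [DecidableEq ι]

omit [Fintype ι] in
theorem measurable_attachData (β : ℝ) (i₀ : ι) (ℓ : ℕ × ℕ) :
    Measurable (attachData (K := K) β i₀ ℓ) := by
  refine measurable_pi_lambda _ fun i => ?_
  unfold attachData
  split_ifs
  · exact (measurable_vertexData β ℓ).comp (by fun_prop)
  · fun_prop

/-- The depths of the local trees after the variable `i₀` has been replaced by its neighbours. -/
def attachDepth (d : ι → ℕ) (i₀ : ι) (t : ℕ) (ℓ : ℕ × ℕ) : {i // i ≠ i₀} ⊕ Nbr K ℓ → ℕ :=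
  Sum.elim (fun i => d i) fun _ => t

/-- The law of independent data is generated by drawing the clauses of the variable with index `i₀`
and the data of their other literals. -/
theorem pi_dataLaw_eq_bind {d : ι → ℕ} {i₀ : ι} {t : ℕ} (hd : d i₀ = t + 1) :
    (Measure.pi fun i => dataLaw K α β ν₀ (d i)) =
      (degreeLaw (occRate (K + 1) α)).bind fun ℓ =>
        (Measure.pi fun j => dataLaw K α β ν₀ (attachDepth (K := K) d i₀ t ℓ j)).map
          (attachData β i₀ ℓ) := by
  refine (Measure.pi_eq fun s hs => ?_)
  rw [Measure.bind_apply (.univ_pi hs) Measurable.of_discrete.aemeasurable]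
  have key (ℓ : ℕ × ℕ) : (Measure.pi fun j => dataLaw K α β ν₀ (attachDepth (K := K) d i₀ t ℓ j)).map
      (attachData β i₀ ℓ) (Set.univ.pi s) = (∏ i : {i // i ≠ i₀}, dataLaw K α β ν₀ (d i) (s i)) *
        (Measure.pi fun _ : Nbr K ℓ => dataLaw K α β ν₀ t).map (vertexData β ℓ) (s i₀) := by
    rw [Measure.map_apply (measurable_attachData β i₀ ℓ) (.univ_pi hs),
      Measure.map_apply (measurable_vertexData β ℓ) (hs i₀)]
    have h1 : attachData (K := K) β i₀ ℓ ⁻¹' Set.univ.pi s =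
        MeasurableEquiv.sumPiEquivProdPi (fun _ : {i // i ≠ i₀} ⊕ Nbr K ℓ => FieldData) ⁻¹'
          ((Set.univ.pi fun i : {i // i ≠ i₀} => s i) ×ˢ (vertexData β ℓ ⁻¹' s i₀)) := by
      ext z
      simp only [Set.mem_preimage, Set.mem_pi, Set.mem_univ, true_imp_iff, Set.mem_prod]
      refine ⟨fun h => ⟨fun i => ?_, ?_⟩, fun h i => ?_⟩
      · have := h i
        rw [attachData, dif_neg i.2] at this
        exact this
      · have := h i₀
        rw [attachData, dif_pos rfl] at this
        exact this
      · rw [attachData]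
        split_ifs with hi
        · subst hi
          exact h.2
        · exact h.1 ⟨i, hi⟩
    rw [h1, (measurePreserving_sumPiEquivProdPi (fun j : {i // i ≠ i₀} ⊕ Nbr K ℓ =>
      dataLaw K α β ν₀ (attachDepth (K := K) d i₀ t ℓ j))).measure_preimage
      ((MeasurableSet.univ_pi fun i => hs _).prod
        (measurable_vertexData β ℓ (hs i₀))).nullMeasurableSet, Measure.prod_prod, Measure.pi_pi]
    rfl
  simp_rw [key]
  rw [lintegral_const_mul _ Measurable.of_discrete, ← Measure.bind_apply (hs i₀)
    Measurable.of_discrete.aemeasurable, ← Finset.mul_prod_erase _ _ (Finset.mem_univ i₀), mul_comm]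
  congr 1
  · rw [hd, dataLaw]
  · exact (Finset.prod_subtype (Finset.univ.erase i₀) (p := fun i => i ≠ i₀) (by simp)
      fun i => dataLaw K α β ν₀ (d i) (s i)).symm

/-- The expectation form of `pi_dataLaw_eq_bind`. -/
theorem integral_pi_dataLaw {d : ι → ℕ} {i₀ : ι} {t : ℕ} (hd : d i₀ = t + 1)
    {B : (ι → FieldData) → ℝ} (hB : Measurable B) {C : ℝ} (hC : ∀ z, |B z| ≤ C) :
    ∫ z, B z ∂(Measure.pi fun i => dataLaw K α β ν₀ (d i)) =
      ∫ ℓ, ∫ z, B (attachData β i₀ ℓ z)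
        ∂(Measure.pi fun j => dataLaw K α β ν₀ (attachDepth (K := K) d i₀ t ℓ j))
        ∂(degreeLaw (occRate (K + 1) α)) := by
  rw [pi_dataLaw_eq_bind hd, integral_bind_of_bounded (fun ℓ =>
    Measure.isProbabilityMeasure_map (measurable_attachData β i₀ ℓ).aemeasurable) hB hC]
  refine integral_congr_ae (.of_forall fun ℓ => ?_)
  exact integral_map (measurable_attachData β i₀ ℓ).aemeasurable hB.aestronglyMeasurable

end Attach

/-! ### Sparse random formulas -/

section Sparse

variable (K : ℕ) (α : ℝ≥0)

/-- The number `N` of variables tends to infinity, and the Poisson rate `γ` of every tuple of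
literals is such that the number of clauses per variable tends to `α`. -/
def sparse : Filter (ℕ × ℝ≥0) :=
  comap (fun p => (p.1, (p.2 : ℝ) * (2 ^ (K + 1) * (p.1 : ℝ) ^ K))) (atTop ×ˢ 𝓝 (α : ℝ))

theorem tendsto_fst_sparse : Tendsto Prod.fst (sparse K α) atTop :=
  (tendsto_fst (g := 𝓝 (α : ℝ))).comp tendsto_comap

theorem tendsto_density_sparse :
    Tendsto (fun p : ℕ × ℝ≥0 => (p.2 : ℝ) * (2 ^ (K + 1) * (p.1 : ℝ) ^ K)) (sparse K α)
      (𝓝 (α : ℝ)) :=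
  (tendsto_snd (f := atTop)).comp tendsto_comap

variable {K α}

theorem eventually_sparse_ge (n : ℕ) : ∀ᶠ p in sparse K α, n ≤ p.1 :=
  (tendsto_fst_sparse K α).eventually_ge_atTop n

/-- A quantity of order `N ^ K` times the rate has a limit in sparse formulas. -/
theorem tendsto_rate_mul {f : ℕ → ℝ} {c : ℝ}
    (hf : Tendsto (fun N : ℕ => f N / (2 ^ (K + 1) * (N : ℝ) ^ K)) atTop (𝓝 c)) :
    Tendsto (fun p : ℕ × ℝ≥0 => (p.2 : ℝ) * f p.1) (sparse K α) (𝓝 (α * c)) := by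
  refine ((tendsto_density_sparse K α).mul (hf.comp (tendsto_fst_sparse K α))).congr' ?_
  filter_upwards [eventually_sparse_ge 1] with p hp
  have : (p.1 : ℝ) ≠ 0 := by positivity
  simp only [Function.comp_apply]
  field_simp

theorem tendsto_sub_div_natCast (a : ℝ) :
    Tendsto (fun N : ℕ => ((N : ℝ) - a) / N) atTop (𝓝 1) := by
  have h : Tendsto (fun N : ℕ => 1 - a / (N : ℝ)) atTop (𝓝 (1 - 0)) :=
    tendsto_const_nhds.sub (tendsto_const_div_atTop_nhds_zero_nat a)
  rw [sub_zero] at h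
  refine h.congr' ?_
  filter_upwards [eventually_ge_atTop 1] with N hN
  have : (N : ℝ) ≠ 0 := by positivity
  field_simp

theorem tendsto_pred_sparse :
    Tendsto (fun p : ℕ × ℝ≥0 => (p.1 - 1, p.2)) (sparse K α) (sparse K α) := by
  refine tendsto_comap_iff.2 (Tendsto.prodMk ?_ ?_)
  · exact (tendsto_sub_atTop_nat 1).comp (tendsto_fst_sparse K α)
  · have h : Tendsto (fun N : ℕ => 2 ^ (K + 1) * ((N - 1 : ℕ) : ℝ) ^ K /
        (2 ^ (K + 1) * (N : ℝ) ^ K)) atTop (𝓝 1) := by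
      have := (tendsto_sub_div_natCast 1).pow K
      rw [one_pow] at this
      refine this.congr' ?_
      filter_upwards [eventually_ge_atTop 1] with N hN
      rw [Nat.cast_sub hN, Nat.cast_one, mul_div_mul_left _ _ (by positivity), div_pow]
    have h2 := tendsto_rate_mul (α := α) h
    rw [mul_one] at h2
    exact h2

/-- The rate of the positive occurrences of a variable. -/
theorem tendsto_slot_rate :
    Tendsto (fun p : ℕ × ℝ≥0 => p.2 * ((K + 1) * (2 * ((p.1 - 1 : ℕ) : ℝ≥0)) ^ K)) (sparse K α)
      (𝓝 (occRate (K + 1) α)) := by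
  rw [← NNReal.tendsto_coe]
  have h : Tendsto (fun N : ℕ => ((K + 1) * (2 * ((N - 1 : ℕ) : ℝ)) ^ K) /
        (2 ^ (K + 1) * (N : ℝ) ^ K)) atTop (𝓝 ((K + 1) / 2)) := by
    have := ((tendsto_sub_div_natCast 1).pow K).const_mul (((K : ℝ) + 1) / 2)
    rw [one_pow, mul_one] at this
    refine this.congr' ?_
    filter_upwards [eventually_ge_atTop 1] with N hN
    have : (N : ℝ) ≠ 0 := by positivity
    rw [Nat.cast_sub hN, Nat.cast_one, mul_pow, div_pow, pow_succ (2 : ℝ) K]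
    field_simp
  have h2 := tendsto_rate_mul (α := α) h
  refine (h2.congr fun p => ?_).trans (le_of_eq ?_)
  · simp only [NNReal.coe_mul, NNReal.coe_pow, NNReal.coe_add, NNReal.coe_natCast,
      NNReal.coe_ofNat, NNReal.coe_one]
  · congr 1
    unfold occRate
    push_cast
    ring

/-- The expected number of clauses in which a given variable occurs more than once. -/
theorem tendsto_multi_rate :
    Tendsto (fun p : ℕ × ℝ≥0 => (p.2 : ℝ) * ((2 * p.1) ^ (K + 1) - (2 * ((p.1 : ℝ) - 1)) ^ (K + 1) -
      2 * ((K + 1) * (2 * ((p.1 : ℝ) - 1)) ^ K))) (sparse K α) (𝓝 0) := by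
  have hg : Tendsto (fun N : ℕ => ((2 * (N : ℝ)) ^ (K + 1) - (2 * ((N : ℝ) - 1)) ^ (K + 1) -
      2 * ((K + 1) * (2 * ((N : ℝ) - 1)) ^ K)) / (2 ^ (K + 1) * (N : ℝ) ^ K)) atTop (𝓝 0) := by
    have hs := tendsto_sub_div_natCast 1
    -- the difference quotient of the power function at `1`
    have hq : Tendsto (fun N : ℕ => ∑ i ∈ Finset.range (K + 1), (((N : ℝ) - 1) / N) ^ i) atTop
        (𝓝 ((K : ℝ) + 1)) := by
      have := tendsto_finsetSum (Finset.range (K + 1)) fun i _ => hs.pow i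
      simpa using this
    have := hq.sub ((hs.pow K).const_mul ((K : ℝ) + 1))
    rw [one_pow, mul_one, sub_self] at this
    refine this.congr' ?_
    filter_upwards [eventually_ge_atTop 1] with N hN
    have hN0 : (N : ℝ) ≠ 0 := by positivity
    have hgeom := geom_sum_mul (((N : ℝ) - 1) / N) (K + 1)
    have h1 : ((N : ℝ) - 1) / N - 1 = -(1 / N) := by field_simp; ring
    rw [h1] at hgeom
    have h2 : ∑ i ∈ Finset.range (K + 1), (((N : ℝ) - 1) / N) ^ i =
        N * (1 - (((N : ℝ) - 1) / N) ^ (K + 1)) := by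
      field_simp at hgeom ⊢
      linarith
    rw [h2, div_pow, div_pow]
    simp only [mul_pow]
    field_simp
    ring
  have := tendsto_rate_mul (α := α) hg
  rwa [mul_zero] at this

end Sparse

/-! ### Joint marginals of literals -/

section Marginal

variable {ι : Type} [Fintype ι] {V : Type*} [Fintype V] [DecidableEq V]

/-- The unnormalised joint distribution of the truth values of the literals `e`, if the assignments
have weights `W`. -/
def marginal (e : ι → V × Bool) (W : (V → Bool) → ℝ) (y : ι → Bool) : ℝ :=
  open Classical in ∑ x, if (fun i => litVal x (e i)) = y then W x else 0

theorem marginal_nonneg {e : ι → V × Bool} {W : (V → Bool) → ℝ} (hW : ∀ x, 0 ≤ W x) :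
    0 ≤ marginal e W := fun y =>
  Finset.sum_nonneg fun x _ => by
    split_ifs
    · exact hW x
    · exact le_rfl

theorem sum_marginal_mul [DecidableEq ι] (e : ι → V × Bool) (W : (V → Bool) → ℝ)
    (g : (ι → Bool) → ℝ) :
    ∑ y, marginal e W y * g y = ∑ x, W x * g fun i => litVal x (e i) := by
  classical
  simp_rw [marginal, Finset.sum_mul]
  rw [Finset.sum_comm]
  refine Finset.sum_congr rfl fun x _ => ?_
  simp [ite_mul]

theorem marginal_weight_ne_zero [DecidableEq ι] (e : ι → V × Bool) {W : (V → Bool) → ℝ}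
    (hW : ∀ x, 0 < W x) : marginal e W ≠ 0 := by
  intro h
  have h1 := sum_marginal_mul e W fun _ => 1
  simp only [h, Pi.zero_apply, Finset.sum_const_zero, mul_one] at h1
  exact (Finset.sum_pos (fun x _ => hW x) Finset.univ_nonempty).ne h1

variable {K : ℕ}

/-- The literals after the removal of the variable `v₀` of the literal with index `i₀`: the remaining
ones of `e`, and the literals `d` that share a clause with `v₀`. -/
def attachLit {v₀ : V} (e : ι → V × Bool) (i₀ : ι) (he : ∀ i, i ≠ i₀ → (e i).1 ≠ v₀) {ℓ : ℕ × ℕ}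
    (d : Nbr K ℓ → {v // v ≠ v₀} × Bool) : {i // i ≠ i₀} ⊕ Nbr K ℓ → {v // v ≠ v₀} × Bool :=
  Sum.elim (fun i => (⟨(e i).1, he i i.2⟩, (e i).2)) d

theorem sum_removeVertex {v₀ : V} (s : Bool) (f : Bool → ({v // v ≠ v₀} → Bool) → ℝ) :
    ∑ x : V → Bool, f (litVal x (v₀, s)) (fun v => x v) = ∑ x, ∑ y, f y x := by
  rw [← (Equiv.funSplitAt v₀ Bool).symm.sum_comp, Fintype.sum_prod_type, Finset.sum_comm]
  refine Finset.sum_congr rfl fun x _ => ?_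
  have h (b : Bool) : (fun v : {v // v ≠ v₀} => (Equiv.funSplitAt v₀ Bool).symm (b, x) v) = x := by
    ext v
    simp [Equiv.funSplitAt, Equiv.piSplitAt, v.2]
  simp only [h]
  have h' (b : Bool) : litVal ((Equiv.funSplitAt v₀ Bool).symm (b, x)) (v₀, s) = (b == s) := by
    simp [litVal, Equiv.funSplitAt, Equiv.piSplitAt]
  simp only [h', Fintype.sum_bool]
  cases s
  · simp [add_comm]
  · simp

/-- The joint marginals of a formula with a removed variable determine those of the formula. -/
theorem marginal_removeVertex [DecidableEq ι] {β : ℝ} (e : ι → V × Bool) (i₀ : ι)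
    (he : ∀ i, i ≠ i₀ → (e i).1 ≠ (e i₀).1) {ℓ : ℕ × ℕ}
    (d : Nbr K ℓ → {v // v ≠ (e i₀).1} × Bool) (W : ({v // v ≠ (e i₀).1} → Bool) → ℝ) :
    marginal e (fun x => W (fun v => x v) * branchWeight β ℓ (litVal x (e i₀))
        fun a => litVal (fun v : {v // v ≠ (e i₀).1} => x v) (d a)) =
      attachVertex β i₀ ℓ (marginal (attachLit e i₀ he d) W) := by
  classical
  ext y
  have h1 : attachVertex β i₀ ℓ (marginal (attachLit e i₀ he d) W) y =
      ∑ x', W x' * ((if ∀ i : {i // i ≠ i₀}, litVal x' (⟨(e i).1, he i i.2⟩, (e i).2) = y i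
        then 1 else 0) * branchWeight β ℓ (y i₀) fun a => litVal x' (d a)) := by
    have h2 := sum_marginal_mul (attachLit e i₀ he d) W fun q =>
      (if ∀ i : {i // i ≠ i₀}, q (.inl i) = y i then 1 else 0) *
        branchWeight β ℓ (y i₀) fun a => q (.inr a)
    refine Eq.trans ?_ h2
    rw [attachVertex, ← (Equiv.sumArrowEquivProdArrow _ _ _).symm.sum_comp,
      Fintype.sum_prod_type, Finset.sum_eq_single (fun i : {i // i ≠ i₀} => y i)]
    · refine Finset.sum_congr rfl fun w _ => ?_
      simp [Equiv.sumArrowEquivProdArrow]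
    · intro q _ hq
      refine Finset.sum_eq_zero fun w _ => ?_
      rw [if_neg, zero_mul, mul_zero]
      intro h
      exact hq (funext fun i => h i)
    · simp
  have h3 := sum_removeVertex (v₀ := (e i₀).1) (e i₀).2 fun b x' =>
    if b = y i₀ ∧ ∀ i : {i // i ≠ i₀}, litVal x' (⟨(e i).1, he i i.2⟩, (e i).2) = y i then
      W x' * branchWeight β ℓ b fun a => litVal x' (d a) else 0
  rw [h1]
  refine Eq.trans ?_ (h3.trans (Finset.sum_congr rfl fun x' _ => ?_))
  · refine Finset.sum_congr rfl fun x _ => ?_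
    congr 1
    refine propext ⟨fun h => ⟨congrFun h i₀, fun i => congrFun h i⟩, fun h => funext fun i => ?_⟩
    by_cases hi : i = i₀
    · rw [hi]
      exact h.1
    · exact h.2 ⟨i, hi⟩
  · rw [Finset.sum_eq_single (y i₀)]
    · simp only [true_and]
      split_ifs <;> ring
    · intro b _ hb
      rw [if_neg fun h => hb h.1]
    · simp

end Marginal

/-! ### Random literals are distinct -/

section Injective

variable {J I V : Type*} [Fintype J] [DecidableEq J] [Fintype I] [Fintype V] [DecidableEq V]

omit [Fintype I] in
/-- The variable of a uniform literal coincides with a variable determined by independent other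
literals with probability at most the inverse number of variables. -/
theorem expect_coincidence (a : J) (v : ({j // j ≠ a} → V × Bool) → V) :
    𝔼 d : J → V × Bool, (if (d a).1 = v (fun j => d j) then (1 : ℝ) else 0) ≤
      1 / Fintype.card V := by
  rcases isEmpty_or_nonempty V with hV | hV
  · have : IsEmpty (J → V × Bool) := ⟨fun d => hV.elim (d a).1⟩
    simp
  have h1 : 𝔼 d : J → V × Bool, (if (d a).1 = v (fun j => d j) then (1 : ℝ) else 0) =
      𝔼 q : (V × Bool) × ({j // j ≠ a} → V × Bool), if q.1.1 = v q.2 then (1 : ℝ) else 0 :=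
    Fintype.expect_equiv (Equiv.funSplitAt a (V × Bool)) _ _ fun d => rfl
  rw [h1, expect_prod_type, Finset.expect_comm]
  refine Finset.expect_le Finset.univ_nonempty fun d _ => ?_
  have h2 : (𝔼 x : V, 𝔼 _y : Bool, if x = v d then (1 : ℝ) else 0) =
      𝔼 x : V, if x = v d then (1 : ℝ) else 0 :=
    Finset.expect_congr rfl fun x _ => Finset.expect_const Finset.univ_nonempty _
  rw [expect_prod_type]
  refine h2.le.trans ?_
  rw [Fintype.expect_ite_zero (fun x => x = v d) (fun x y hx hy => hx.trans hy.symm)]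
  simp [NNRat.smul_def, div_eq_inv_mul]

/-- A union bound for the event that some random literals coincide with each other or with given
literals. -/
theorem expect_le_of_injective [Nonempty V] {e : I → V} (he : Function.Injective e)
    {H : (J → V × Bool) → ℝ} {b C : ℝ} (hb : |b| ≤ C) (hH : ∀ d, H d ≤ C)
    (hinj : ∀ d, Function.Injective (Sum.elim e fun j => (d j).1) → H d ≤ b) :
    𝔼 d, H d ≤ b + 2 * C * (Fintype.card J * (Fintype.card I + Fintype.card J) / Fintype.card V) := by
  have hC : 0 ≤ C := (abs_nonneg b).trans hb
  have h1 (d : J → V × Bool) : H d ≤ b + 2 * C * ∑ a : J,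
      ((∑ i : I, if (d a).1 = e i then (1 : ℝ) else 0) +
        ∑ c : {j // j ≠ a}, if (d a).1 = (d c).1 then (1 : ℝ) else 0) := by
    have hn (a : J) : 0 ≤ ∑ i : I, if (d a).1 = e i then (1 : ℝ) else 0 :=
      Finset.sum_nonneg fun i _ => by split_ifs <;> norm_num
    have hn' (a : J) : 0 ≤ ∑ c : {j // j ≠ a}, if (d a).1 = (d c).1 then (1 : ℝ) else 0 :=
      Finset.sum_nonneg fun i _ => by split_ifs <;> norm_num
    by_cases hd : Function.Injective (Sum.elim e fun j => (d j).1)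
    · refine (hinj d hd).trans (le_add_of_nonneg_right ?_)
      exact mul_nonneg (by positivity) (Finset.sum_nonneg fun a _ => add_nonneg (hn a) (hn' a))
    · have h2 : ∃ a, (∃ i, (d a).1 = e i) ∨ ∃ c : {j // j ≠ a}, (d a).1 = (d c).1 := by
        by_contra! h
        refine hd ?_
        rintro (i | a) (i' | a') haa
        · exact congrArg _ (he haa)
        · exact ((h a').1 i haa.symm).elim
        · exact ((h a).1 i' haa).elim
        · by_contra hne
          exact (h a).2 ⟨a', fun h => hne (congrArg _ h.symm)⟩ haa
      obtain ⟨a, ha⟩ := h2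
      have h3 : 1 ≤ ∑ a : J, ((∑ i : I, if (d a).1 = e i then (1 : ℝ) else 0) +
          ∑ c : {j // j ≠ a}, if (d a).1 = (d c).1 then (1 : ℝ) else 0) := by
        refine le_trans ?_ (Finset.single_le_sum (fun a _ => add_nonneg (hn a) (hn' a))
          (Finset.mem_univ a))
        rcases ha with ⟨i, hi⟩ | ⟨c, hc⟩
        · refine le_trans (le_trans (le_of_eq ?_) (Finset.single_le_sum
            (f := fun i => if (d a).1 = e i then (1 : ℝ) else 0)
            (fun i _ => by split_ifs <;> norm_num) (Finset.mem_univ i))) (le_add_of_nonneg_right (hn' a))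
          rw [if_pos hi]
        · refine le_trans (le_trans (le_of_eq ?_) (Finset.single_le_sum
            (f := fun c : {j // j ≠ a} => if (d a).1 = (d c).1 then (1 : ℝ) else 0)
            (fun i _ => by split_ifs <;> norm_num) (Finset.mem_univ c))) (le_add_of_nonneg_left (hn a))
          rw [if_pos hc]
      have := (abs_le.1 hb).1
      nlinarith [hH d]
  refine (Finset.expect_le_expect fun d _ => h1 d).trans ?_
  rw [Finset.expect_add_distrib, Fintype.expect_const, ← Finset.mul_expect,
    Finset.expect_sum_comm]
  gcongr
  refine (Finset.sum_le_sum fun a _ => ?_).trans (b := ∑ a : J,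
    ((Fintype.card I + Fintype.card J : ℝ) / Fintype.card V)) (le_of_eq ?_)
  · rw [Finset.expect_add_distrib, Finset.expect_sum_comm, Finset.expect_sum_comm]
    have h4 : ∑ i : I, 𝔼 d : J → V × Bool, (if (d a).1 = e i then (1 : ℝ) else 0) ≤
        ∑ i : I, 1 / (Fintype.card V : ℝ) :=
      Finset.sum_le_sum fun i _ => expect_coincidence a fun _ => e i
    have h5 : ∑ c : {j // j ≠ a}, 𝔼 d : J → V × Bool, (if (d a).1 = (d c).1 then (1 : ℝ) else 0) ≤
        ∑ c : {j // j ≠ a}, 1 / (Fintype.card V : ℝ) :=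
      Finset.sum_le_sum fun c _ => expect_coincidence a fun q => (q c).1
    have h6 : ∑ c : {j // j ≠ a}, 1 / (Fintype.card V : ℝ) ≤ ∑ c : J, 1 / (Fintype.card V : ℝ) := by
      simp only [Finset.sum_const, Finset.card_univ]
      exact nsmul_le_nsmul_left (by positivity) (Fintype.card_subtype_le _)
    refine (add_le_add h4 (h5.trans h6)).trans (le_of_eq ?_)
    simp only [Finset.sum_const, Finset.card_univ, nsmul_eq_mul]
    ring
  · simp only [Finset.sum_const, Finset.card_univ, nsmul_eq_mul]
    ring

end Injective

/-! ### Domination by the local tree -/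

theorem abs_integral_le_of_abs_le {X : Type*} [MeasurableSpace X] {μ : Measure X}
    [IsProbabilityMeasure μ] {f : X → ℝ} {C : ℝ} (h : ∀ x, |f x| ≤ C) : |∫ x, f x ∂μ| ≤ C := by
  have := norm_integral_le_of_norm_le_const (μ := μ) (f := f) (C := C) (.of_forall h)
  simpa using this

section Domination

variable {K : ℕ} {α : ℝ≥0} {β : ℝ} {ν₀ : ProbabilityMeasure ℝ}

variable (K α β ν₀) in
/-- The local trees of depths `d` bound the joint marginals of literals of distinct variables: if a
functional of the joint marginals is at most `B z` whenever the marginals are a mixture of product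
measures that are compatible with the data `z`, then its expectation in a sparse random formula is
asymptotically at most that of `B`. -/
def DominatedByTree (ι : Type) [Fintype ι] (d : ι → ℕ) : Prop :=
  ∀ (Ψ : ((ι → Bool) → ℝ) → ℝ) (B : (ι → FieldData) → ℝ) (C : ℝ), Measurable B →
    (∀ m, |Ψ m| ≤ C) → (∀ z, |B z| ≤ C) → (∀ z, ∀ m ∈ mixtures z, m ≠ 0 → Ψ m ≤ B z) →
    ∀ ε > 0, ∀ᶠ p in sparse K α, ∀ (V : Type) [Fintype V] [DecidableEq V], Fintype.card V = p.1 →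
      ∀ e : ι → V × Bool, Function.Injective (fun i => (e i).1) →
        ∫ η, Ψ (marginal e (weight β η)) ∂(poissonPi (Tuple (K + 1) V) p.2) ≤
          ∫ z, B z ∂(Measure.pi fun i => dataLaw K α β ν₀ (d i)) + ε

/-- At depth `0` the local trees impose no constraint, and every joint marginal is a mixture. -/
theorem dominatedByTree_zero {ι : Type} [Fintype ι] [DecidableEq ι] {d : ι → ℕ}
    (hd : ∀ i, d i = 0) : DominatedByTree K α β ν₀ ι d := by
  intro Ψ B C hB hΨC hBC hΨB ε hε
  refine .of_forall fun p V _ _ _ e _ => ?_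
  have htop (i : ι) : ∀ᵐ z ∂(dataLaw K α β ν₀ (d i)), z.2.2 = ⊤ := by
    rw [hd i, dataLaw, ae_map_iff (by fun_prop) (measurableSet_eq_fun (by fun_prop) (by fun_prop))]
    simp
  have hall : ∀ᵐ z ∂(Measure.pi fun i => dataLaw K α β ν₀ (d i)), ∀ i, (z i).2.2 = ⊤ := by
    rw [ae_all_iff]
    exact fun i => (measurePreserving_eval (fun i => dataLaw K α β ν₀ (d i)) i).quasiMeasurePreserving.ae (htop i)
  have hint : Integrable B (Measure.pi fun i => dataLaw K α β ν₀ (d i)) :=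
    .of_bound hB.aestronglyMeasurable C (.of_forall hBC)
  have h1 (η : Tuple (K + 1) V → ℕ) : Ψ (marginal e (weight β η)) ≤
      ∫ z, B z ∂(Measure.pi fun i => dataLaw K α β ν₀ (d i)) := by
    have h2 : ∫ _, Ψ (marginal e (weight β η)) ∂(Measure.pi fun i => dataLaw K α β ν₀ (d i)) ≤
        ∫ z, B z ∂(Measure.pi fun i => dataLaw K α β ν₀ (d i)) := by
      refine integral_mono_ae (integrable_const _) hint ?_
      filter_upwards [hall] with z hz
      exact hΨB z _ (mem_mixtures_of_top hz (marginal_nonneg fun x => (weight_pos β η x).le))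
        (marginal_weight_ne_zero e fun x => weight_pos β η x)
    simpa using h2
  have h3 : ∫ η, Ψ (marginal e (weight β η)) ∂(poissonPi (Tuple (K + 1) V) p.2) ≤
      ∫ _, (∫ z, B z ∂(Measure.pi fun i => dataLaw K α β ν₀ (d i)))
        ∂(poissonPi (Tuple (K + 1) V) p.2) :=
    integral_mono (.of_bound Measurable.of_discrete.aestronglyMeasurable C
      (.of_forall fun _ => hΨC _)) (integrable_const _) h1
  rw [integral_const, probReal_univ, one_smul] at h3
  linarith

theorem card_slot {V : Type} [Fintype V] [DecidableEq V] (v₀ : V) :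
    Fintype.card (Slot K V v₀) = (K + 1) * (2 * (Fintype.card V - 1)) ^ K := by
  have hN' : Fintype.card {v // v ≠ v₀} = Fintype.card V - 1 := by
    rw [Fintype.card_subtype_compl, Fintype.card_subtype_eq]
  simp only [Fintype.card_prod, Fintype.card_fin, Fintype.card_pi, hN', Fintype.card_bool,
    Finset.prod_const, Finset.card_univ, mul_comm 2]

theorem tendsto_const_div_pred_sparse (c : ℝ) :
    Tendsto (fun p : ℕ × ℝ≥0 => c / ((p.1 - 1 : ℕ) : ℝ)) (sparse K α) (𝓝 0) :=
  (tendsto_const_div_atTop_nhds_zero_nat c).comp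
    ((tendsto_sub_atTop_nat 1).comp (tendsto_fst_sparse K α))

/-- Functions of the weights change by a bounded amount if the clauses with a repeated variable are
removed, and not at all if there is no such clause. -/
theorem abs_sub_le_sum_multiClauses {V : Type} [Fintype V] [DecidableEq V] {l₀ : V × Bool}
    {G : ((V → Bool) → ℝ) → ℝ} {C : ℝ} (hG : ∀ W, |G W| ≤ C) {η η' : Tuple (K + 1) V → ℕ}
    (h : ∀ c ∉ multiClauses K l₀, η' c = η c) (hle : ∀ c, η' c ≤ η c) :
    |G (weight β η) - G (weight β η')| ≤ 2 * C * ∑ c ∈ multiClauses K l₀, (η c : ℝ) := by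
  have hC : 0 ≤ C := (abs_nonneg _).trans (hG 0)
  by_cases heq : η' = η
  · rw [heq, sub_self, abs_zero]
    positivity
  · obtain ⟨c, hc⟩ := Function.ne_iff.1 heq
    have hcm : c ∈ multiClauses K l₀ := by
      by_contra hn
      exact hc (h c hn)
    have h1 : (1 : ℝ) ≤ ∑ c ∈ multiClauses K l₀, (η c : ℝ) := by
      refine le_trans ?_ (Finset.single_le_sum (f := fun c => (η c : ℝ))
        (fun _ _ => Nat.cast_nonneg _) hcm)
      have := lt_of_le_of_ne (hle c) hc
      exact_mod_cast (show 1 ≤ η c by omega)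
    calc _ ≤ |G (weight β η)| + |G (weight β η')| := abs_sub _ _
      _ ≤ 2 * C * 1 := by linarith [hG (weight β η), hG (weight β η')]
      _ ≤ _ := by gcongr

/-- The variable with index `i₀` and its clauses are removed from the formula. Up to small errors
this leaves a formula with one variable less, in which the joint marginals of the other literals and
of the neighbours of the variable determine the joint marginals in question. -/
theorem dominatedByTree_attach (hβ : 0 ≤ β) {ι : Type} [Fintype ι] [DecidableEq ι] {d : ι → ℕ}
    {i₀ : ι} {t : ℕ} (hd : d i₀ = t + 1)
    (h : ∀ ℓ, DominatedByTree K α β ν₀ ({i // i ≠ i₀} ⊕ Nbr K ℓ) (attachDepth d i₀ t ℓ)) :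
    DominatedByTree K α β ν₀ ι d := by
  classical
  intro Ψ B C hB hΨC hBC hΨB ε hε
  have hC : 0 ≤ C := (abs_nonneg _).trans (hΨC 0)
  set b : ℕ × ℕ → ℝ := fun ℓ => ∫ z, B (attachData β i₀ ℓ z)
    ∂(Measure.pi fun j => dataLaw K α β ν₀ (attachDepth (K := K) d i₀ t ℓ j)) with hb
  have hbC (ℓ) : |b ℓ| ≤ C := abs_integral_le_of_abs_le fun z => hBC _
  -- The hypothesis holds for every `ℓ` eventually, but not uniformly in `ℓ`. The function `u p`
  -- bounds the conditional expectation given `ℓ` by the trivial bound `C` where the asymptotic one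
  -- is not yet available, and dominated convergence shows that this does not matter.
  let good (p : ℕ × ℝ≥0) (ℓ : ℕ × ℕ) : Prop :=
    (∀ (V : Type) [Fintype V] [DecidableEq V], Fintype.card V = p.1 - 1 →
      ∀ e : {i // i ≠ i₀} ⊕ Nbr K ℓ → V × Bool, Function.Injective (fun i => (e i).1) →
        ∫ η, Ψ (attachVertex β i₀ ℓ (marginal e (weight β η)))
          ∂(poissonPi (Tuple (K + 1) V) p.2) ≤ b ℓ + ε / 4) ∧
    2 * (C + ε) * (Fintype.card (Nbr K ℓ) * (Fintype.card {i // i ≠ i₀} +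
      Fintype.card (Nbr K ℓ)) / ((p.1 - 1 : ℕ) : ℝ)) ≤ ε / 4
  have hgood (ℓ) : ∀ᶠ p in sparse K α, good p ℓ := by
    have h1 := tendsto_pred_sparse.eventually (h ℓ (fun m => Ψ (attachVertex β i₀ ℓ m))
      (fun z => B (attachData β i₀ ℓ z)) C (hB.comp (measurable_attachData β i₀ ℓ))
      (fun m => hΨC _) (fun z => hBC _) (fun z m hm hm0 => hΨB _ _
        (attachVertex_mem_mixtures hβ hm) (attachVertex_ne_zero β (mixtures_nonneg hm) hm0))
      (ε / 4) (by positivity))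
    have h2 := ((tendsto_const_div_pred_sparse (K := K) (α := α)
      (Fintype.card (Nbr K ℓ) * (Fintype.card {i // i ≠ i₀} + Fintype.card (Nbr K ℓ)))).const_mul
        (2 * (C + ε))).eventually_le_const (u := ε / 4) (by rw [mul_zero]; positivity)
    filter_upwards [h1, h2] with p h1 h2
    exact ⟨h1, h2⟩
  let u (p : ℕ × ℝ≥0) (ℓ : ℕ × ℕ) : ℝ := if good p ℓ then b ℓ + ε / 2 else C
  have huC (p ℓ) : |u p ℓ| ≤ C + ε := by
    simp only [u]
    split_ifs
    · refine (abs_add_le _ _).trans (add_le_add (hbC ℓ) ?_)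
      rw [abs_of_pos (by positivity)]
      linarith
    · rw [abs_of_nonneg hC]
      linarith
  have hu : Tendsto (fun p : ℕ × ℝ≥0 => ∫ ℓ, u p ℓ
      ∂(degreeLaw (p.2 * ((K + 1) * (2 * ((p.1 - 1 : ℕ) : ℝ≥0)) ^ K)))) (sparse K α)
      (𝓝 (∫ ℓ, (b ℓ + ε / 2) ∂(degreeLaw (occRate (K + 1) α)))) := by
    refine tendsto_integral_poisson_prod tendsto_slot_rate (A := C + ε) (B := 0) le_rfl
      (fun ℓ => ?_) (fun p ℓ => by simpa using huC p ℓ) fun ℓ => ?_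
    · refine tendsto_const_nhds.congr' ?_
      filter_upwards [hgood ℓ] with p hp
      simp only [u, if_pos hp]
    · rw [zero_mul, add_zero]
      refine (abs_add_le _ _).trans (add_le_add (hbC ℓ) ?_)
      rw [abs_of_pos (by positivity)]
      linarith
  have hbint : Integrable b (degreeLaw (occRate (K + 1) α)) :=
    .of_bound Measurable.of_discrete.aestronglyMeasurable C (.of_forall hbC)
  rw [integral_add hbint (integrable_const _), ← integral_pi_dataLaw hd hB hBC] at hu
  simp only [integral_const, probReal_univ, smul_eq_mul, one_mul] at hu
  set I := ∫ z, B z ∂(Measure.pi fun i => dataLaw K α β ν₀ (d i)) with hI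
  have hm := ((tendsto_multi_rate (K := K) (α := α)).const_mul (2 * C)).eventually_le_const
    (u := ε / 4) (by rw [mul_zero]; positivity)
  filter_upwards [hu.eventually_le_const (u := I + ε / 2 + ε / 4) (by linarith), hm,
    eventually_sparse_ge 2] with p hup hmp hp2 V _ _ hV e he
  have hrem := abs_integral_sub_removeVertex_le (K := K) (β := β) (e i₀) p.2
    (G := fun W => Ψ (marginal e W)) (a := C) (b := 0) (C := 2 * C) hC le_rfl
    (fun η => by simpa using hΨC _)
    (fun η η' hle hη => abs_sub_le_sum_multiClauses (G := fun W => Ψ (marginal e W))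
      (fun W => hΨC _) hη hle)
  rw [card_multiClauses (e i₀) (N := p.1 - 1) (by omega), card_slot, hV] at hrem
  have hcast : ((p.1 - 1 : ℕ) : ℝ) = (p.1 : ℝ) - 1 := by
    rw [Nat.cast_sub (by omega), Nat.cast_one]
  rw [hcast, sub_add_cancel] at hrem
  have hne : ∀ i, i ≠ i₀ → (e i).1 ≠ (e i₀).1 := fun i hi h => hi (he h)
  have hcard : Fintype.card {v // v ≠ (e i₀).1} = p.1 - 1 := by
    rw [Fintype.card_subtype_compl, Fintype.card_subtype_eq, hV]
  have hnonempty : Nonempty {v // v ≠ (e i₀).1} := by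
    rw [← Fintype.card_pos_iff, hcard]
    omega
  have hle (ℓ : ℕ × ℕ) : 𝔼 f : Nbr K ℓ → {v // v ≠ (e i₀).1} × Bool,
      ∫ η, Ψ (marginal e fun x => weight β η (fun v => x v) * branchWeight β ℓ (litVal x (e i₀))
        fun a => litVal (fun v : {v // v ≠ (e i₀).1} => x v) (f a))
        ∂(poissonPi (Tuple (K + 1) {v // v ≠ (e i₀).1}) p.2) ≤ u p ℓ := by
    simp_rw [marginal_removeVertex e i₀ hne]
    have hH (f : Nbr K ℓ → {v // v ≠ (e i₀).1} × Bool) :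
        ∫ η, Ψ (attachVertex β i₀ ℓ (marginal (attachLit e i₀ hne f) (weight β η)))
          ∂(poissonPi (Tuple (K + 1) {v // v ≠ (e i₀).1}) p.2) ≤ C :=
      (le_abs_self _).trans (abs_integral_le_of_abs_le fun η => hΨC _)
    simp only [u]
    split_ifs with hg
    · refine (expect_le_of_injective
        (e := fun i : {i // i ≠ i₀} => (⟨(e i).1, hne i i.2⟩ : {v // v ≠ (e i₀).1}))
        (fun i j hij => Subtype.ext (he (congrArg Subtype.val hij))) (b := b ℓ + ε / 4)
        (C := C + ε) ?_ (fun f => (hH f).trans (by linarith)) fun f hf => ?_).trans ?_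
      · refine (abs_add_le _ _).trans (add_le_add (hbC ℓ) ?_)
        rw [abs_of_pos (by positivity)]
        linarith
      · refine hg.1 _ hcard _ ?_
        convert hf using 1
        funext j
        rcases j with j | j <;> rfl
      · have := hg.2
        rw [← hcard] at this
        linarith
    · exact Finset.expect_le Finset.univ_nonempty fun f _ => hH f
  have habs := (abs_le.1 hrem).2
  have hmono := integral_mono (μ := degreeLaw (p.2 * ((K + 1) * (2 * ((p.1 - 1 : ℕ) : ℝ≥0)) ^ K)))
    (.of_bound (C := C) Measurable.of_discrete.aestronglyMeasurable (.of_forall fun ℓ => ?_))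
    (.of_bound (C := C + ε) Measurable.of_discrete.aestronglyMeasurable
      (.of_forall fun ℓ => huC p ℓ)) hle
  · have hr : p.2 * (((K + 1) * (2 * (p.1 - 1)) ^ K : ℕ) : ℝ≥0) =
        p.2 * ((K + 1) * (2 * ((p.1 - 1 : ℕ) : ℝ≥0)) ^ K) := by
      simp only [Nat.cast_mul, Nat.cast_pow, Nat.cast_add, Nat.cast_one, Nat.cast_ofNat]
    rw [hr] at habs
    linarith
  · exact abs_expect_le hC fun f => abs_integral_le_of_abs_le fun η => hΨC _

/-- By induction on the maximal depth and, within it, on the number of literals whose local tree has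
this depth: `dominatedByTree_attach` replaces one of them by literals with local trees of smaller
depth. -/
theorem dominatedByTree (hβ : 0 ≤ β) (ι : Type) [Fintype ι] [DecidableEq ι] (d : ι → ℕ) :
    DominatedByTree K α β ν₀ ι d := by
  have key : ∀ t : ℕ, ∀ (ι : Type) [Fintype ι] [DecidableEq ι] (d : ι → ℕ), (∀ i, d i ≤ t) →
      DominatedByTree K α β ν₀ ι d := by
    intro t
    induction t with
    | zero => exact fun ι _ _ d hd => dominatedByTree_zero fun i => Nat.le_zero.1 (hd i)
    | succ t iht =>
      have : ∀ n : ℕ, ∀ (ι : Type) [Fintype ι] [DecidableEq ι] (d : ι → ℕ), (∀ i, d i ≤ t + 1) →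
          Fintype.card {i // d i = t + 1} = n → DominatedByTree K α β ν₀ ι d := by
        intro n
        induction n with
        | zero =>
          intro ι _ _ d hd hn
          refine iht ι d fun i => ?_
          have := Fintype.card_eq_zero_iff.1 hn
          have h1 : d i ≠ t + 1 := fun h => this.elim ⟨i, h⟩
          have := hd i
          omega
        | succ n ihn =>
          intro ι _ _ d hd hn
          obtain ⟨⟨i₀, hi₀⟩⟩ := Fintype.card_pos_iff.1 (by omega : 0 < Fintype.card {i // d i = t + 1})
          refine dominatedByTree_attach hβ hi₀ fun ℓ => ihn _ _ ?_ ?_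
          · rintro (i | a)
            · exact hd i
            · exact Nat.le_succ t
          · have e : {j // attachDepth (K := K) d i₀ t ℓ j = t + 1} ≃
                {j : {i // d i = t + 1} // j ≠ ⟨i₀, hi₀⟩} :=
              { toFun := fun j => match j with
                  | ⟨.inl i, hi⟩ => ⟨⟨i, hi⟩, fun h => i.2 (congrArg Subtype.val h)⟩
                  | ⟨.inr a, ha⟩ => (Nat.succ_ne_self t (Eq.symm ha)).elim
                invFun := fun j => ⟨.inl ⟨j.1, fun h => j.2 (Subtype.ext h)⟩, j.1.2⟩
                left_inv := by
                  rintro ⟨i | a, h⟩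
                  · rfl
                  · exact (Nat.succ_ne_self t (Eq.symm h)).elim
                right_inv := fun j => rfl }
            rw [Fintype.card_congr e, Fintype.card_subtype_compl, hn, Fintype.card_subtype_eq]
            rfl
      exact fun ι _ _ d hd => this _ ι d hd rfl
  exact key (∑ i, d i) ι d fun i => Finset.single_le_sum (fun _ _ => Nat.zero_le _)
    (Finset.mem_univ i)

end Domination

/-! ### Local limits -/

section LocalLimit

variable {K : ℕ} {α : ℝ≥0} {β : ℝ} {ν₀ : ProbabilityMeasure ℝ}

/-- A functional of joint marginals that is almost determined by the reference fields: on the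
mixtures compatible with the data `z`, it differs from `g` by at most a multiple of the radii. -/
def ApproxBy {ι : Type} [Fintype ι] (Ψ : ((ι → Bool) → ℝ) → ℝ) (g : (ι → ℝ) → ℝ) (L : ℝ) : Prop :=
  ∀ z : ι → FieldData, (∀ i, (z i).2.2 ≠ ⊤) → ∀ m ∈ mixtures z, m ≠ 0 →
    |Ψ m - g fun i => (z i).1| ≤ L * ∑ i, (z i).2.2.toReal

variable (K α β) in
/-- A bound on the mean radius of a variable whose local tree is revealed up to depth `t + 1`. -/
def radiusBound (t : ℕ) : ℝ :=
  2 * occRate (K + 1) α * (contractionRate (K + 1) α ^ t * (β / 2))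

theorem tendsto_radiusBound (hK : 1 ≤ K) (hα : (α : ℝ) < alphaStar (K + 1)) :
    Tendsto (radiusBound K α β) atTop (𝓝 0) := by
  have h := ((tendsto_pow_atTop_nhds_zero_of_lt_one (contractionRate_nonneg (α := α) hK)
    (contractionRate_lt_one hK hα)).mul_const (β / 2)).const_mul (2 * (occRate (K + 1) α : ℝ))
  rw [zero_mul, mul_zero] at h
  exact h

theorem radiusBound_nonneg (hK : 1 ≤ K) (hβ : 0 ≤ β) (t : ℕ) : 0 ≤ radiusBound K α β t := by
  have := contractionRate_nonneg (α := α) hK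
  unfold radiusBound
  positivity

theorem ae_radius_ne_top (hK : 1 ≤ K) (t : ℕ) :
    ∀ᵐ z ∂(dataLaw K α β ν₀ (t + 1)), z.2.2 ≠ ⊤ := by
  have h := ae_lt_top (μ := dataLaw K α β ν₀ (t + 1)) (f := fun z => z.2.2) (by fun_prop)
    ((lintegral_radius_le hK t).trans_lt ENNReal.ofReal_lt_top).ne
  filter_upwards [h] with z hz using hz.ne

theorem integrable_radius (hK : 1 ≤ K) (t : ℕ) :
    Integrable (fun z : FieldData => z.2.2.toReal) (dataLaw K α β ν₀ (t + 1)) :=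
  integrable_toReal_of_lintegral_ne_top (by fun_prop)
    ((lintegral_radius_le hK t).trans_lt ENNReal.ofReal_lt_top).ne

theorem integral_radius_le (hK : 1 ≤ K) (hβ : 0 ≤ β) (t : ℕ) :
    ∫ z, z.2.2.toReal ∂(dataLaw K α β ν₀ (t + 1)) ≤ radiusBound K α β t := by
  rw [integral_toReal (by fun_prop) (by
    filter_upwards [ae_radius_ne_top hK t] with z hz using lt_top_iff_ne_top.2 hz)]
  exact ENNReal.toReal_le_of_le_ofReal (radiusBound_nonneg hK hβ t) (lintegral_radius_le hK t)

theorem ApproxBy.neg {ι : Type} [Fintype ι] {Ψ : ((ι → Bool) → ℝ) → ℝ} {g : (ι → ℝ) → ℝ} {L : ℝ}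
    (h : ApproxBy Ψ g L) : ApproxBy (fun m => -Ψ m) (fun x => -g x) L := fun z hz m hm hm0 => by
  rw [neg_sub_neg, abs_sub_comm]
  exact h z hz m hm hm0

theorem integral_pi_refLaw {ι : Type} [Fintype ι] (t : ℕ) {g : (ι → ℝ) → ℝ} (hg : Measurable g) :
    ∫ z, g (fun i => (z i).1) ∂(Measure.pi fun _ : ι => dataLaw K α β ν₀ t) =
      ∫ h, g h ∂(Measure.pi fun _ : ι => (refLaw K α β ν₀ t : Measure ℝ)) := by
  have h1 : MeasurePreserving (fun (z : ι → FieldData) a => (z a).1)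
        (Measure.pi fun _ => dataLaw K α β ν₀ t)
        (Measure.pi fun _ => (refLaw K α β ν₀ t : Measure ℝ)) :=
      measurePreserving_pi (f := fun _ (z : FieldData) => z.1) _ _
        fun _ => ⟨measurable_fst, map_fst_dataLaw t⟩
  rw [← h1.map_eq, integral_map h1.measurable.aemeasurable hg.aestronglyMeasurable]

/-- The upper bound in `eventually_abs_integral_sub_le`; the lower bound is the upper bound for
`-Ψ`. -/
theorem eventually_integral_le (hK : 1 ≤ K) (hβ : 0 ≤ β) {ι : Type} [Fintype ι]
    {Ψ : ((ι → Bool) → ℝ) → ℝ} {g : (ι → ℝ) → ℝ} {L C : ℝ} (hL : 0 ≤ L) (hg : Measurable g)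
    (hΨC : ∀ m, |Ψ m| ≤ C) (hgC : ∀ h, |g h| ≤ C) (hΨ : ApproxBy Ψ g L) (t : ℕ) {ε : ℝ}
    (hε : 0 < ε) :
    ∀ᶠ p in sparse K α, ∀ (V : Type) [Fintype V] [DecidableEq V], Fintype.card V = p.1 →
      ∀ e : ι → V × Bool, Function.Injective (fun i => (e i).1) →
        ∫ η, Ψ (marginal e (weight β η)) ∂(poissonPi (Tuple (K + 1) V) p.2) ≤
          ∫ h, g h ∂(Measure.pi fun _ : ι => (refLaw K α β ν₀ (t + 1) : Measure ℝ)) +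
            L * (Fintype.card ι * radiusBound K α β t) + ε := by
  classical
  set ζ := dataLaw K α β ν₀ (t + 1) with hζ
  have hC : 0 ≤ C := (abs_nonneg _).trans (hΨC 0)
  -- the bound on `Ψ` by the data, truncated so that it is bounded
  let B : (ι → FieldData) → ℝ := fun z => if ∀ i, (z i).2.2 ≠ ⊤ then
    min C (g (fun i => (z i).1) + L * ∑ i, (z i).2.2.toReal) else C
  have hms : MeasurableSet {z : ι → FieldData | ∀ i, (z i).2.2 ≠ ⊤} := by
    rw [Set.ofPred_forall]
    refine MeasurableSet.iInter fun i => ?_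
    exact (measurableSet_singleton (⊤ : ℝ≥0∞)).compl.preimage (f := fun z : ι → FieldData =>
      (z i).2.2) (by fun_prop)
  have hgm : Measurable fun z : ι → FieldData => g fun i => (z i).1 := hg.comp (by fun_prop)
  have hrm : Measurable fun z : ι → FieldData => ∑ i, (z i).2.2.toReal := by fun_prop
  have hB : Measurable B :=
    Measurable.ite hms (measurable_const.min (hgm.add (hrm.const_mul L))) measurable_const
  have hr0 (z : ι → FieldData) : 0 ≤ L * ∑ i, (z i).2.2.toReal :=
    mul_nonneg hL (Finset.sum_nonneg fun _ _ => ENNReal.toReal_nonneg)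
  have hBC (z) : |B z| ≤ C := by
    simp only [B]
    split_ifs
    · rw [abs_le]
      refine ⟨le_min (by linarith) ?_, min_le_left _ _⟩
      linarith [(abs_le.1 (hgC fun i => (z i).1)).1, hr0 z]
    · rw [abs_of_nonneg hC]
  have hΨB : ∀ z, ∀ m ∈ mixtures z, m ≠ 0 → Ψ m ≤ B z := by
    intro z m hm hm0
    simp only [B]
    split_ifs with hz
    · refine le_min ((le_abs_self _).trans (hΨC m)) ?_
      linarith [(abs_le.1 (hΨ z hz m hm hm0)).2]
    · exact (le_abs_self _).trans (hΨC m)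
  have hri (i : ι) : Integrable (fun z : ι → FieldData => (z i).2.2.toReal)
      (Measure.pi fun _ : ι => ζ) :=
    (measurePreserving_eval (fun _ : ι => ζ) i).integrable_comp_of_integrable
      (integrable_radius hK t)
  have hrint : Integrable (fun z : ι → FieldData => L * ∑ i, (z i).2.2.toReal)
      (Measure.pi fun _ : ι => ζ) :=
    (integrable_finsetSum _ fun i _ => hri i).const_mul L
  have hgint : Integrable (fun z : ι → FieldData => g fun i => (z i).1)
      (Measure.pi fun _ : ι => ζ) :=
    .of_bound hgm.aestronglyMeasurable C (.of_forall fun _ => hgC _)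
  have hBle : ∫ z, B z ∂(Measure.pi fun _ : ι => ζ) ≤
      ∫ h, g h ∂(Measure.pi fun _ : ι => (refLaw K α β ν₀ (t + 1) : Measure ℝ)) +
        L * (Fintype.card ι * radiusBound K α β t) := by
    have hall : ∀ᵐ z ∂(Measure.pi fun _ : ι => ζ), ∀ i, (z i).2.2 ≠ ⊤ := by
      rw [ae_all_iff]
      exact fun i => (measurePreserving_eval (fun _ : ι => ζ) i).quasiMeasurePreserving.ae
        (ae_radius_ne_top hK t)
    refine (integral_mono_ae (.of_bound hB.aestronglyMeasurable C (.of_forall hBC))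
      (hgint.add hrint) ?_).trans ?_
    · filter_upwards [hall] with z hz
      simp only [B, if_pos hz]
      exact min_le_right _ _
    · rw [integral_add' hgint hrint, hζ, integral_pi_refLaw (t + 1) hg, ← hζ, integral_const_mul,
        integral_finsetSum _ fun i _ => hri i]
      gcongr
      refine (Finset.sum_le_card_nsmul _ _ (radiusBound K α β t) fun i _ => ?_).trans (by simp)
      have := integral_map (μ := Measure.pi fun _ : ι => ζ) (measurable_pi_apply i).aemeasurable
        (f := fun z : FieldData => z.2.2.toReal) (by
          have : Measurable fun z : FieldData => z.2.2.toReal := by fun_prop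
          exact this.aestronglyMeasurable)
      rw [(measurePreserving_eval (fun _ : ι => ζ) i).map_eq] at this
      rw [← this]
      exact integral_radius_le hK hβ t
  filter_upwards [dominatedByTree hβ ι (fun _ => t + 1) Ψ B C hB hΨC hBC hΨB ε hε]
    with p hp V _ _ hV e he
  exact (hp V hV e he).trans (by linarith)

/-- The expectation of a functional of the joint marginals of literals of distinct variables is
asymptotically that for independent fields with the law of the reference field, up to the radii. -/
theorem eventually_abs_integral_sub_le (hK : 1 ≤ K) (hβ : 0 ≤ β) {ι : Type} [Fintype ι]
    {Ψ : ((ι → Bool) → ℝ) → ℝ} {g : (ι → ℝ) → ℝ} {L C : ℝ} (hL : 0 ≤ L) (hg : Measurable g)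
    (hΨC : ∀ m, |Ψ m| ≤ C) (hgC : ∀ h, |g h| ≤ C) (hΨ : ApproxBy Ψ g L) (t : ℕ) {ε : ℝ}
    (hε : 0 < ε) :
    ∀ᶠ p in sparse K α, ∀ (V : Type) [Fintype V] [DecidableEq V], Fintype.card V = p.1 →
      ∀ e : ι → V × Bool, Function.Injective (fun i => (e i).1) →
        |∫ η, Ψ (marginal e (weight β η)) ∂(poissonPi (Tuple (K + 1) V) p.2) -
          ∫ h, g h ∂(Measure.pi fun _ : ι => (refLaw K α β ν₀ (t + 1) : Measure ℝ))| ≤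
            L * (Fintype.card ι * radiusBound K α β t) + ε := by
  filter_upwards [eventually_integral_le (ν₀ := ν₀) hK hβ hL hg hΨC hgC hΨ t hε,
    eventually_integral_le (ν₀ := ν₀) hK hβ hL hg.neg (fun m => by simpa using hΨC m)
      (fun h => by simpa using hgC h) hΨ.neg t hε] with p h1 h2 V _ _ hV e he
  have h3 := h1 V hV e he
  have h4 := h2 V hV e he
  simp only [Pi.neg_apply] at h4
  rw [integral_neg, integral_neg] at h4
  rw [abs_le]
  constructor <;> linarith

/-- The local limit: for a fixed point `ν` of `S₂ ∘ S₁`, literals of distinct variables of a sparse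
random formula behave as if they were independent with independent random fields of law `ν`. -/
theorem eventually_abs_integral_sub_le_of_fixed (hK : 1 ≤ K) (hα : (α : ℝ) < alphaStar (K + 1))
    (hβ : 0 ≤ β) {ν : ProbabilityMeasure ℝ} (hν : S₂ (K + 1) α (S₁ (K + 1) β ν) = ν)
    {ι : Type} [Fintype ι]
    {Ψ : ((ι → Bool) → ℝ) → ℝ} {g : (ι → ℝ) → ℝ} {L C : ℝ} (hL : 0 ≤ L) (hg : Measurable g)
    (hΨC : ∀ m, |Ψ m| ≤ C) (hgC : ∀ h, |g h| ≤ C) (hΨ : ApproxBy Ψ g L) {ε : ℝ} (hε : 0 < ε) :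
    ∀ᶠ p in sparse K α, ∀ (V : Type) [Fintype V] [DecidableEq V], Fintype.card V = p.1 →
      ∀ e : ι → V × Bool, Function.Injective (fun i => (e i).1) →
        |∫ η, Ψ (marginal e (weight β η)) ∂(poissonPi (Tuple (K + 1) V) p.2) -
          ∫ h, g h ∂(Measure.pi fun _ : ι => (ν : Measure ℝ))| ≤ ε := by
  have h1 := ((tendsto_radiusBound (β := β) hK hα).const_mul (Fintype.card ι : ℝ)).const_mul L
  rw [mul_zero, mul_zero] at h1
  obtain ⟨t, ht⟩ := (h1.eventually_le_const (u := ε / 2) (by positivity)).exists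
  have href (t : ℕ) : refLaw K α β ν t = ν := Function.iterate_fixed hν t
  filter_upwards [eventually_abs_integral_sub_le (ν₀ := ν) hK hβ hL hg hΨC hgC hΨ t
    (half_pos hε)] with p hp V _ _ hV e he
  have := hp V hV e he
  rw [href] at this
  linarith

end LocalLimit

/-! ### Functionals of joint marginals -/

section Functionals

theorem exists_field_of_mem_allowed {z : FieldData} (hz : z.2.2 ≠ ⊤) {q : ℝ} (hq : q ∈ allowed z) :
    ∃ h', q = probFalse h' ∧ |h' - z.1| ≤ z.2.2.toReal := by
  obtain ⟨-, h', hq, -, hr⟩ := hq.2.2.resolve_left hz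
  exact ⟨h', hq, (ENNReal.ofReal_le_iff_le_toReal hz).1 hr⟩

theorem probFalse_neg (h : ℝ) : probFalse (-h) = 1 - probFalse h := by
  rw [one_sub_probFalse, probFalse, probFalse, mul_neg, Real.exp_neg]
  have := Real.exp_pos (2 * h)
  field_simp
  ring

theorem probFalse_le_exp_mul {h h' r : ℝ} (hr : |h' - h| ≤ r) :
    probFalse h' ≤ Real.exp (2 * r) * probFalse h := by
  obtain ⟨h1, -⟩ := abs_le.1 hr
  have hr0 : 0 ≤ r := (abs_nonneg _).trans hr
  rw [probFalse, probFalse, ← div_eq_mul_inv, inv_eq_one_div, div_le_div_iff₀ (by positivity)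
    (by positivity), one_mul, mul_add, mul_one, ← Real.exp_add]
  refine add_le_add (Real.one_le_exp (by positivity)) (Real.exp_le_exp.2 (by linarith))

variable {ι : Type} [Fintype ι]

theorem prodWeight_le_exp_mul {h h' r : ι → ℝ} (hr : ∀ i, |h' i - h i| ≤ r i) (y : ι → Bool) :
    prodWeight (fun i => probFalse (h' i)) y ≤
      Real.exp (2 * ∑ i, r i) * prodWeight (fun i => probFalse (h i)) y := by
  rw [Finset.mul_sum, Real.exp_sum, prodWeight, prodWeight, ← Finset.prod_mul_distrib]
  refine Finset.prod_le_prod (fun i _ => ?_) fun i _ => ?_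
  · have := probFalse_pos (h' i)
    have := probFalse_lt_one (h' i)
    split_ifs <;> linarith
  · split_ifs
    · rw [← probFalse_neg, ← probFalse_neg]
      refine probFalse_le_exp_mul ?_
      rw [neg_sub_neg, abs_sub_comm]
      exact hr i
    · exact probFalse_le_exp_mul (hr i)

variable [DecidableEq ι]

/-- The logarithm of the mean of `Λ`; the truncation to `[a, b]` is immaterial for functions `Λ`
with values in this interval. -/
def logMean (a b : ℝ) (Λ : (ι → Bool) → ℝ) (m : (ι → Bool) → ℝ) : ℝ :=
  Real.log (max a (min b ((∑ y, m y * Λ y) / ∑ y, m y)))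

/-- The logarithm of the mean of `Λ` for independent truth values with given fields. -/
def logMeanField (Λ : (ι → Bool) → ℝ) (h : ι → ℝ) : ℝ :=
  Real.log (∑ y, prodWeight (fun i => probFalse (h i)) y * Λ y)

variable {a b : ℝ} {Λ : (ι → Bool) → ℝ}

theorem abs_log_le_max {a b x : ℝ} (ha : 0 < a) (hx : a ≤ x) (hb : x ≤ b) :
    |Real.log x| ≤ max |Real.log a| |Real.log b| := by
  have h1 := Real.log_le_log ha hx
  have h2 := Real.log_le_log (ha.trans_le hx) hb
  exact abs_le_max_abs_abs h1 h2

theorem abs_logMean_le (ha : 0 < a) (hab : a ≤ b) (m : (ι → Bool) → ℝ) :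
    |logMean a b Λ m| ≤ max |Real.log a| |Real.log b| :=
  abs_log_le_max ha (le_max_left _ _) (max_le hab (min_le_left _ _))

theorem mean_mem_Icc (ha : ∀ y, a ≤ Λ y) (hb : ∀ y, Λ y ≤ b) {m : (ι → Bool) → ℝ} (hm : 0 ≤ m)
    (hm0 : m ≠ 0) : 0 < ∑ y, m y ∧ a ≤ (∑ y, m y * Λ y) / ∑ y, m y ∧
      (∑ y, m y * Λ y) / ∑ y, m y ≤ b := by
  obtain ⟨y, hy⟩ := Function.ne_iff.1 hm0
  have hpos : 0 < ∑ y, m y :=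
    Finset.sum_pos' (fun y _ => hm y) ⟨y, Finset.mem_univ y, lt_of_le_of_ne (hm y) (Ne.symm hy)⟩
  refine ⟨hpos, ?_, ?_⟩
  · rw [le_div_iff₀ hpos, mul_comm, Finset.sum_mul]
    exact Finset.sum_le_sum fun y _ => mul_le_mul_of_nonneg_left (ha y) (hm y)
  · rw [div_le_iff₀ hpos, mul_comm, Finset.sum_mul]
    exact Finset.sum_le_sum fun y _ => mul_le_mul_of_nonneg_left (hb y) (hm y)

theorem logMean_eq (ha : ∀ y, a ≤ Λ y) (hb : ∀ y, Λ y ≤ b) {m : (ι → Bool) → ℝ} (hm : 0 ≤ m)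
    (hm0 : m ≠ 0) : logMean a b Λ m = Real.log ((∑ y, m y * Λ y) / ∑ y, m y) := by
  obtain ⟨-, h1, h2⟩ := mean_mem_Icc ha hb hm hm0
  rw [logMean, min_eq_right h2, max_eq_right h1]

omit [DecidableEq ι] in
theorem prodWeight_probFalse_pos (h : ι → ℝ) (y : ι → Bool) :
    0 < prodWeight (fun i => probFalse (h i)) y := by
  refine Finset.prod_pos fun i _ => ?_
  have := probFalse_pos (h i)
  have := probFalse_lt_one (h i)
  split_ifs <;> linarith

theorem mean_prodWeight_mem_Icc (ha : ∀ y, a ≤ Λ y) (hb : ∀ y, Λ y ≤ b)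
    (h : ι → ℝ) : a ≤ ∑ y, prodWeight (fun i => probFalse (h i)) y * Λ y ∧
      ∑ y, prodWeight (fun i => probFalse (h i)) y * Λ y ≤ b := by
  have h1 := mean_mem_Icc ha hb (m := prodWeight fun i => probFalse (h i))
    (fun y => (prodWeight_probFalse_pos h y).le) fun h0 =>
      (prodWeight_probFalse_pos h fun _ => true).ne' (congrFun h0 _)
  rw [sum_prodWeight, div_one] at h1
  exact h1.2

theorem abs_logMeanField_le (ha0 : 0 < a) (ha : ∀ y, a ≤ Λ y) (hb : ∀ y, Λ y ≤ b)
    (h : ι → ℝ) : |logMeanField Λ h| ≤ max |Real.log a| |Real.log b| :=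
  abs_log_le_max ha0 (mean_prodWeight_mem_Icc ha hb h).1 (mean_prodWeight_mem_Icc ha hb h).2

theorem measurable_logMeanField : Measurable (logMeanField Λ) := by
  have := continuous_probFalse.measurable
  unfold logMeanField prodWeight
  refine Real.measurable_log.comp (Finset.measurable_fun_sum _ fun y _ => Measurable.mul_const ?_ _)
  refine Finset.measurable_fun_prod _ fun i _ => ?_
  split_ifs <;> fun_prop

/-- The logarithm of `prodWeight` is `2`-Lipschitz in each field, and the resulting bounds between
`Λ`-means are preserved by mixtures. -/
theorem approxBy_logMean (ha0 : 0 < a) (ha : ∀ y, a ≤ Λ y) (hb : ∀ y, Λ y ≤ b) :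
    ApproxBy (logMean a b Λ) (logMeanField Λ) 2 := by
  intro z hz m hm hm0
  set R := ∑ i, (z i).2.2.toReal with hR
  set G := ∑ y, prodWeight (fun i => probFalse (z i).1) y * Λ y with hG
  have hΛ0 (y) : 0 ≤ Λ y := ha0.le.trans (ha y)
  have hG0 : 0 < G := ha0.trans_le (mean_prodWeight_mem_Icc ha hb _).1
  have key : ∑ y, m y * Λ y ≤ Real.exp (2 * R) * G * ∑ y, m y ∧
      G * ∑ y, m y ≤ Real.exp (2 * R) * ∑ y, m y * Λ y := by
    clear hm0
    induction hm using Submodule.span_induction with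
    | mem m hm =>
      obtain ⟨p, hp, rfl⟩ := hm
      choose h' hph hr using fun i => exists_field_of_mem_allowed (hz i) (hp i)
      obtain rfl : p = fun i => probFalse (h' i) := funext hph
      rw [sum_prodWeight, mul_one, mul_one, hG, Finset.mul_sum _ _ (Real.exp _),
        Finset.mul_sum _ _ (Real.exp _)]
      refine ⟨Finset.sum_le_sum fun y _ => ?_, Finset.sum_le_sum fun y _ => ?_⟩
      · rw [← mul_assoc]
        exact mul_le_mul_of_nonneg_right (prodWeight_le_exp_mul hr y) (hΛ0 y)
      · rw [← mul_assoc]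
        exact mul_le_mul_of_nonneg_right (prodWeight_le_exp_mul
          (fun i => (abs_sub_comm _ _).trans_le (hr i)) y) (hΛ0 y)
    | zero => simp
    | add m m' _ _ h h' =>
      simp only [Pi.add_apply, add_mul, Finset.sum_add_distrib, mul_add]
      exact ⟨add_le_add h.1 h'.1, add_le_add h.2 h'.2⟩
    | smul c m _ h =>
      simp only [Pi.smul_apply, NNReal.smul_def, smul_eq_mul, mul_assoc, ← Finset.mul_sum]
      simp only [mul_left_comm _ (c : ℝ)]
      rw [mul_assoc] at h
      exact ⟨mul_le_mul_of_nonneg_left h.1 c.2, mul_le_mul_of_nonneg_left h.2 c.2⟩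
  have hmn := mixtures_nonneg hm
  obtain ⟨hpos, h1, h2⟩ := mean_mem_Icc ha hb hmn hm0
  rw [logMean_eq ha hb hmn hm0, logMeanField, ← hG]
  set Q := (∑ y, m y * Λ y) / ∑ y, m y with hQ
  have hQ0 : 0 < Q := ha0.trans_le h1
  have k1 : Q ≤ Real.exp (2 * R) * G := (div_le_iff₀ hpos).2 key.1
  have k2 : G ≤ Real.exp (2 * R) * Q := by
    rw [hQ, ← mul_div_assoc, le_div_iff₀ hpos]
    exact key.2
  have l1 := Real.log_le_log hQ0 k1
  have l2 := Real.log_le_log hG0 k2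
  rw [Real.log_mul (Real.exp_pos _).ne' hG0.ne', Real.log_exp] at l1
  rw [Real.log_mul (Real.exp_pos _).ne' hQ0.ne', Real.log_exp] at l2
  rw [abs_le]
  constructor <;> linarith

/-- The field of a single literal with the joint distribution `m` of its truth value. (The junk values
of the logarithm and of the division occur only if one of the two weights vanishes, which is
impossible for nonzero mixtures with a finite radius.) -/
def literalField (m : (Unit → Bool) → ℝ) : ℝ :=
  1 / 2 * Real.log (m (fun _ => true) / m fun _ => false)

theorem abs_literalField_sub_le {z : Unit → FieldData} (hz : ∀ i, (z i).2.2 ≠ ⊤)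
    {m : (Unit → Bool) → ℝ} (hm : m ∈ mixtures z) (hm0 : m ≠ 0) :
    |literalField m - (z ()).1| ≤ (z ()).2.2.toReal := by
  set r := (z ()).2.2.toReal with hr
  set h := (z ()).1 with hh
  have key : m (fun _ => true) ≤ Real.exp (2 * (h + r)) * m (fun _ => false) ∧
      Real.exp (2 * (h - r)) * m (fun _ => false) ≤ m fun _ => true := by
    clear hm0
    induction hm using Submodule.span_induction with
    | mem m hm =>
      obtain ⟨p, hp, rfl⟩ := hm
      obtain ⟨h', hph, hr⟩ := exists_field_of_mem_allowed (hz ()) (hp ())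
      obtain ⟨h1, h2⟩ := abs_le.1 hr
      simp only [prodWeight, Finset.univ_unique, Finset.prod_singleton, PUnit.default_eq_unit, hph,
        if_true, Bool.false_eq_true, if_false, one_sub_probFalse]
      have := (probFalse_pos h').le
      exact ⟨mul_le_mul_of_nonneg_right (Real.exp_le_exp.2 (by linarith)) this,
        mul_le_mul_of_nonneg_right (Real.exp_le_exp.2 (by linarith)) this⟩
    | zero => simp
    | add m m' _ _ h h' =>
      simp only [Pi.add_apply, mul_add _ (m _)]
      exact ⟨add_le_add h.1 h'.1, add_le_add h.2 h'.2⟩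
    | smul c m _ h =>
      simp only [Pi.smul_apply, NNReal.smul_def, smul_eq_mul, mul_left_comm _ (c : ℝ)]
      exact ⟨mul_le_mul_of_nonneg_left h.1 c.2, mul_le_mul_of_nonneg_left h.2 c.2⟩
  have hmn := mixtures_nonneg hm
  have hpos : 0 < m fun _ => false := by
    refine lt_of_le_of_ne (hmn _) fun h0 => hm0 ?_
    rw [← h0, mul_zero] at key
    ext y
    rcases hy : y () with _ | _
    · rw [show y = fun _ => false from funext fun _ => hy, ← h0]
      rfl
    · rw [show y = fun _ => true from funext fun _ => hy]
      exact le_antisymm key.1 (hmn _)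
  have k1 : m (fun _ => true) / m (fun _ => false) ≤ Real.exp (2 * (h + r)) :=
    (div_le_iff₀ hpos).2 key.1
  have k2 : Real.exp (2 * (h - r)) ≤ m (fun _ => true) / m (fun _ => false) :=
    (le_div_iff₀ hpos).2 key.2
  have l1 := Real.log_le_log ((Real.exp_pos _).trans_le k2) k1
  have l2 := Real.log_le_log (Real.exp_pos _) k2
  rw [Real.log_exp] at l1 l2
  rw [literalField, abs_le]
  constructor <;> linarith

theorem approxBy_literalField {φ : ℝ → ℝ} {L : ℝ≥0} (hφ : LipschitzWith L φ) :
    ApproxBy (ι := Unit) (fun m => φ (literalField m)) (fun h => φ (h ())) L := by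
  intro z hz m hm hm0
  have h1 := hφ.dist_le_mul (literalField m) (z ()).1
  rw [Real.dist_eq, Real.dist_eq] at h1
  refine h1.trans ?_
  have := abs_literalField_sub_le hz hm hm0
  simp only [Finset.univ_unique, Finset.sum_singleton, PUnit.default_eq_unit]
  gcongr

end Functionals

/-! ### The fixed point -/

section FixedPoint

variable {K : ℕ} {α : ℝ≥0} {β : ℝ}

variable (K α) in
/-- The rate for which a formula over `N` variables has `α N` clauses on average. -/
def criticalRate (N : ℕ) : ℝ≥0 := α / (2 ^ (K + 1) * N ^ K)

theorem criticalRate_mul {N : ℕ} (hN : 1 ≤ N) :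
    (criticalRate K α N : ℝ) * (2 ^ (K + 1) * (N : ℝ) ^ K) = α := by
  have : (N : ℝ) ≠ 0 := by positivity
  unfold criticalRate
  push_cast
  field_simp

theorem tendsto_criticalRate :
    Tendsto (fun N : ℕ => (N, criticalRate K α N)) atTop (sparse K α) := by
  refine tendsto_comap_iff.2 (tendsto_id.prodMk (tendsto_const_nhds.congr' ?_))
  filter_upwards [eventually_ge_atTop 1] with N hN
  exact (criticalRate_mul hN).symm

instance : (sparse K α).NeBot := tendsto_criticalRate.neBot

theorem integral_unit_pi (ν : ProbabilityMeasure ℝ) {φ : ℝ → ℝ} (hφ : Measurable φ) :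
    ∫ h : Unit → ℝ, φ (h ()) ∂(Measure.pi fun _ => (ν : Measure ℝ)) = ∫ x, φ x ∂(ν : Measure ℝ) := by
  have h := integral_map (μ := Measure.pi fun _ : Unit => (ν : Measure ℝ))
    (measurable_pi_apply ()).aemeasurable hφ.aestronglyMeasurable
  rw [(measurePreserving_eval (fun _ : Unit => (ν : Measure ℝ)) ()).map_eq] at h
  exact h.symm

/-- The laws of the reference fields for different depths and different initial laws are close,
since both are close to the law of the field of a literal in a sparse random formula. -/
theorem abs_integral_refLaw_sub_le (hK : 1 ≤ K) (hβ : 0 ≤ β) {φ : ℝ → ℝ} {L : ℝ≥0} {C : ℝ}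
    (hφ : LipschitzWith L φ) (hC : ∀ x, |φ x| ≤ C) (ν ν' : ProbabilityMeasure ℝ) (s t : ℕ) :
    |∫ x, φ x ∂(refLaw K α β ν (s + 1) : Measure ℝ) -
        ∫ x, φ x ∂(refLaw K α β ν' (t + 1) : Measure ℝ)| ≤
      L * (radiusBound K α β s + radiusBound K α β t) := by
  have hm : Measurable φ := hφ.continuous.measurable
  refine le_of_forall_pos_le_add fun ε hε => ?_
  have h (ν : ProbabilityMeasure ℝ) (t : ℕ) := eventually_abs_integral_sub_le (α := α) (ν₀ := ν) hK
    hβ (g := fun h : Unit → ℝ => φ (h ())) L.coe_nonneg (by fun_prop) (fun m => hC (literalField m))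
    (fun h => hC _) (approxBy_literalField hφ) t (half_pos hε)
  obtain ⟨p, ⟨h1, h2⟩, hp⟩ := ((h ν s).and (h ν' t)).and (eventually_sparse_ge 1) |>.exists
  have h3 := h1 (Fin p.1) (by simp) (fun _ => (⟨0, hp⟩, true)) (Function.injective_of_subsingleton _)
  have h4 := h2 (Fin p.1) (by simp) (fun _ => (⟨0, hp⟩, true)) (Function.injective_of_subsingleton _)
  rw [integral_unit_pi _ hm] at h3 h4
  rw [Fintype.card_unit, Nat.cast_one, one_mul] at h3 h4
  rw [abs_le] at h3 h4 ⊢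
  constructor <;> linarith [h3.1, h3.2, h4.1, h4.2]

/-- Laws with the same characteristic function agree. -/
theorem eq_of_integral_cos_sin {μ ν : ProbabilityMeasure ℝ}
    (hc : ∀ s : ℝ, ∫ x, Real.cos (s * x) ∂(μ : Measure ℝ) = ∫ x, Real.cos (s * x) ∂(ν : Measure ℝ))
    (hs : ∀ s : ℝ, ∫ x, Real.sin (s * x) ∂(μ : Measure ℝ) = ∫ x, Real.sin (s * x) ∂(ν : Measure ℝ)) :
    μ = ν := by
  have h (μ : ProbabilityMeasure ℝ) (s : ℝ) : charFun (μ : Measure ℝ) s =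
      ((∫ x, Real.cos (s * x) ∂(μ : Measure ℝ) : ℝ) : ℂ) +
        (∫ x, Real.sin (s * x) ∂(μ : Measure ℝ) : ℝ) * Complex.I := by
    have h1 : Integrable (fun x : ℝ => ((Real.cos (s * x) : ℝ) : ℂ)) (μ : Measure ℝ) :=
      .of_bound (by fun_prop) 1 (.of_forall fun x => by
        rw [Complex.norm_real]; exact Real.abs_cos_le_one _)
    have h2 : Integrable (fun x : ℝ => ((Real.sin (s * x) : ℝ) : ℂ)) (μ : Measure ℝ) :=
      .of_bound (by fun_prop) 1 (.of_forall fun x => by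
        rw [Complex.norm_real]; exact Real.abs_sin_le_one _)
    rw [charFun_apply_real, ← integral_complex_ofReal, ← integral_complex_ofReal, ← integral_mul_const,
      ← integral_add h1 (h2.mul_const _)]
    refine integral_congr_ae (.of_forall fun x => ?_)
    simp only
    rw [Complex.exp_mul_I]
    push_cast
    rfl
  have h' : (μ : Measure ℝ) = ν := Measure.ext_of_charFun (by
    ext s
    rw [h, h, hc, hs])
  exact Subtype.ext h'

theorem lipschitzWith_cos_mul (s : ℝ) : LipschitzWith ‖s‖₊ fun x : ℝ => Real.cos (s * x) := by
  refine LipschitzWith.of_dist_le_mul fun x y => ?_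
  rw [Real.dist_eq, Real.dist_eq]
  refine (Real.abs_cos_sub_cos_le _ _).trans ?_
  rw [← mul_sub, abs_mul]
  rfl

theorem lipschitzWith_sin_mul (s : ℝ) : LipschitzWith ‖s‖₊ fun x : ℝ => Real.sin (s * x) := by
  refine LipschitzWith.of_dist_le_mul fun x y => ?_
  rw [Real.dist_eq, Real.dist_eq]
  refine (Real.abs_sin_sub_sin_le _ _).trans ?_
  rw [← mul_sub, abs_mul]
  rfl

/-- Both fixed points approximate the law of the field of a literal in the same random formula. -/
theorem eq_of_fixed (hK : 1 ≤ K) (hα : (α : ℝ) < alphaStar (K + 1)) (hβ : 0 ≤ β)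
    {ν ν' : ProbabilityMeasure ℝ} (hν : S₂ (K + 1) α (S₁ (K + 1) β ν) = ν)
    (hν' : S₂ (K + 1) α (S₁ (K + 1) β ν') = ν') : ν = ν' := by
  have key (φ : ℝ → ℝ) (L : ℝ≥0) (hφ : LipschitzWith L φ) (hC : ∀ x, |φ x| ≤ 1) :
      ∫ x, φ x ∂(ν : Measure ℝ) = ∫ x, φ x ∂(ν' : Measure ℝ) := by
    have h1 (t : ℕ) := abs_integral_refLaw_sub_le (α := α) hK hβ hφ hC ν ν' t t
    have href (t : ℕ) : refLaw K α β ν t = ν := Function.iterate_fixed hν t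
    have href' (t : ℕ) : refLaw K α β ν' t = ν' := Function.iterate_fixed hν' t
    simp_rw [href, href'] at h1
    have h2 := ((tendsto_radiusBound (β := β) hK hα).add
      (tendsto_radiusBound (β := β) hK hα)).const_mul (L : ℝ)
    rw [add_zero, mul_zero] at h2
    exact sub_eq_zero.1 (abs_nonpos_iff.1 (ge_of_tendsto' h2 h1))
  exact eq_of_integral_cos_sin
    (fun s => key _ _ (lipschitzWith_cos_mul s) fun x => Real.abs_cos_le_one _)
    (fun s => key _ _ (lipschitzWith_sin_mul s) fun x => Real.abs_sin_le_one _)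

theorem continuous_pi_const (ι : Type) [Fintype ι] :
    Continuous fun ν : ProbabilityMeasure ℝ => ProbabilityMeasure.pi fun _ : ι => ν :=
  ProbabilityMeasure.continuous_pi.comp (continuous_pi fun _ => continuous_id)

theorem continuous_bpFun (hβ : 0 ≤ β) : Continuous (bpFun (K + 1) β) := by
  have h := continuous_message_probFalse hβ K
  exact h.congr fun x => (bpFun_succ K β x).symm

theorem continuous_S₁ (hβ : 0 ≤ β) : Continuous (S₁ (K + 1) β) :=
  (ProbabilityMeasure.continuous_map (continuous_bpFun hβ)).comp (continuous_pi_const (Fin K))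

theorem integral_S₂ (μ : ProbabilityMeasure ℝ) {k : ℕ} {φ : ℝ → ℝ} (hφ : Measurable φ) {C : ℝ}
    (hC : ∀ x, |φ x| ≤ C) : ∫ x, φ x ∂(S₂ k α μ : Measure ℝ) =
      ∫ ℓ, ∫ u, φ (signedSum ℓ u) ∂(Measure.pi fun _ => (μ : Measure ℝ))
        ∂(degreeLaw (occRate k α)) := by
  rw [S₂_eq_bind, integral_bind_of_bounded (fun ℓ =>
    Measure.isProbabilityMeasure_map (measurable_signedSum ℓ).aemeasurable) hφ hC]
  exact integral_congr_ae (.of_forall fun ℓ =>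
    integral_map (measurable_signedSum ℓ).aemeasurable hφ.aestronglyMeasurable)

theorem continuous_S₂ (k : ℕ) : Continuous (S₂ k α) := by
  refine continuous_iff_continuousAt.2 fun μ => ?_
  refine ProbabilityMeasure.tendsto_iff_forall_integral_tendsto.2 fun f => ?_
  have hC (x : ℝ) : |f x| ≤ ‖f‖ := f.norm_coe_le_norm x
  simp_rw [fun μ => integral_S₂ (α := α) μ (k := k) f.continuous.measurable hC]
  refine tendsto_integral_poisson_prod tendsto_const_nhds (A := ‖f‖) (B := 0) le_rfl
    (fun ℓ => ?_) (fun ν ℓ => ?_) (fun ℓ => ?_)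
  · have hc : Continuous (signedSum ℓ) := by unfold signedSum; fun_prop
    have h1 := (continuous_pi_const (Fin ℓ.1 ⊕ Fin ℓ.2)).tendsto μ
    exact ProbabilityMeasure.tendsto_iff_forall_integral_tendsto.1 h1
      (f.compContinuous ⟨signedSum ℓ, hc⟩)
  · rw [zero_mul, add_zero]
    exact abs_integral_le_of_abs_le fun _ => hC _
  · rw [zero_mul, add_zero]
    exact abs_integral_le_of_abs_le fun _ => hC _

theorem bpFun_mem_Icc (hβ : 0 ≤ β) (h : Fin K → ℝ) : bpFun (K + 1) β h ∈ Set.Icc 0 (β / 2) := by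
  have hp (j : Fin K) : 0 ≤ probFalse (h j) ∧ probFalse (h j) ≤ 1 :=
    ⟨(probFalse_pos _).le, (probFalse_lt_one _).le⟩
  rw [bpFun_succ]
  exact ⟨message_nonneg hβ hp, message_le hβ hp⟩

/-- A limit point of the iterates of `S₂ ∘ S₁` is a fixed point, because consecutive iterates
approach each other. It exists since all messages lie in the compact interval `[0, β / 2]`. -/
theorem exists_fixed (hK : 1 ≤ K) (hα : (α : ℝ) < alphaStar (K + 1)) (hβ : 0 ≤ β) :
    ∃ ν : ProbabilityMeasure ℝ, S₂ (K + 1) α (S₁ (K + 1) β ν) = ν := by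
  set ν₀ : ProbabilityMeasure ℝ := ⟨Measure.dirac 0, inferInstance⟩
  set ν : ℕ → ProbabilityMeasure ℝ := refLaw K α β ν₀ with hν
  have hsucc (t : ℕ) : ν (t + 1) = S₂ (K + 1) α (S₁ (K + 1) β (ν t)) :=
    Function.iterate_succ_apply' _ t ν₀
  have hcomp := isCompact_setOfPred_probabilityMeasure_mass_eq_compl_isCompact_le (E := ℝ)
    (u := fun _ => 0) (K := fun _ => Set.Icc 0 (β / 2)) tendsto_const_nhds
    (fun _ => isCompact_Icc) (Or.inr monotone_const)
  have hmem (t : ℕ) : S₁ (K + 1) β (ν t) ∈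
      {μ : ProbabilityMeasure ℝ | ∀ _ : ℕ, μ (Set.Icc 0 (β / 2))ᶜ ≤ 0} := by
    intro _
    rw [nonpos_iff_eq_zero, ProbabilityMeasure.null_iff_toMeasure_null]
    refine (Measure.map_apply (measurable_bpFun (K + 1) β) measurableSet_Icc.compl).trans ?_
    have : bpFun (K + 1) β ⁻¹' (Set.Icc 0 (β / 2))ᶜ = ∅ := by
      ext h
      simpa using (bpFun_mem_Icc hβ h)
    rw [this, measure_empty]
  let U : Ultrafilter ℕ := hyperfilter ℕ
  have hU : (U : Filter ℕ) ≤ atTop := Nat.hyperfilter_le_atTop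
  obtain ⟨μ, -, hμ⟩ := hcomp.ultrafilter_le_nhds (U.map fun t => S₁ (K + 1) β (ν t))
    (by
      rw [Ultrafilter.coe_map, le_principal_iff, mem_map]
      exact univ_mem' hmem)
  have hμ' : Tendsto (fun t => S₁ (K + 1) β (ν t)) U (𝓝 μ) := hμ
  have h1 : Tendsto (fun t => ν (t + 1)) U (𝓝 (S₂ (K + 1) α μ)) := by
    simp_rw [hsucc]
    exact ((continuous_S₂ (K + 1)).tendsto μ).comp hμ'
  have h2 : Tendsto (fun t => ν (t + 1 + 1)) U
      (𝓝 (S₂ (K + 1) α (S₁ (K + 1) β (S₂ (K + 1) α μ)))) := by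
    simp_rw [fun t => hsucc (t + 1)]
    exact (((continuous_S₂ (K + 1)).comp (continuous_S₁ hβ)).tendsto _).comp h1
  refine ⟨S₂ (K + 1) α μ, ?_⟩
  have key (φ : ℝ → ℝ) (L : ℝ≥0) (hφ : LipschitzWith L φ) (hC : ∀ x, |φ x| ≤ 1) :
      ∫ x, φ x ∂(S₂ (K + 1) α (S₁ (K + 1) β (S₂ (K + 1) α μ)) : Measure ℝ) =
        ∫ x, φ x ∂(S₂ (K + 1) α μ : Measure ℝ) := by
    let f : BoundedContinuousFunction ℝ ℝ :=
      BoundedContinuousFunction.ofNormedAddCommGroup φ hφ.continuous 1 hC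
    have t1 := ProbabilityMeasure.tendsto_iff_forall_integral_tendsto.1 h1 f
    have t2 := ProbabilityMeasure.tendsto_iff_forall_integral_tendsto.1 h2 f
    have t3 := (t2.sub t1).abs
    have hb (t : ℕ) := abs_integral_refLaw_sub_le (α := α) hK hβ hφ hC ν₀ ν₀ (t + 1) t
    have hr := tendsto_radiusBound (β := β) hK hα
    have h4 := (((tendsto_add_atTop_iff_nat 1).2 hr).add hr).const_mul (L : ℝ)
    rw [add_zero, mul_zero] at h4
    have h5 := le_of_tendsto_of_tendsto' t3 (h4.mono_left hU) hb
    exact sub_eq_zero.1 (abs_nonpos_iff.1 h5)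
  exact eq_of_integral_cos_sin
    (fun s => key _ _ (lipschitzWith_cos_mul s) fun x => Real.abs_cos_le_one _)
    (fun s => key _ _ (lipschitzWith_sin_mul s) fun x => Real.abs_sin_le_one _)

theorem existsUnique_fixed (hK : 1 ≤ K) (hα : (α : ℝ) < alphaStar (K + 1)) (hβ : 0 ≤ β) :
    ∃! μ : ProbabilityMeasure ℝ, S (K + 1) α β μ = μ := by
  obtain ⟨ν, hν⟩ := exists_fixed hK hα hβ
  refine ⟨S₁ (K + 1) β ν, congrArg (S₁ (K + 1) β) hν, fun μ hμ => ?_⟩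
  have hμ' : S₁ (K + 1) β (S₂ (K + 1) α μ) = μ := hμ
  have : S₂ (K + 1) α μ = ν := eq_of_fixed hK hα hβ (congrArg (S₂ (K + 1) α) hμ') hν
  rw [← this, hμ']

end FixedPoint

/-! ### The free entropy of Poissonian formulas -/

section WeightBounds

variable {k : ℕ} {V : Type} [Fintype V] {β : ℝ}

theorem weight_add (η η' : Tuple k V → ℕ) (x : V → Bool) :
    weight β (η + η') x = weight β η x * weight β η' x := by
  simp only [weight, Pi.add_apply, pow_add, Finset.prod_mul_distrib]

theorem exp_le_weight (hβ : 0 ≤ β) (η : Tuple k V → ℕ) (x : V → Bool) :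
    Real.exp (-(β * ∑ c, (η c : ℝ))) ≤ weight β η x := by
  rw [← neg_mul, Finset.mul_sum, Real.exp_sum]
  refine Finset.prod_le_prod (fun c _ => (Real.exp_pos _).le) fun c _ => ?_
  rw [mul_comm, Real.exp_nat_mul]
  exact pow_le_pow_left₀ (Real.exp_pos _).le (exp_le_penalty hβ _) _

variable [DecidableEq V]

theorem sum_weight_pos (η : Tuple k V → ℕ) : 0 < ∑ x, weight β η x :=
  Finset.sum_pos (fun x _ => weight_pos β η x) Finset.univ_nonempty

/-- Adding clauses lowers the logarithm of the partition function by at most `β` per clause. -/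
theorem log_sum_weight_add_mem (hβ : 0 ≤ β) (η η' : Tuple k V → ℕ) :
    Real.log (∑ x, weight β (η + η') x) ≤ Real.log (∑ x, weight β η x) ∧
      Real.log (∑ x, weight β η x) - β * ∑ c, (η' c : ℝ) ≤
        Real.log (∑ x, weight β (η + η') x) := by
  constructor
  · refine Real.log_le_log (sum_weight_pos _) (Finset.sum_le_sum fun x _ => ?_)
    rw [weight_add]
    exact mul_le_of_le_one_right (weight_pos β η x).le (weight_le_one hβ η' x)
  · rw [sub_le_iff_le_add, ← Real.log_exp (β * ∑ c, (η' c : ℝ)),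
      ← Real.log_mul (sum_weight_pos _).ne' (Real.exp_pos _).ne', Finset.sum_mul]
    refine Real.log_le_log (sum_weight_pos _) (Finset.sum_le_sum fun x _ => ?_)
    rw [weight_add, mul_assoc]
    refine le_mul_of_one_le_right (weight_pos β η x).le ?_
    have := mul_le_mul_of_nonneg_right (exp_le_weight hβ η' x)
      (Real.exp_pos (β * ∑ c, (η' c : ℝ))).le
    rwa [← Real.exp_add, neg_add_cancel, Real.exp_zero] at this

theorem abs_log_sum_weight_le (hβ : 0 ≤ β) (η : Tuple k V → ℕ) :
    |Real.log (∑ x, weight β η x)| ≤ Fintype.card V * Real.log 2 + β * ∑ c, (η c : ℝ) := by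
  have h := log_sum_weight_add_mem hβ (0 : Tuple k V → ℕ) η
  have h0 : Real.log (∑ x : V → Bool, weight β (0 : Tuple k V → ℕ) x) =
      Fintype.card V * Real.log 2 := by
    simp [weight]
  rw [h0, zero_add] at h
  have h1 : 0 ≤ Fintype.card V * Real.log 2 := by
    have := Real.log_nonneg one_le_two
    positivity
  have h2 : 0 ≤ β * ∑ c, (η c : ℝ) := by positivity
  rw [abs_le]
  constructor <;> linarith [h.1, h.2]

variable (k V β) in
/-- The mean logarithm of the partition function of a Poissonian formula. -/
def meanLog (γ : ℝ≥0) : ℝ := ∫ η, Real.log (∑ x, weight β η x) ∂(poissonPi (Tuple k V) γ)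

theorem integrable_log_sum_weight (hβ : 0 ≤ β) (γ : ℝ≥0) :
    Integrable (fun η => Real.log (∑ x, weight β η x)) (poissonPi (Tuple k V) γ) :=
  integrable_poissonPi_of_le (abs_log_sum_weight_le hβ)

theorem meanLog_congr {V' : Type} [Fintype V'] [DecidableEq V'] (σ : V ≃ V') (γ : ℝ≥0) :
    meanLog k V β γ = meanLog k V' β γ := by
  let f : Tuple k V → Tuple k V' := fun c j => (σ (c j).1, (c j).2)
  have hf : Function.Bijective f := by
    refine (Equiv.arrowCongr (Equiv.refl (Fin k)) (σ.prodCongr (Equiv.refl Bool))).bijective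
  have hw (η : Tuple k V' → ℕ) : ∑ x, weight β (η ∘ f) x = ∑ x, weight β η x := by
    rw [← (Equiv.arrowCongr σ (Equiv.refl Bool)).sum_comp]
    refine Finset.sum_congr rfl fun x _ => ?_
    rw [weight, weight, ← hf.prod_comp]
    refine Finset.prod_congr rfl fun c _ => ?_
    congr 2
    funext j
    simp [litVal, f, Equiv.arrowCongr]
  rw [meanLog, ← (measurePreserving_comp_injective (γ := γ) hf.1).map_eq,
    integral_map Measurable.of_discrete.aemeasurable Measurable.of_discrete.aestronglyMeasurable]
  simp_rw [hw]
  rfl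

/-- The effect of the factor `Λ` on the partition function, in terms of a joint marginal. -/
theorem log_sum_mul_eq {J : Type} [Fintype J] [DecidableEq J] {a b : ℝ} {Λ : (J → Bool) → ℝ}
    (ha0 : 0 < a) (ha : ∀ w, a ≤ Λ w) (hb : ∀ w, Λ w ≤ b) (η : Tuple k V → ℕ)
    (d : J → V × Bool) :
    Real.log (∑ x, weight β η x * Λ fun j => litVal x (d j)) =
      Real.log (∑ x, weight β η x) + logMean a b Λ (marginal d (weight β η)) := by
  have hm := marginal_nonneg (e := d) fun x => (weight_pos β η x).le
  have hm0 := marginal_weight_ne_zero d fun x => weight_pos β η x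
  have h1 := sum_marginal_mul d (weight β η) Λ
  have h2 := sum_marginal_mul d (weight β η) fun _ => 1
  simp only [mul_one] at h2
  obtain ⟨h3, h4, -⟩ := mean_mem_Icc ha hb hm hm0
  rw [logMean_eq ha hb hm hm0, ← h1, ← h2, ← Real.log_mul h3.ne' (ha0.trans_le h4).ne',
    mul_div_cancel₀ _ h3.ne']

end WeightBounds

section Recursion

variable {K : ℕ} {α : ℝ≥0} {β : ℝ} {ν : ProbabilityMeasure ℝ}

/-- The local limit for independent uniform literals. -/
theorem eventually_abs_expect_sub_le (hK : 1 ≤ K) (hα : (α : ℝ) < alphaStar (K + 1))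
    (hβ : 0 ≤ β) (hν : S₂ (K + 1) α (S₁ (K + 1) β ν) = ν) {J : Type} [Fintype J] [DecidableEq J]
    {Ψ : ((J → Bool) → ℝ) → ℝ} {g : (J → ℝ) → ℝ} {L C : ℝ} (hL : 0 ≤ L) (hg : Measurable g)
    (hΨC : ∀ m, |Ψ m| ≤ C) (hgC : ∀ h, |g h| ≤ C) (hΨ : ApproxBy Ψ g L) {ε : ℝ} (hε : 0 < ε) :
    ∀ᶠ p in sparse K α, ∀ (V : Type) [Fintype V] [DecidableEq V], Fintype.card V = p.1 →
      |𝔼 d : J → V × Bool, ∫ η, Ψ (marginal d (weight β η)) ∂(poissonPi (Tuple (K + 1) V) p.2) -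
        ∫ h, g h ∂(Measure.pi fun _ : J => (ν : Measure ℝ))| ≤ ε := by
  set I := ∫ h, g h ∂(Measure.pi fun _ : J => (ν : Measure ℝ)) with hI
  have hIC : |I| ≤ C := abs_integral_le_of_abs_le hgC
  have hε4 : 0 < ε / 2 := half_pos hε
  have h2 := (((tendsto_const_div_atTop_nhds_zero_nat
    ((Fintype.card J : ℝ) * (Fintype.card Empty + Fintype.card J))).comp
      (tendsto_fst_sparse K α)).const_mul (2 * (C + ε))).eventually_le_const (u := ε / 2)
        (by rw [mul_zero]; exact hε4)
  filter_upwards [eventually_abs_integral_sub_le_of_fixed hK hα hβ hν hL hg hΨC hgC hΨ hε4, h2,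
    eventually_sparse_ge 1] with p hp h2 hp1 V _ _ hV
  have : Nonempty V := by
    rw [← Fintype.card_pos_iff, hV]
    omega
  have hinj (d : J → V × Bool)
      (hd : Function.Injective (Sum.elim (Empty.elim : Empty → V) fun j => (d j).1)) :
      Function.Injective fun j => (d j).1 := hd.comp Sum.inr_injective
  have hbd (d : J → V × Bool) :
      |∫ η, Ψ (marginal d (weight β η)) ∂(poissonPi (Tuple (K + 1) V) p.2)| ≤ C :=
    abs_integral_le_of_abs_le fun _ => hΨC _
  simp only [Function.comp_apply] at h2
  rw [← hV] at h2
  have hup := expect_le_of_injective (e := (Empty.elim : Empty → V)) (fun x => x.elim)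
    (H := fun d : J → V × Bool => ∫ η, Ψ (marginal d (weight β η))
      ∂(poissonPi (Tuple (K + 1) V) p.2)) (b := I + ε / 2) (C := C + ε)
    ((abs_add_le _ _).trans (add_le_add hIC (by rw [abs_of_pos hε4]; linarith)))
    (fun d => ((le_abs_self _).trans (hbd d)).trans (by linarith))
    (fun d hd => by linarith [(abs_le.1 (hp V hV d (hinj d hd))).2])
  have hlow := expect_le_of_injective (e := (Empty.elim : Empty → V)) (fun x => x.elim)
    (H := fun d : J → V × Bool => -∫ η, Ψ (marginal d (weight β η))
      ∂(poissonPi (Tuple (K + 1) V) p.2)) (b := -I + ε / 2) (C := C + ε)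
    ((abs_add_le _ _).trans (add_le_add (by rwa [abs_neg]) (by rw [abs_of_pos hε4]; linarith)))
    (fun d => ((neg_le_abs _).trans (hbd d)).trans (by linarith))
    (fun d hd => by linarith [(abs_le.1 (hp V hV d (hinj d hd))).1])
  rw [Finset.expect_neg_distrib] at hlow
  rw [abs_le]
  constructor <;> linarith

variable (β) in
/-- The weight of the clauses that contain a given variable, summed over its values. -/
def vertexFactor (ℓ : ℕ × ℕ) (w : Nbr K ℓ → Bool) : ℝ := ∑ y, branchWeight β ℓ y w

theorem vertexFactor_le (hβ : 0 ≤ β) (ℓ : ℕ × ℕ) (w : Nbr K ℓ → Bool) :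
    vertexFactor β ℓ w ≤ 2 := by
  have := branchWeight_le_one hβ ℓ true w
  have := branchWeight_le_one hβ ℓ false w
  rw [vertexFactor, Fintype.sum_bool]
  linarith

theorem exp_le_branchWeight (hβ : 0 ≤ β) (ℓ : ℕ × ℕ) (y : Bool) (w : Nbr K ℓ → Bool) :
    Real.exp (-(β * (ℓ.1 + ℓ.2))) ≤ branchWeight β ℓ y w := by
  have h : ∏ _a : Fin ℓ.1 ⊕ Fin ℓ.2, Real.exp (-β) = Real.exp (-(β * (ℓ.1 + ℓ.2))) := by
    rw [Finset.prod_const, Finset.card_univ, ← Real.exp_nat_mul]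
    congr 1
    simp
    ring
  rw [← h, branchWeight]
  refine Finset.prod_le_prod (fun c _ => (Real.exp_pos _).le) fun c _ => ?_
  split_ifs
  · simpa using hβ
  · exact exp_le_penalty hβ _

theorem exp_le_vertexFactor (hβ : 0 ≤ β) (ℓ : ℕ × ℕ) (w : Nbr K ℓ → Bool) :
    Real.exp (-(β * (ℓ.1 + ℓ.2))) ≤ vertexFactor β ℓ w := by
  have := exp_le_branchWeight hβ ℓ true w
  have := branchWeight_pos β ℓ false w
  rw [vertexFactor, Fintype.sum_bool]
  linarith

theorem max_abs_log_exp_le (hβ : 0 ≤ β) (s : ℝ) (hs : 0 ≤ s) :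
    max |Real.log (Real.exp (-(β * s)))| |Real.log 2| ≤ Real.log 2 + β * s := by
  have h2 := Real.log_nonneg one_le_two
  rw [Real.log_exp, abs_neg, abs_of_nonneg (by positivity : 0 ≤ β * s), abs_of_nonneg h2]
  refine max_le ?_ ?_
  · linarith
  · linarith [(by positivity : 0 ≤ β * s)]

theorem abs_logMean_vertexFactor_le (hβ : 0 ≤ β) (ℓ : ℕ × ℕ) (m : (Nbr K ℓ → Bool) → ℝ) :
    |logMean (Real.exp (-(β * (ℓ.1 + ℓ.2)))) 2 (vertexFactor β ℓ) m| ≤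
      Real.log 2 + β * (ℓ.1 + ℓ.2) :=
  (abs_logMean_le (Real.exp_pos _) ((exp_le_vertexFactor hβ ℓ fun _ : Nbr K ℓ => true).trans
    (vertexFactor_le hβ ℓ _)) _).trans (max_abs_log_exp_le hβ _ (by positivity))

variable (K α β ν) in
/-- The contribution of a variable to the free entropy. -/
def vertexEntropy : ℝ :=
  ∫ ℓ, ∫ h, logMeanField (vertexFactor (K := K) β ℓ) h ∂(Measure.pi fun _ => (ν : Measure ℝ))
    ∂(degreeLaw (occRate (K + 1) α))

/-- The effect of a variable and its clauses on the mean free entropy. The error comes from the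
clauses that contain the variable more than once. -/
theorem abs_meanLog_sub_sub_le (hβ : 0 ≤ β) (γ : ℝ≥0) {V : Type} [Fintype V] [DecidableEq V]
    (v₀ : V) {N : ℕ} (hN : 1 ≤ N)
    (hV : Fintype.card V = N + 1) :
    |meanLog (K + 1) V β γ - meanLog (K + 1) {v // v ≠ v₀} β γ -
      ∫ ℓ, (𝔼 d : Nbr K ℓ → {v // v ≠ v₀} × Bool,
        ∫ η, logMean (Real.exp (-(β * (ℓ.1 + ℓ.2)))) 2 (vertexFactor β ℓ) (marginal d (weight β η))
          ∂(poissonPi (Tuple (K + 1) {v // v ≠ v₀}) γ))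
        ∂(degreeLaw (γ * ((K + 1) * (2 * (N : ℝ≥0)) ^ K)))| ≤
      β * (γ * ((2 * (N + 1)) ^ (K + 1) - (2 * N) ^ (K + 1) - 2 * ((K + 1) * (2 * N) ^ K))) := by
  have h := abs_integral_sub_removeVertex_le (K := K) (β := β) (v₀, true) γ
    (G := fun W => Real.log (∑ x, W x)) (a := Fintype.card V * Real.log 2) (b := β) (C := β)
    (by have := Real.log_nonneg one_le_two; positivity) hβ (abs_log_sum_weight_le hβ) ?_
  · rw [card_multiClauses (v₀, true) hV, card_slot, hV] at h
    have hr : γ * (((K + 1) * (2 * (N + 1 - 1)) ^ K : ℕ) : ℝ≥0) =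
        γ * ((K + 1) * (2 * (N : ℝ≥0)) ^ K) := by
      simp
    rw [hr] at h
    refine le_trans (le_of_eq (congrArg _ ?_)) h
    rw [sub_sub]
    congr 1
    have hi : Integrable (fun ℓ : ℕ × ℕ => 𝔼 d : Nbr K ℓ → {v // v ≠ v₀} × Bool,
        ∫ η, logMean (Real.exp (-(β * (ℓ.1 + ℓ.2)))) 2 (vertexFactor β ℓ) (marginal d (weight β η))
          ∂(poissonPi (Tuple (K + 1) {v // v ≠ v₀}) γ))
        (degreeLaw (γ * ((K + 1) * (2 * (N : ℝ≥0)) ^ K))) := by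
      refine integrable_poisson_prod_of_le (A := Real.log 2) (B := β) fun ℓ => ?_
      refine (abs_expect_le (C := Real.log 2 + β * (ℓ.1 + ℓ.2)) ?_ fun d =>
        abs_integral_le_of_abs_le fun η => ?_)
      · have := Real.log_nonneg one_le_two
        positivity
      · exact abs_logMean_vertexFactor_le hβ ℓ _
    have hc : meanLog (K + 1) {v // v ≠ v₀} β γ = ∫ _, meanLog (K + 1) {v // v ≠ v₀} β γ
        ∂(degreeLaw (γ * ((K + 1) * (2 * (N : ℝ≥0)) ^ K))) := by simp
    rw [hc, ← integral_add (integrable_const _) hi]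
    refine integral_congr_ae (.of_forall fun ℓ => ?_)
    simp only
    have hne : Nonempty {v // v ≠ v₀} := by
      rw [← Fintype.card_pos_iff, Fintype.card_subtype_compl, Fintype.card_subtype_eq, hV]
      omega
    have hc' : meanLog (K + 1) {v // v ≠ v₀} β γ = 𝔼 _d : Nbr K ℓ → {v // v ≠ v₀} × Bool,
        meanLog (K + 1) {v // v ≠ v₀} β γ := (Finset.expect_const Finset.univ_nonempty _).symm
    rw [hc', ← Finset.expect_add_distrib]
    refine Finset.expect_congr rfl fun d _ => ?_
    rw [meanLog, ← integral_add (integrable_log_sum_weight hβ γ)]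
    · refine integral_congr_ae (.of_forall fun η => ?_)
      simp only
      rw [← log_sum_mul_eq (Real.exp_pos _) (exp_le_vertexFactor hβ ℓ) (vertexFactor_le hβ ℓ)]
      congr 1
      rw [sum_removeVertex (v₀ := v₀) true fun y x' => weight β η x' * branchWeight β ℓ y
        fun a => litVal x' (d a)]
      exact Finset.sum_congr rfl fun x' _ => by rw [vertexFactor, Finset.mul_sum]
    · exact .of_bound Measurable.of_discrete.aestronglyMeasurable _ (.of_forall fun η =>
        abs_logMean_vertexFactor_le hβ ℓ _)
  · intro η η' hle hη
    have hsum : η = η' + (η - η') := by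
      funext c
      simp [Nat.add_sub_cancel' (hle c)]
    have h1 := log_sum_weight_add_mem hβ η' (η - η')
    rw [← hsum] at h1
    have h2 : ∑ c, (((η - η') c : ℕ) : ℝ) ≤ ∑ c ∈ multiClauses K (v₀, true), (η c : ℝ) := by
      rw [← Finset.sum_subset (Finset.subset_univ (multiClauses K (v₀, true))) fun c _ hc => ?_]
      · refine Finset.sum_le_sum fun c _ => ?_
        exact_mod_cast Nat.sub_le _ _
      · simp [hη c hc]
    have h3 := mul_le_mul_of_nonneg_left h2 hβ
    have h4 : 0 ≤ β * ∑ c ∈ multiClauses K (v₀, true), (η c : ℝ) := by positivity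
    rw [abs_le]
    constructor <;> linarith [h1.1, h1.2]

theorem measurable_clauseTerm (k : ℕ) (β : ℝ) : Measurable (clauseTerm k β) := by
  have h : Measurable Real.tanh := continuous_tanh.measurable
  unfold clauseTerm
  fun_prop

theorem clauseTerm_eq (k : ℕ) (β : ℝ) (h : Fin k → ℝ) :
    clauseTerm k β h = Real.log (1 - (1 - Real.exp (-β)) * ∏ i, probFalse (h i)) := by
  unfold clauseTerm
  simp_rw [probFalse_eq_tanh, Finset.prod_div_distrib]
  simp only [Finset.prod_const, Finset.card_univ, Fintype.card_fin]
  congr 2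
  ring

theorem prod_probFalse_le_one {k : ℕ} (h : Fin k → ℝ) : ∏ i, probFalse (h i) ≤ 1 :=
  Finset.prod_le_one (fun _ _ => (probFalse_pos _).le) fun _ _ => (probFalse_lt_one _).le

theorem abs_clauseTerm_le (hβ : 0 ≤ β) (k : ℕ) (h : Fin k → ℝ) : |clauseTerm k β h| ≤ β := by
  have h1 := exp_neg_le_one_sub hβ (prod_probFalse_le_one h)
  have h0 : 0 ≤ ∏ i, probFalse (h i) := Finset.prod_nonneg fun i _ => (probFalse_pos _).le
  have h2 : 1 - (1 - Real.exp (-β)) * ∏ i, probFalse (h i) ≤ 1 := by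
    nlinarith [(one_sub_exp_neg_mem hβ).1]
  rw [clauseTerm_eq, abs_le]
  have h3 := Real.log_le_log (Real.exp_pos _) h1
  rw [Real.log_exp] at h3
  exact ⟨h3, (Real.log_nonpos ((Real.exp_pos _).le.trans h1) h2).trans hβ⟩

theorem integrable_clauseTerm (hβ : 0 ≤ β) (k : ℕ) :
    Integrable (clauseTerm k β) (Measure.pi fun _ : Fin k => (ν : Measure ℝ)) :=
  .of_bound (measurable_clauseTerm k β).aestronglyMeasurable β
    (.of_forall fun h => abs_clauseTerm_le hβ k h)

variable (K β) in
/-- The weight of `m` clauses on distinct variables. -/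
def clauseFactor (m : ℕ) (w : Fin m × Fin (K + 1) → Bool) : ℝ := ∏ j, penalty β fun i => w (j, i)

theorem clauseFactor_le (hβ : 0 ≤ β) (m : ℕ) (w : Fin m × Fin (K + 1) → Bool) :
    clauseFactor K β m w ≤ 1 :=
  Finset.prod_le_one (fun _ _ => (penalty_pos _ _).le) fun _ _ => penalty_le_one hβ _

theorem exp_le_clauseFactor (hβ : 0 ≤ β) (m : ℕ) (w : Fin m × Fin (K + 1) → Bool) :
    Real.exp (-(β * m)) ≤ clauseFactor K β m w := by
  have h : ∏ _a : Fin m, Real.exp (-β) = Real.exp (-(β * m)) := by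
    rw [Finset.prod_const, Finset.card_univ, ← Real.exp_nat_mul, Fintype.card_fin]
    congr 1
    ring
  rw [← h, clauseFactor]
  exact Finset.prod_le_prod (fun c _ => (Real.exp_pos _).le) fun c _ => exp_le_penalty hβ _

theorem max_abs_log_exp_one (hβ : 0 ≤ β) (m : ℕ) :
    max |Real.log (Real.exp (-(β * m)))| |Real.log 1| = β * m := by
  rw [Real.log_exp, abs_neg, abs_of_nonneg (by positivity : 0 ≤ β * m), Real.log_one, abs_zero,
    max_eq_left (by positivity)]

theorem abs_logMean_clauseFactor_le (hβ : 0 ≤ β) (m : ℕ) (q : (Fin m × Fin (K + 1) → Bool) → ℝ) :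
    |logMean (Real.exp (-(β * m))) 1 (clauseFactor K β m) q| ≤ β * m := by
  have h := abs_logMean_le (Λ := clauseFactor K β m) (Real.exp_pos (-(β * m)))
    ((exp_le_clauseFactor hβ m fun _ : Fin m × Fin (K + 1) => true).trans
      (clauseFactor_le hβ m _)) q
  rwa [max_abs_log_exp_one hβ] at h

theorem logMeanField_clauseFactor (hβ : 0 ≤ β) (m : ℕ) (h : Fin m × Fin (K + 1) → ℝ) :
    logMeanField (clauseFactor K β m) h = ∑ j, clauseTerm (K + 1) β fun i => h (j, i) := by
  have hsum : ∑ w, prodWeight (fun a => probFalse (h a)) w * clauseFactor K β m w =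
      ∏ j, (1 - (1 - Real.exp (-β)) * ∏ i, probFalse (h (j, i))) := by
    have h1 (w : Fin m × Fin (K + 1) → Bool) :
        prodWeight (fun a => probFalse (h a)) w * clauseFactor K β m w =
        ∏ j, ((penalty β fun i => w (j, i)) *
          ∏ i, if w (j, i) then 1 - probFalse (h (j, i)) else probFalse (h (j, i))) := by
      rw [Finset.prod_mul_distrib, mul_comm, prodWeight, clauseFactor, Fintype.prod_prod_type]
    simp_rw [h1]
    rw [← (Equiv.curry _ _ _).symm.sum_comp]
    simp only [Equiv.curry_symm_apply, Function.uncurry_apply_pair]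
    rw [← Fintype.prod_sum fun j (w : Fin (K + 1) → Bool) => (penalty β fun i => w i) *
          ∏ i, if w i then 1 - probFalse (h (j, i)) else probFalse (h (j, i))]
    exact Finset.prod_congr rfl fun j _ => sum_penalty_mul _
  rw [logMeanField, hsum, Real.log_prod fun j _ => ?_]
  · exact Finset.sum_congr rfl fun j _ => (clauseTerm_eq _ _ _).symm
  · exact ((Real.exp_pos _).trans_le
      (exp_neg_le_one_sub hβ (prod_probFalse_le_one fun i => h (j, i)))).ne'

variable (K β ν) in
/-- The mean effect of a clause on distinct variables on the free entropy. -/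
def clauseEntropy : ℝ :=
  ∫ h, clauseTerm (K + 1) β h ∂(Measure.pi fun _ : Fin (K + 1) => (ν : Measure ℝ))

theorem integral_logMeanField_clauseFactor (hβ : 0 ≤ β) (m : ℕ) :
    ∫ h, logMeanField (clauseFactor K β m) h
      ∂(Measure.pi fun _ : Fin m × Fin (K + 1) => (ν : Measure ℝ)) = m * clauseEntropy K β ν := by
  simp_rw [logMeanField_clauseFactor hβ]
  have hmp (j : Fin m) := measurePreserving_pi_comp_injective
    (fun _ : Fin m × Fin (K + 1) => (ν : Measure ℝ)) (f := fun i : Fin (K + 1) => (j, i))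
    (Prod.mk_right_injective j)
  have hi (j : Fin m) : Integrable (fun h : Fin m × Fin (K + 1) → ℝ =>
      clauseTerm (K + 1) β fun i => h (j, i))
      (Measure.pi fun _ : Fin m × Fin (K + 1) => (ν : Measure ℝ)) :=
    (hmp j).integrable_comp_of_integrable (integrable_clauseTerm hβ (K + 1))
  rw [integral_finsetSum _ fun j _ => hi j]
  have h (j : Fin m) : ∫ h : Fin m × Fin (K + 1) → ℝ, clauseTerm (K + 1) β (fun i => h (j, i))
      ∂(Measure.pi fun _ : Fin m × Fin (K + 1) => (ν : Measure ℝ)) = clauseEntropy K β ν := by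
    rw [clauseEntropy, ← (hmp j).map_eq, integral_map (hmp j).measurable.aemeasurable
      (measurable_clauseTerm _ _).aestronglyMeasurable]
  simp [h]

/-- The effect of additional clauses on the free entropy. -/
theorem meanLog_add (hβ : 0 ≤ β) (γ δ : ℝ≥0) (V : Type) [Fintype V] [DecidableEq V] [Nonempty V] :
    meanLog (K + 1) V β (γ + δ) = meanLog (K + 1) V β γ +
      ∫ m, (𝔼 d : Fin m × Fin (K + 1) → V × Bool,
        ∫ η, logMean (Real.exp (-(β * m))) 1 (clauseFactor K β m) (marginal d (weight β η))
          ∂(poissonPi (Tuple (K + 1) V) γ))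
        ∂(poissonMeasure (δ * Fintype.card (Tuple (K + 1) V))) := by
  have hmp := measurePreserving_add_poissonPi (T := Tuple (K + 1) V) γ δ
  have hi : Integrable (fun p : (Tuple (K + 1) V → ℕ) × (Tuple (K + 1) V → ℕ) =>
      Real.log (∑ x, weight β (p.1 + p.2) x))
      ((poissonPi (Tuple (K + 1) V) γ).prod (poissonPi (Tuple (K + 1) V) δ)) :=
    hmp.integrable_comp_of_integrable (integrable_log_sum_weight (V := V) hβ (γ + δ))
  have hi2 : Integrable (fun η' : Tuple (K + 1) V → ℕ => ∫ η, Real.log (∑ x, weight β (η + η') x)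
      ∂(poissonPi (Tuple (K + 1) V) γ)) (poissonPi (Tuple (K + 1) V) δ) := hi.integral_prod_right
  have h1 : meanLog (K + 1) V β (γ + δ) = ∫ η', ∫ η, Real.log (∑ x, weight β (η + η') x)
      ∂(poissonPi (Tuple (K + 1) V) γ) ∂(poissonPi (Tuple (K + 1) V) δ) := by
    rw [meanLog, ← hmp.map_eq, integral_map Measurable.of_discrete.aemeasurable
      Measurable.of_discrete.aestronglyMeasurable]
    exact integral_prod_symm _ hi
  rw [h1, integral_poissonPi hi2]
  have hi3 : Integrable (fun m : ℕ => 𝔼 d : Fin m × Fin (K + 1) → V × Bool,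
        ∫ η, logMean (Real.exp (-(β * m))) 1 (clauseFactor K β m) (marginal d (weight β η))
          ∂(poissonPi (Tuple (K + 1) V) γ))
        (poissonMeasure (δ * Fintype.card (Tuple (K + 1) V))) := by
    refine integrable_poisson_of_le (A := 0) (B := β) fun m => ?_
    rw [zero_add]
    exact abs_expect_le (by positivity) fun d => abs_integral_le_of_abs_le fun η =>
      abs_logMean_clauseFactor_le hβ m _
  have hc : meanLog (K + 1) V β γ = ∫ _ : ℕ, meanLog (K + 1) V β γ
    ∂(poissonMeasure (δ * Fintype.card (Tuple (K + 1) V))) := by simp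
  rw [hc, ← integral_add (integrable_const _) hi3]
  refine integral_congr_ae (.of_forall fun m => ?_)
  simp only
  have hc' : meanLog (K + 1) V β γ = 𝔼 _d : Fin m × Fin (K + 1) → V × Bool,
    meanLog (K + 1) V β γ := (Finset.expect_const Finset.univ_nonempty _).symm
  rw [hc', ← Finset.expect_add_distrib]
  refine Fintype.expect_equiv (Equiv.curry _ _ _).symm _ _ fun d => ?_
  rw [meanLog, ← integral_add (integrable_log_sum_weight hβ γ)
    (.of_bound Measurable.of_discrete.aestronglyMeasurable _ (.of_forall fun η =>
      abs_logMean_clauseFactor_le hβ m _))]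
  refine integral_congr_ae (.of_forall fun η => ?_)
  simp only
  rw [← log_sum_mul_eq (Real.exp_pos _) (exp_le_clauseFactor hβ m) (clauseFactor_le hβ m)]
  congr 1
  refine Finset.sum_congr rfl fun x _ => ?_
  rw [weight_add]
  congr 1
  exact prod_pow_counts d _

end Recursion

/-! ### The free entropy density -/

section Limit

variable {K : ℕ} {α : ℝ≥0} {β : ℝ} {ν : ProbabilityMeasure ℝ}

theorem tendsto_expect_logMean (hK : 1 ≤ K) (hα : (α : ℝ) < alphaStar (K + 1))
    (hβ : 0 ≤ β) (hν : S₂ (K + 1) α (S₁ (K + 1) β ν) = ν) {J : Type} [Fintype J] [DecidableEq J]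
    {a b : ℝ} {Λ : (J → Bool) → ℝ} (ha0 : 0 < a) (ha : ∀ w, a ≤ Λ w) (hb : ∀ w, Λ w ≤ b)
    {σ : Type*} {l : Filter σ} {p : σ → ℕ × ℝ≥0} (hp : Tendsto p l (sparse K α))
    (V : σ → Type) [∀ s, Fintype (V s)] [∀ s, DecidableEq (V s)]
    (hV : ∀ s, Fintype.card (V s) = (p s).1) :
    Tendsto (fun s => 𝔼 d : J → V s × Bool, ∫ η, logMean a b Λ (marginal d (weight β η))
      ∂(poissonPi (Tuple (K + 1) (V s)) (p s).2)) l
      (𝓝 (∫ h, logMeanField Λ h ∂(Measure.pi fun _ : J => (ν : Measure ℝ)))) := by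
  refine Metric.tendsto_nhds.2 fun ε hε => ?_
  have hab : a ≤ b := (ha fun _ => true).trans (hb _)
  filter_upwards [hp.eventually (eventually_abs_expect_sub_le hK hα hβ hν zero_le_two
    measurable_logMeanField (abs_logMean_le ha0 hab) (abs_logMeanField_le ha0 ha hb)
    (approxBy_logMean ha0 ha hb) (half_pos hε))] with s hs
  rw [Real.dist_eq]
  exact (hs (V s) (hV s)).trans_lt (half_lt_self hε)

theorem tendsto_criticalRate_succ :
    Tendsto (fun N : ℕ => (N, criticalRate K α (N + 1))) atTop (sparse K α) :=
  tendsto_pred_sparse.comp (tendsto_criticalRate.comp (tendsto_add_atTop_nat 1))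

/-- The effect of an additional variable together with its clauses. -/
theorem tendsto_meanLog_addVertex (hK : 1 ≤ K) (hα : (α : ℝ) < alphaStar (K + 1))
    (hβ : 0 ≤ β) (hν : S₂ (K + 1) α (S₁ (K + 1) β ν) = ν) :
    Tendsto (fun N : ℕ => meanLog (K + 1) (Fin (N + 1)) β (criticalRate K α (N + 1)) -
      meanLog (K + 1) (Fin N) β (criticalRate K α (N + 1))) atTop
      (𝓝 (vertexEntropy K α β ν)) := by
  have hsucc : Tendsto (fun N : ℕ => (N + 1, criticalRate K α (N + 1))) atTop (sparse K α) :=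
    tendsto_criticalRate.comp (tendsto_add_atTop_nat 1)
  have herr := ((tendsto_multi_rate.comp hsucc).const_mul β)
  rw [mul_zero] at herr
  have hmain : Tendsto (fun N : ℕ => ∫ ℓ, (𝔼 d : Nbr K ℓ → {v : Fin (N + 1) // v ≠ 0} × Bool,
        ∫ η, logMean (Real.exp (-(β * (ℓ.1 + ℓ.2)))) 2 (vertexFactor β ℓ) (marginal d (weight β η))
          ∂(poissonPi (Tuple (K + 1) {v : Fin (N + 1) // v ≠ 0}) (criticalRate K α (N + 1))))
        ∂(degreeLaw (criticalRate K α (N + 1) * ((K + 1) * (2 * (N : ℝ≥0)) ^ K)))) atTop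
      (𝓝 (vertexEntropy K α β ν)) := by
    have h2 := Real.log_nonneg one_le_two
    refine tendsto_integral_poisson_prod (A := Real.log 2) (B := β) ?_ hβ (fun ℓ => ?_)
      (fun N ℓ => ?_) fun ℓ => ?_
    · exact (tendsto_slot_rate (K := K) (α := α)).comp hsucc
    · exact tendsto_expect_logMean hK hα hβ hν (Real.exp_pos _) (exp_le_vertexFactor hβ ℓ)
        (vertexFactor_le hβ ℓ) tendsto_criticalRate_succ _ fun N => by simp
    · exact abs_expect_le (by positivity) fun d => abs_integral_le_of_abs_le fun η =>
        abs_logMean_vertexFactor_le hβ ℓ _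
    · exact abs_integral_le_of_abs_le fun h => (abs_logMeanField_le (Real.exp_pos _)
        (exp_le_vertexFactor hβ ℓ) (vertexFactor_le hβ ℓ) h).trans
          (max_abs_log_exp_le hβ _ (by positivity))
  refine tendsto_of_tendsto_of_dist hmain (squeeze_zero' (.of_forall fun _ => dist_nonneg) ?_ herr)
  filter_upwards [eventually_ge_atTop 1] with N hN
  have h := abs_meanLog_sub_sub_le (K := K) hβ (criticalRate K α (N + 1)) (0 : Fin (N + 1)) hN
    (by simp)
  rw [meanLog_congr (V := {v : Fin (N + 1) // v ≠ 0}) (V' := Fin N)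
    (Fintype.equivOfCardEq (by simp))] at h
  rw [dist_comm, Real.dist_eq]
  simpa [Function.comp_apply] using h

theorem criticalRate_succ_le {N : ℕ} (hN : 1 ≤ N) :
    criticalRate K α (N + 1) ≤ criticalRate K α N := by
  unfold criticalRate
  have : 0 < (N : ℝ≥0) := by positivity
  gcongr
  simp

/-- Removing a variable removes `k α` clauses on average but should remove only `α` of them; the
difference is the number of clauses that have to be added. -/
theorem tendsto_extra_rate :
    Tendsto (fun N : ℕ => (criticalRate K α N - criticalRate K α (N + 1)) *
      (Fintype.card (Tuple (K + 1) (Fin N)) : ℝ≥0)) atTop (𝓝 (K * α)) := by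
  rw [← NNReal.tendsto_coe]
  have hx : Tendsto (fun N : ℕ => (N : ℝ) / (N + 1)) atTop (𝓝 1) :=
    tendsto_natCast_div_add_atTop 1
  have hq : Tendsto (fun N : ℕ => ∑ i ∈ Finset.range K, ((N : ℝ) / (N + 1)) ^ i) atTop
      (𝓝 (K : ℝ)) := by
    have := tendsto_finsetSum (Finset.range K) fun i _ => hx.pow i
    simpa using this
  have h := (hx.mul hq).mul_const (α : ℝ)
  rw [one_mul] at h
  push_cast
  refine h.congr' ?_
  filter_upwards [eventually_ge_atTop 1] with N hN
  have hN0 : (N : ℝ) ≠ 0 := by positivity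
  have hN1 : (N : ℝ) + 1 ≠ 0 := by positivity
  rw [NNReal.coe_sub (criticalRate_succ_le hN)]
  have hgeom := mul_neg_geom_sum ((N : ℝ) / (N + 1)) K
  have h1 : 1 - (N : ℝ) / (N + 1) = 1 / (N + 1) := by field_simp; ring
  rw [h1] at hgeom
  have h2 : (N : ℝ) / (N + 1) * ∑ i ∈ Finset.range K, ((N : ℝ) / (N + 1)) ^ i =
      N * (1 - ((N : ℝ) / (N + 1)) ^ K) := by
    rw [← hgeom]
    ring
  rw [h2, div_pow]
  unfold criticalRate
  push_cast
  simp only [Fintype.card_pi, Fintype.card_prod, Fintype.card_fin, Fintype.card_bool,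
    Finset.prod_const, Finset.card_univ]
  push_cast
  rw [mul_pow]
  field_simp
  ring

/-- The effect of the additional clauses that keep the number of clauses per variable constant. -/
theorem tendsto_meanLog_addClauses (hK : 1 ≤ K) (hα : (α : ℝ) < alphaStar (K + 1))
    (hβ : 0 ≤ β) (hν : S₂ (K + 1) α (S₁ (K + 1) β ν) = ν) :
    Tendsto (fun N : ℕ => meanLog (K + 1) (Fin N) β (criticalRate K α N) -
      meanLog (K + 1) (Fin N) β (criticalRate K α (N + 1))) atTop
      (𝓝 (K * α * clauseEntropy K β ν)) := by
  have hlim : ∫ m : ℕ, (m * clauseEntropy K β ν) ∂(poissonMeasure (K * α)) =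
      K * α * clauseEntropy K β ν := by
    rw [integral_mul_const, integral_natCast_poisson]
    simp
  rw [← hlim]
  have hmain : Tendsto (fun N : ℕ => ∫ m, (𝔼 d : Fin m × Fin (K + 1) → Fin N × Bool,
        ∫ η, logMean (Real.exp (-(β * m))) 1 (clauseFactor K β m) (marginal d (weight β η))
          ∂(poissonPi (Tuple (K + 1) (Fin N)) (criticalRate K α (N + 1))))
        ∂(poissonMeasure ((criticalRate K α N - criticalRate K α (N + 1)) *
          Fintype.card (Tuple (K + 1) (Fin N))))) atTop
      (𝓝 (∫ m : ℕ, (m * clauseEntropy K β ν) ∂(poissonMeasure (K * α)))) := by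
    refine tendsto_integral_poisson (A := 0) (B := β) tendsto_extra_rate (fun m => ?_)
      (.of_forall fun N m => ?_)
    · rw [← integral_logMeanField_clauseFactor hβ m]
      exact tendsto_expect_logMean hK hα hβ hν (Real.exp_pos _) (exp_le_clauseFactor hβ m)
        (clauseFactor_le hβ m) tendsto_criticalRate_succ _ fun N => by simp
    · rw [zero_add]
      exact abs_expect_le (by positivity) fun d => abs_integral_le_of_abs_le fun η =>
        abs_logMean_clauseFactor_le hβ m _
  refine hmain.congr' ?_
  filter_upwards [eventually_ge_atTop 1] with N hN
  have : Nonempty (Fin N) := ⟨⟨0, hN⟩⟩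
  have h := meanLog_add (K := K) hβ (criticalRate K α (N + 1))
    (criticalRate K α N - criticalRate K α (N + 1)) (Fin N)
  rw [add_tsub_cancel_of_le (criticalRate_succ_le hN)] at h
  rw [h, add_sub_cancel_left]

/-- The free entropy per variable of a Poissonian formula. It is the limit of the mean effect of
adding a variable while the number of clauses per variable is kept. -/
theorem tendsto_meanLog_div (hK : 1 ≤ K) (hα : (α : ℝ) < alphaStar (K + 1))
    (hβ : 0 ≤ β) (hν : S₂ (K + 1) α (S₁ (K + 1) β ν) = ν) :
    Tendsto (fun N : ℕ => meanLog (K + 1) (Fin N) β (criticalRate K α N) / N) atTop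
      (𝓝 (vertexEntropy K α β ν - K * α * clauseEntropy K β ν)) := by
  set u : ℕ → ℝ := fun N => meanLog (K + 1) (Fin N) β (criticalRate K α N) with hu
  have h1 : Tendsto (fun N => u (N + 1) - u N) atTop
      (𝓝 (vertexEntropy K α β ν - K * α * clauseEntropy K β ν)) := by
    refine ((tendsto_meanLog_addVertex hK hα hβ hν).sub
      (tendsto_meanLog_addClauses hK hα hβ hν)).congr fun N => ?_
    simp only [hu]
    ring
  have h2 := h1.cesaro.add (tendsto_const_div_atTop_nhds_zero_nat (u 0))
  rw [add_zero] at h2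
  refine h2.congr fun N => ?_
  rw [Finset.sum_range_sub, inv_mul_eq_div, ← add_div, sub_add_cancel]

end Limit

/-! ### The Bethe formula -/

section Bethe

theorem integral_comp_measurePreserving {X Y : Type*} [MeasurableSpace X] [MeasurableSpace Y]
    {P : Measure X} {Q : Measure Y} {f : X → Y} (hf : MeasurePreserving f P Q) {g : Y → ℝ}
    (hg : Measurable g) : ∫ x, g (f x) ∂P = ∫ y, g y ∂Q := by
  rw [← hf.map_eq, integral_map hf.measurable.aemeasurable hg.aestronglyMeasurable]

theorem measurable_tanh : Measurable Real.tanh := continuous_tanh.measurable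

theorem one_add_tanh_pos (u : ℝ) : 0 < 1 + Real.tanh u := by
  have h := probFalse_lt_one u
  rw [probFalse_eq_tanh] at h
  linarith

theorem one_sub_tanh (u : ℝ) : 1 - Real.tanh u = Real.exp (-2 * u) * (1 + Real.tanh u) := by
  have h := one_sub_probFalse u
  rw [probFalse_eq_tanh] at h
  have h1 : 1 + Real.tanh u = Real.exp (2 * u) * (1 - Real.tanh u) := by linarith
  rw [h1, ← mul_assoc, ← Real.exp_add]
  simp

theorem one_sub_tanh_pos (u : ℝ) : 0 < 1 - Real.tanh u := by
  rw [one_sub_tanh]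
  exact mul_pos (Real.exp_pos _) (one_add_tanh_pos u)

theorem abs_log_one_add_tanh_le {u : ℝ} (hu : 0 ≤ u) : |Real.log (1 + Real.tanh u)| ≤ Real.log 2 := by
  have h1 := probFalse_le_half hu
  rw [probFalse_eq_tanh] at h1
  have h2 := one_sub_tanh_pos u
  rw [abs_of_nonneg (Real.log_nonneg (by linarith))]
  exact Real.log_le_log (one_add_tanh_pos u) (by linarith)

variable {K : ℕ} {α : ℝ≥0} {β : ℝ} {μ ν : ProbabilityMeasure ℝ}

variable (K β ν) in
/-- The mean logarithm of the normalisation `1 + tanh u` of a message `u`. -/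
def messageEntropy : ℝ :=
  ∫ h, Real.log (1 + Real.tanh (bpFun (K + 1) β h))
    ∂(Measure.pi fun _ : Fin K => (ν : Measure ℝ))

theorem measurable_log_one_add_tanh_bpFun :
    Measurable fun h : Fin K → ℝ => Real.log (1 + Real.tanh (bpFun (K + 1) β h)) :=
  Real.measurable_log.comp
    ((measurable_tanh.comp (measurable_bpFun (K + 1) β)).const_add 1)

theorem integrable_log_one_add_tanh_bpFun (hβ : 0 ≤ β) :
    Integrable (fun h : Fin K → ℝ => Real.log (1 + Real.tanh (bpFun (K + 1) β h)))
      (Measure.pi fun _ : Fin K => (ν : Measure ℝ)) :=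
  .of_bound measurable_log_one_add_tanh_bpFun.aestronglyMeasurable (Real.log 2)
    (.of_forall fun h => abs_log_one_add_tanh_le (bpFun_mem_Icc hβ h).1)

theorem exp_neg_two_mul_bpFun (hβ : 0 ≤ β) (h : Fin K → ℝ) :
    Real.exp (-2 * bpFun (K + 1) β h) = 1 - (1 - Real.exp (-β)) * ∏ j, probFalse (h j) := by
  rw [bpFun_succ, exp_message hβ fun j => ⟨(probFalse_pos _).le, (probFalse_lt_one _).le⟩]

/-! #### The edge term -/

/-- If `u` is the message of a clause to one of its literals, with field `h 0`, then the edge term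
is the clause term up to the normalisation of `u`. -/
theorem edgeTerm_eq (hβ : 0 ≤ β) (h : Fin (K + 1) → ℝ) :
    edgeTerm (h 0, bpFun (K + 1) β fun j : Fin K => h j.succ) =
      Real.log (1 + Real.tanh (bpFun (K + 1) β fun j : Fin K => h j.succ)) +
        clauseTerm (K + 1) β h := by
  have h1 := exp_neg_two_mul_bpFun hβ fun j : Fin K => h j.succ
  set u := bpFun (K + 1) β fun j : Fin K => h j.succ
  have h2 := one_sub_tanh u
  have h3 : (1 + Real.tanh u) * (1 - (1 - Real.exp (-β)) * ∏ i, probFalse (h i)) =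
      1 + Real.tanh (h 0) * Real.tanh u := by
    rw [Fin.prod_univ_succ, probFalse_eq_tanh (h 0)]
    rw [h1] at h2
    linear_combination (-(1 - Real.tanh (h 0)) / 2) * h2
  rw [clauseTerm_eq, ← Real.log_mul (one_add_tanh_pos u).ne', h3, edgeTerm]
  exact ((Real.exp_pos _).trans_le
    (exp_neg_le_one_sub hβ (prod_probFalse_le_one h))).ne'

theorem measurePreserving_edge (hμ : S₁ (K + 1) β ν = μ) :
    MeasurePreserving (fun h : Fin (K + 1) → ℝ => (h 0, bpFun (K + 1) β fun j : Fin K => h j.succ))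
      (Measure.pi fun _ : Fin (K + 1) => (ν : Measure ℝ)) ((ν : Measure ℝ).prod (μ : Measure ℝ)) := by
  have h1 := measurePreserving_piFinSuccAbove (fun _ : Fin (K + 1) => (ν : Measure ℝ)) 0
  have h2 : MeasurePreserving (fun w : Fin K → ℝ => bpFun (K + 1) β w)
      (Measure.pi fun _ : Fin K => (ν : Measure ℝ)) (μ : Measure ℝ) :=
    ⟨measurable_bpFun (K + 1) β, by rw [← hμ]; rfl⟩
  exact ((MeasurePreserving.id (ν : Measure ℝ)).prod h2).comp h1

theorem measurable_edgeTerm : Measurable edgeTerm := by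
  have := measurable_tanh
  unfold edgeTerm
  fun_prop

theorem integrable_edgeTerm (hβ : 0 ≤ β) (hμ : S₁ (K + 1) β ν = μ) :
    Integrable edgeTerm ((ν : Measure ℝ).prod (μ : Measure ℝ)) := by
  have hmp := measurePreserving_edge hμ
  rw [← hmp.integrable_comp measurable_edgeTerm.aestronglyMeasurable]
  refine .of_bound (measurable_edgeTerm.comp hmp.measurable).aestronglyMeasurable
    (Real.log 2 + β) (.of_forall fun h => ?_)
  rw [Function.comp_apply, edgeTerm_eq hβ]
  exact (abs_add_le _ _).trans (add_le_add
    (abs_log_one_add_tanh_le (bpFun_mem_Icc hβ _).1) (abs_clauseTerm_le hβ _ _))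

theorem integral_edgeTerm (hβ : 0 ≤ β) (hμ : S₁ (K + 1) β ν = μ) :
    ∫ p, edgeTerm p ∂((ν : Measure ℝ).prod (μ : Measure ℝ)) =
      messageEntropy K β ν + clauseEntropy K β ν := by
  rw [← integral_comp_measurePreserving (measurePreserving_edge hμ) measurable_edgeTerm]
  simp_rw [edgeTerm_eq hβ]
  have hmp := measurePreserving_pi_comp_injective (fun _ : Fin (K + 1) => (ν : Measure ℝ))
    (Fin.succ_injective K)
  have hi : Integrable (fun h : Fin (K + 1) → ℝ =>
      Real.log (1 + Real.tanh (bpFun (K + 1) β fun j : Fin K => h j.succ)))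
      (Measure.pi fun _ => (ν : Measure ℝ)) :=
    hmp.integrable_comp_of_integrable (integrable_log_one_add_tanh_bpFun hβ)
  rw [integral_add hi (integrable_clauseTerm hβ _), messageEntropy, clauseEntropy]
  congr 1
  exact integral_comp_measurePreserving hmp
    (measurable_log_one_add_tanh_bpFun (K := K) (β := β))

/-! #### The variable term -/

/-- `variableTerm` as a function of the relevant values of a sample. -/
def variableTermOf (ℓ : ℕ × ℕ) (u : Fin ℓ.1 ⊕ Fin ℓ.2 → ℝ) : ℝ :=
  Real.log ((∏ i, (1 + Real.tanh (u (.inl i)))) * ∏ i, (1 - Real.tanh (u (.inr i))) +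
    (∏ i, (1 - Real.tanh (u (.inl i)))) * ∏ i, (1 + Real.tanh (u (.inr i))))

theorem variableTerm_eq (s : PoissonSample) :
    variableTerm s = variableTermOf s.1 (relevant s.1 s.2) := by
  simp [variableTerm, variableTermOf, relevant, Finset.prod_range]

theorem measurable_variableTermOf (ℓ : ℕ × ℕ) : Measurable (variableTermOf ℓ) := by
  have := measurable_tanh
  unfold variableTermOf
  fun_prop

/-- The messages to a variable, as functions of the fields of the other literals in its clauses. -/
def messages (β : ℝ) (ℓ : ℕ × ℕ) (h : Nbr K ℓ → ℝ) (a : Fin ℓ.1 ⊕ Fin ℓ.2) : ℝ :=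
  bpFun (K + 1) β fun j : Fin K => h (a, j)

theorem measurePreserving_messages (hμ : S₁ (K + 1) β ν = μ) (ℓ : ℕ × ℕ) :
    MeasurePreserving (messages (K := K) β ℓ) (Measure.pi fun _ => (ν : Measure ℝ))
      (Measure.pi fun _ => (μ : Measure ℝ)) := by
  have h1 := measurePreserving_curry (A := Fin ℓ.1 ⊕ Fin ℓ.2) (B := Fin K) (ν : Measure ℝ)
  have h2 : MeasurePreserving (fun (w : Fin ℓ.1 ⊕ Fin ℓ.2 → Fin K → ℝ) a => bpFun (K + 1) β (w a))
      (Measure.pi fun _ => Measure.pi fun _ : Fin K => (ν : Measure ℝ))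
      (Measure.pi fun _ => (μ : Measure ℝ)) :=
    measurePreserving_pi (f := fun _ w => bpFun (K + 1) β w) _ _
      fun _ => ⟨measurable_bpFun (K + 1) β, by rw [← hμ]; rfl⟩
  exact h2.comp h1

/-- The variable term is the effect of a variable on the free entropy, up to the normalisations of
the messages. In `bethe` they cancel against those of the edge terms. -/
theorem variableTermOf_messages (hβ : 0 ≤ β) (ℓ : ℕ × ℕ) (h : Nbr K ℓ → ℝ) :
    variableTermOf ℓ (messages β ℓ h) =
      ∑ a, Real.log (1 + Real.tanh (bpFun (K + 1) β fun j : Fin K => h (a, j))) +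
        logMeanField (vertexFactor β ℓ) h := by
  set u := messages β ℓ h with hu
  have h1 : ∑ w, prodWeight (fun i => probFalse (h i)) w * vertexFactor β ℓ w =
      ∏ i, Real.exp (-2 * u (.inr i)) + ∏ i, Real.exp (-2 * u (.inl i)) := by
    simp_rw [vertexFactor, Finset.mul_sum]
    rw [Finset.sum_comm]
    simp_rw [sum_prodWeight_mul_branchWeight hβ
      fun a => ⟨(probFalse_pos (h a)).le, (probFalse_lt_one (h a)).le⟩]
    simp [Fintype.prod_sum_type, hu, messages, bpFun_succ]
  have h2 : ∑ a, Real.log (1 + Real.tanh (u a)) = Real.log (∏ a, (1 + Real.tanh (u a))) :=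
    (Real.log_prod fun a _ => (one_add_tanh_pos _).ne').symm
  change _ = ∑ a, Real.log (1 + Real.tanh (u a)) + _
  rw [logMeanField, h1, h2, ← Real.log_mul
    (Finset.prod_pos fun a _ => one_add_tanh_pos _).ne' (by positivity), variableTermOf]
  congr 1
  simp_rw [one_sub_tanh, Finset.prod_mul_distrib, Fintype.prod_sum_type]
  ring

theorem abs_variableTermOf_messages_le (hβ : 0 ≤ β) (ℓ : ℕ × ℕ) (h : Nbr K ℓ → ℝ) :
    |variableTermOf ℓ (messages β ℓ h)| ≤ Real.log 2 + (Real.log 2 + β) * (ℓ.1 + ℓ.2) := by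
  have h1 : |∑ a : Fin ℓ.1 ⊕ Fin ℓ.2,
      Real.log (1 + Real.tanh (bpFun (K + 1) β fun j : Fin K => h (a, j)))| ≤
      (ℓ.1 + ℓ.2) * Real.log 2 := by
    refine (Finset.abs_sum_le_sum_abs _ _).trans ((Finset.sum_le_sum fun a _ =>
      abs_log_one_add_tanh_le (bpFun_mem_Icc hβ _).1).trans (le_of_eq ?_))
    simp
  have h2 : |logMeanField (vertexFactor (K := K) β ℓ) h| ≤ Real.log 2 + β * (ℓ.1 + ℓ.2) :=
    (abs_logMeanField_le (Real.exp_pos _) (exp_le_vertexFactor hβ ℓ) (vertexFactor_le hβ ℓ)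
      h).trans (max_abs_log_exp_le hβ _ (by positivity))
  rw [variableTermOf_messages hβ]
  refine (abs_add_le _ _).trans ((add_le_add h1 h2).trans (le_of_eq ?_))
  ring

theorem integral_variableTermOf (hβ : 0 ≤ β) (hμ : S₁ (K + 1) β ν = μ) (ℓ : ℕ × ℕ) :
    ∫ u, variableTermOf ℓ u ∂(Measure.pi fun _ => (μ : Measure ℝ)) =
      (ℓ.1 + ℓ.2) * messageEntropy K β ν + ∫ h, logMeanField (vertexFactor (K := K) β ℓ) h
        ∂(Measure.pi fun _ => (ν : Measure ℝ)) := by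
  rw [← integral_comp_measurePreserving (measurePreserving_messages hμ ℓ)
    (measurable_variableTermOf ℓ)]
  simp_rw [variableTermOf_messages hβ]
  have hmp (a : Fin ℓ.1 ⊕ Fin ℓ.2) := measurePreserving_pi_comp_injective
    (fun _ : Nbr K ℓ => (ν : Measure ℝ)) (f := fun j : Fin K => (a, j)) (Prod.mk_right_injective a)
  have hi (a : Fin ℓ.1 ⊕ Fin ℓ.2) : Integrable (fun h : Nbr K ℓ → ℝ =>
      Real.log (1 + Real.tanh (bpFun (K + 1) β fun j : Fin K => h (a, j))))
      (Measure.pi fun _ => (ν : Measure ℝ)) :=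
    (hmp a).integrable_comp_of_integrable (integrable_log_one_add_tanh_bpFun hβ)
  have he (a : Fin ℓ.1 ⊕ Fin ℓ.2) : ∫ h : Nbr K ℓ → ℝ,
      Real.log (1 + Real.tanh (bpFun (K + 1) β fun j : Fin K => h (a, j)))
      ∂(Measure.pi fun _ => (ν : Measure ℝ)) = messageEntropy K β ν :=
    integral_comp_measurePreserving (hmp a) (measurable_log_one_add_tanh_bpFun (K := K) (β := β))
  rw [integral_add (integrable_finsetSum _ fun a _ => hi a)
    (.of_bound measurable_logMeanField.aestronglyMeasurable _ (.of_forall fun h =>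
      abs_logMeanField_le (Real.exp_pos _) (exp_le_vertexFactor hβ ℓ) (vertexFactor_le hβ ℓ) h)),
    integral_finsetSum _ fun a _ => hi a]
  simp [he]

theorem integrable_variableTerm (hβ : 0 ≤ β) (hμ : S₁ (K + 1) β ν = μ) :
    Integrable variableTerm (poissonSampleLaw (K + 1) α μ) := by
  have hm : Measurable fun s : PoissonSample => variableTermOf s.1 (relevant s.1 s.2) :=
    measurable_from_prod_countable_right fun ℓ =>
      (measurable_variableTermOf ℓ).comp (measurePreserving_relevant (μ := μ) ℓ).measurable
  rw [funext variableTerm_eq]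
  refine ⟨hm.aestronglyMeasurable, ?_⟩
  rw [HasFiniteIntegral, lintegral_poissonSampleLaw (G := fun ℓ u => ‖variableTermOf ℓ u‖ₑ)
    fun ℓ => (measurable_variableTermOf ℓ).enorm]
  refine lt_of_le_of_lt (lintegral_mono fun ℓ => ?_) (integrable_poisson_prod_of_le
    (r := occRate (K + 1) α) (f := fun ℓ : ℕ × ℕ => Real.log 2 + (Real.log 2 + β) * (ℓ.1 + ℓ.2))
    (A := Real.log 2) (B := Real.log 2 + β) fun ℓ => le_of_eq (abs_of_nonneg ?_)).lintegral_lt_top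
  · rw [← (measurePreserving_messages hμ ℓ).lintegral_comp (measurable_variableTermOf ℓ).enorm]
    refine (lintegral_mono (g := fun _ => ENNReal.ofReal
      (Real.log 2 + (Real.log 2 + β) * (ℓ.1 + ℓ.2))) fun h => ?_).trans (by simp)
    rw [Real.enorm_eq_ofReal_abs]
    exact ENNReal.ofReal_le_ofReal (abs_variableTermOf_messages_le hβ ℓ h)
  · have := Real.log_nonneg one_le_two
    positivity

theorem integral_variableTerm (hβ : 0 ≤ β) (hμ : S₁ (K + 1) β ν = μ) :
    ∫ s, variableTerm s ∂(poissonSampleLaw (K + 1) α μ) =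
      (K + 1) * α * messageEntropy K β ν + vertexEntropy K α β ν := by
  have hi := integrable_variableTerm (α := α) hβ hμ
  rw [funext variableTerm_eq] at hi ⊢
  rw [integral_poissonSampleLaw measurable_variableTermOf hi]
  simp_rw [integral_variableTermOf hβ hμ]
  have h1 : Integrable (fun ℓ : ℕ × ℕ => ((ℓ.1 : ℝ) + ℓ.2)) (degreeLaw (occRate (K + 1) α)) :=
    integrable_poisson_prod_of_le (A := 0) (B := 1) fun ℓ => by
      rw [abs_of_nonneg (by positivity)]
      simp
  have h2 : Integrable (fun ℓ : ℕ × ℕ => ∫ h, logMeanField (vertexFactor (K := K) β ℓ) h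
      ∂(Measure.pi fun _ => (ν : Measure ℝ))) (degreeLaw (occRate (K + 1) α)) :=
    integrable_poisson_prod_of_le (A := Real.log 2) (B := β) fun ℓ =>
      abs_integral_le_of_abs_le fun h => (abs_logMeanField_le (Real.exp_pos _)
        (exp_le_vertexFactor hβ ℓ) (vertexFactor_le hβ ℓ) h).trans
          (max_abs_log_exp_le hβ _ (by positivity))
  rw [integral_add (h1.mul_const _) h2, integral_mul_const, integral_add
    ((integrable_natCast_poisson _).comp_fst _) ((integrable_natCast_poisson _).comp_snd _),
    integral_fun_fst (fun n : ℕ => (n : ℝ)), integral_fun_snd (fun n : ℕ => (n : ℝ)),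
    integral_natCast_poisson, vertexEntropy]
  simp only [probReal_univ, one_smul, occRate]
  push_cast
  ring

/-- The Bethe free entropy of a fixed point. -/
theorem bethe_eq (hβ : 0 ≤ β) (hμ : S₁ (K + 1) β ν = μ) :
    bethe (K + 1) α β μ ν = vertexEntropy K α β ν - K * α * clauseEntropy K β ν := by
  rw [bethe, integral_edgeTerm hβ hμ, integral_variableTerm hβ hμ, ← clauseEntropy]
  push_cast
  ring

end Bethe

/-! ### Concentration -/

section Concentration

variable {X : Type*} [MeasurableSpace X] [Finite X] [DiscreteMeasurableSpace X] {P : Measure X}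
  [IsProbabilityMeasure P]

theorem integral_pi_succ {M : ℕ} (f : (Fin (M + 1) → X) → ℝ) :
    ∫ d, f d ∂(Measure.pi fun _ => P) =
      ∫ y, ∫ x, f (Fin.cons x y) ∂P ∂(Measure.pi fun _ : Fin M => P) := by
  have h := (measurePreserving_piFinSuccAbove (fun _ : Fin (M + 1) => P) 0).symm
  rw [← h.map_eq, integral_map_equiv]
  rw [integral_prod_symm _ .of_finite]
  simp [MeasurableEquiv.piFinSuccAbove, Fin.insertNthEquiv]

/-- A function of independent variables with bounded differences has sub-Gaussian fluctuations. -/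
theorem integral_exp_sub_integral_le {M : ℕ} {f : (Fin M → X) → ℝ} {C : ℝ} (hC : 0 ≤ C)
    (hf : ∀ d i x, |f (Function.update d i x) - f d| ≤ C) (t : ℝ) :
    ∫ d, Real.exp (t * (f d - ∫ d', f d' ∂(Measure.pi fun _ => P))) ∂(Measure.pi fun _ => P) ≤
      Real.exp (M * C ^ 2 * t ^ 2 / 2) := by
  induction M with
  | zero =>
    have h (d : Fin 0 → X) : ∫ d', f d' ∂(Measure.pi fun _ => P) = f d := by
      rw [integral_congr_ae (g := fun _ => f d)
        (.of_forall fun d' => congrArg f (Subsingleton.elim _ _))]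
      simp
    simp_rw [fun d => congrArg (fun y => Real.exp (t * (f d - y))) (h d)]
    simp
  | succ M ih =>
    -- average out one variable at a time; given the others, the oscillation of `f` is at most `2 C`
    set g : (Fin M → X) → ℝ := fun y => ∫ x, f (Fin.cons x y) ∂P with hg
    have hint : ∫ d, f d ∂(Measure.pi fun _ => P) = ∫ y, g y ∂(Measure.pi fun _ => P) :=
      integral_pi_succ f
    have hgC (y : Fin M → X) (i : Fin M) (x' : X) : |g (Function.update y i x') - g y| ≤ C := by
      rw [hg]
      simp only
      rw [← integral_sub .of_finite .of_finite]
      refine abs_integral_le_of_abs_le fun x => ?_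
      rw [Fin.cons_update]
      exact hf _ _ _
    have hosc (y : Fin M → X) (x : X) : f (Fin.cons x y) ∈ Set.Icc (g y - C) (g y + C) := by
      have h : |∫ x', (f (Fin.cons x y) - f (Fin.cons x' y)) ∂P| ≤ C := by
        refine abs_integral_le_of_abs_le fun x' => ?_
        have := hf (Fin.cons x' y) 0 x
        rwa [Fin.update_cons_zero (α := fun _ => X)] at this
      rw [integral_sub .of_finite .of_finite, integral_const, probReal_univ, one_smul, abs_le] at h
      constructor <;> linarith [h.1, h.2]
    have hin (y : Fin M → X) : ∫ x, Real.exp (t * (f (Fin.cons x y) - g y)) ∂P ≤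
        Real.exp (C ^ 2 * t ^ 2 / 2) := by
      have h := (hasSubgaussianMGF_of_mem_Icc (μ := P) (X := fun x => f (Fin.cons x y))
        Measurable.of_discrete.aemeasurable (.of_forall (hosc y))).mgf_le t
      refine h.trans (le_of_eq ?_)
      congr 3
      push_cast
      rw [show g y + C - (g y - C) = 2 * C by ring, Real.norm_of_nonneg (by positivity)]
      ring
    rw [integral_pi_succ, hint]
    have h (y : Fin M → X) : ∫ x, Real.exp (t * (f (Fin.cons x y) -
        ∫ y', g y' ∂(Measure.pi fun _ => P))) ∂P ≤
        Real.exp (C ^ 2 * t ^ 2 / 2) *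
          Real.exp (t * (g y - ∫ y', g y' ∂(Measure.pi fun _ => P))) := by
      refine le_trans (le_of_eq ?_) (mul_le_mul_of_nonneg_right (hin y) (Real.exp_pos _).le)
      rw [← integral_mul_const]
      refine integral_congr_ae (.of_forall fun x => ?_)
      simp only
      rw [← Real.exp_add]
      congr 1
      ring
    refine (integral_mono .of_finite .of_finite h).trans ?_
    rw [integral_const_mul]
    refine (mul_le_mul_of_nonneg_left (ih hgC) (Real.exp_pos _).le).trans (le_of_eq ?_)
    rw [← Real.exp_add]
    congr 1
    push_cast
    ring

/-- The bounded difference inequality. -/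
theorem measureReal_le_abs_sub_integral {M : ℕ} {f : (Fin M → X) → ℝ} {C : ℝ} (hC : 0 ≤ C)
    (hf : ∀ d i x, |f (Function.update d i x) - f d| ≤ C) {c : ℝ≥0} (hc : M * C ^ 2 ≤ c)
    {ε : ℝ} (hε : 0 ≤ ε) :
    (Measure.pi fun _ : Fin M => P).real
      {d | ε ≤ |f d - ∫ d', f d' ∂(Measure.pi fun _ => P)|} ≤ 2 * Real.exp (-ε ^ 2 / (2 * c)) := by
  have hs : HasSubgaussianMGF (fun d => f d - ∫ d', f d' ∂(Measure.pi fun _ => P)) c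
      (Measure.pi fun _ : Fin M => P) := by
    refine ⟨fun t => .of_finite, fun t => (integral_exp_sub_integral_le hC hf t).trans ?_⟩
    gcongr
  have h1 := hs.measure_ge_le hε
  have h2 := hs.neg.measure_ge_le hε
  rw [two_mul]
  refine le_trans ?_ (add_le_add h1 h2)
  refine le_trans (measureReal_mono ?_) (measureReal_union_le _ _)
  intro d hd
  rcases le_abs.1 (show ε ≤ |f d - ∫ d', f d' ∂(Measure.pi fun _ => P)| from hd) with h | h
  · exact Or.inl h
  · exact Or.inr h

end Concentration

/-! ### Clauses on distinct variables -/

section Distinct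

variable {k N : ℕ}

variable (k N) in
/-- Ordered clauses on distinct variables. -/
abbrev DistinctTuple : Type := {c : Tuple k (Fin N) // Function.Injective fun j => (c j).1}

/-- The clause given by a tuple of literals. -/
def toClause (c : DistinctTuple k N) : Clause N := Finset.univ.image c.1

theorem injective_distinctTuple (c : DistinctTuple k N) : Function.Injective c.1 :=
  fun _ _ h => c.2 (congrArg Prod.fst h)

theorem toClause_mem (c : DistinctTuple k N) : toClause c ∈ kClauses k N := by
  refine ⟨?_, ?_⟩
  · rw [toClause, Finset.card_image_of_injective _ (injective_distinctTuple c), Finset.card_univ,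
      Fintype.card_fin]
  · rw [toClause, Finset.coe_image, Finset.coe_univ, Set.image_univ]
    rintro _ ⟨i, rfl⟩ _ ⟨j, rfl⟩ h
    exact congrArg c.1 (c.2 h)

/-- Every clause arises from `k!` tuples. -/
theorem card_fiber_toClause {c : Clause N} (hc : c ∈ kClauses k N) :
    (Finset.univ.filter fun d : DistinctTuple k N => toClause d = c).card = k.factorial := by
  have e : {d : DistinctTuple k N // toClause d = c} ≃ (Fin k ≃ c) :=
    { toFun := fun d => Equiv.ofBijective
        (fun j => ⟨d.1.1 j, d.2.le (Finset.mem_image_of_mem d.1.1 (Finset.mem_univ j))⟩)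
        ⟨fun i j h => injective_distinctTuple d.1 (congrArg Subtype.val h), fun l => by
          have hl : l.1 ∈ toClause d.1 := d.2.symm ▸ l.2
          obtain ⟨j, -, hj⟩ := Finset.mem_image.1 hl
          exact ⟨j, Subtype.ext hj⟩⟩
      invFun := fun σ => ⟨⟨fun j => σ j, fun i j h =>
          σ.injective (Subtype.ext (hc.2 (σ i).2 (σ j).2 h))⟩, by
        ext l
        simp only [toClause, Finset.mem_image, Finset.mem_univ, true_and]
        exact ⟨fun ⟨j, hj⟩ => hj ▸ (σ j).2, fun hl => ⟨σ.symm ⟨l, hl⟩, by simp⟩⟩⟩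
      left_inv := fun d => rfl
      right_inv := fun σ => Equiv.ext fun j => rfl }
  rw [← Fintype.card_subtype, Fintype.card_congr e,
    Fintype.card_equiv (c.equivFinOfCardEq hc.1).symm, Fintype.card_fin]

theorem nonempty_distinctTuple (h : k ≤ N) : Nonempty (DistinctTuple k N) :=
  ⟨⟨fun j => (Fin.castLE h j, true), Fin.castLE_injective h⟩⟩

/-- The clause given by a uniform tuple is uniform. -/
theorem map_toClause (h : k ≤ N) :
    (uniformOn (Set.univ : Set (DistinctTuple k N))).map toClause = uniformOn (kClauses k N) := by
  classical
  have := nonempty_distinctTuple h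
  have hcard : Fintype.card (DistinctTuple k N) =
      k.factorial * (kClauses k N).toFinset.card := by
    rw [← Finset.card_univ, Finset.card_eq_sum_card_fiberwise
      (t := (kClauses k N).toFinset) fun d _ => by simpa using toClause_mem d,
      Finset.sum_congr rfl fun c hc => card_fiber_toClause (by simpa using hc)]
    simp [mul_comm]
  refine Measure.ext_of_singleton fun c => ?_
  rw [Measure.map_apply Measurable.of_discrete (measurableSet_singleton c), uniformOn_univ]
  have hS : (kClauses k N) = ((kClauses k N).toFinset : Set (Clause N)) := by simp
  have hcount : (Measure.count (toClause ⁻¹' {c} : Set (DistinctTuple k N)) : ℝ≥0∞) =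
      (Finset.univ.filter fun d : DistinctTuple k N => toClause d = c).card := by
    rw [← Measure.count_apply_finset]
    congr 1
    ext d
    simp
  rw [hcount]
  rw [hS, ← Finset.coe_singleton, uniformOn_apply_finset, hcard]
  by_cases hc : c ∈ kClauses k N
  · rw [card_fiber_toClause hc, Finset.inter_singleton_of_mem (by simpa using hc),
      Finset.card_singleton]
    push_cast
    rw [← ENNReal.mul_div_mul_left 1 _ (c := (k.factorial : ℝ≥0∞))
      (by exact_mod_cast k.factorial_ne_zero) (ENNReal.natCast_ne_top _), mul_one]
  · rw [Finset.inter_singleton_of_notMem (by simpa using hc), Finset.filter_eq_empty_iff.2 ?_]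
    · simp
    · rintro d - rfl
      exact hc (toClause_mem d)

theorem integral_uniformOn_univ {X : Type*} [Fintype X] [Nonempty X] [MeasurableSpace X]
    [MeasurableSingletonClass X] (f : X → ℝ) :
    ∫ x, f x ∂(uniformOn (Set.univ : Set X)) = 𝔼 x, f x := by
  rw [integral_fintype .of_finite, Fintype.expect_eq_sum_div_card, Finset.sum_div]
  refine Finset.sum_congr rfl fun x _ => ?_
  rw [measureReal_def, uniformOn_univ, Measure.count_singleton]
  simp [div_eq_inv_mul]

theorem integral_formulaLaw (h : k ≤ N) {M : ℕ} (f : (Fin M → Clause N) → ℝ) :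
    ∫ F, f F ∂(formulaLaw k N M) =
      𝔼 d : Fin M → DistinctTuple k N, f fun a => toClause (d a) := by
  have := nonempty_distinctTuple h
  have hmp : MeasurePreserving (fun (d : Fin M → DistinctTuple k N) a => toClause (d a))
      (Measure.pi fun _ => uniformOn (Set.univ : Set (DistinctTuple k N)))
      (formulaLaw k N M) := by
    have (_ : Fin M) : IsProbabilityMeasure (uniformOn (kClauses k N)) := by
      rw [← map_toClause h]
      exact Measure.isProbabilityMeasure_map Measurable.of_discrete.aemeasurable
    exact measurePreserving_pi (f := fun _ => toClause) _ _
      fun _ => ⟨Measurable.of_discrete, map_toClause h⟩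
  rw [← integral_comp_measurePreserving hmp Measurable.of_discrete, ← uniformOn_pi,
    Set.pi_univ, integral_uniformOn_univ]

end Distinct

/-! ### Comparison with Poissonian formulas -/

section Comparison

variable {k N : ℕ} {β : ℝ}

/-- A factor with values in `[exp (-β), 1]` lowers the logarithm of a partition function by at most
`β`. -/
theorem log_sum_mul_mem {ι : Type*} [Fintype ι] [Nonempty ι] {W p : ι → ℝ} (hW : ∀ x, 0 < W x)
    (hp : ∀ x, Real.exp (-β) ≤ p x) (hp1 : ∀ x, p x ≤ 1) :
    Real.log (∑ x, W x) - β ≤ Real.log (∑ x, W x * p x) ∧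
      Real.log (∑ x, W x * p x) ≤ Real.log (∑ x, W x) := by
  have hp0 (x : ι) : 0 < p x := (Real.exp_pos _).trans_le (hp x)
  have h1 : 0 < ∑ x, W x := Finset.sum_pos (fun x _ => hW x) Finset.univ_nonempty
  have h2 : 0 < ∑ x, W x * p x :=
    Finset.sum_pos (fun x _ => mul_pos (hW x) (hp0 x)) Finset.univ_nonempty
  constructor
  · rw [← Real.log_exp β, ← Real.log_div h1.ne' (Real.exp_pos _).ne', div_eq_mul_inv,
      ← Real.exp_neg, Finset.sum_mul]
    exact Real.log_le_log (Finset.sum_pos (fun x _ => mul_pos (hW x) (Real.exp_pos _))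
      Finset.univ_nonempty) (Finset.sum_le_sum fun x _ =>
        mul_le_mul_of_nonneg_left (hp x) (hW x).le)
  · exact Real.log_le_log h2 (Finset.sum_le_sum fun x _ =>
      mul_le_of_le_one_right (hW x).le (hp1 x))

open Classical in
/-- The Gibbs weight of a clause. -/
def violationWeight (β : ℝ) (c : Clause N) (x : Fin N → Bool) : ℝ :=
  if Violated c x then Real.exp (-β) else 1

theorem exp_le_violationWeight (hβ : 0 ≤ β) (c : Clause N) (x : Fin N → Bool) :
    Real.exp (-β) ≤ violationWeight β c x := by
  unfold violationWeight
  split_ifs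
  · exact le_rfl
  · simpa using hβ

theorem violationWeight_le_one (hβ : 0 ≤ β) (c : Clause N) (x : Fin N → Bool) :
    violationWeight β c x ≤ 1 := by
  unfold violationWeight
  split_ifs
  · simpa using hβ
  · exact le_rfl

theorem violationWeight_pos (c : Clause N) (x : Fin N → Bool) : 0 < violationWeight β c x := by
  unfold violationWeight
  split_ifs
  · exact Real.exp_pos _
  · exact one_pos

theorem partitionFunction_eq {M : ℕ} (β : ℝ) (F : Fin M → Clause N) :
    partitionFunction β F = ∑ x, ∏ a, violationWeight β (F a) x := by
  classical
  refine Finset.sum_congr rfl fun x _ => ?_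
  simp only [violationWeight, Finset.prod_ite, Finset.prod_const]
  rw [one_pow, mul_one, mul_comm, Real.exp_nat_mul, energy]

theorem abs_log_partitionFunction_update_sub_le (hβ : 0 ≤ β) {M : ℕ} (F : Fin M → Clause N)
    (i : Fin M) (c : Clause N) :
    |Real.log (partitionFunction β (Function.update F i c)) - Real.log (partitionFunction β F)| ≤
      β := by
  have h (c : Clause N) := log_sum_mul_mem (β := β)
    (W := fun x => ∏ a ∈ Finset.univ.erase i, violationWeight β (F a) x)
    (fun x => Finset.prod_pos fun a _ => violationWeight_pos _ _)
    (exp_le_violationWeight hβ c) (violationWeight_le_one hβ c)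
  have h1 : partitionFunction β (Function.update F i c) = ∑ x,
      (∏ a ∈ Finset.univ.erase i, violationWeight β (F a) x) * violationWeight β c x := by
    rw [partitionFunction_eq]
    refine Finset.sum_congr rfl fun x _ => ?_
    rw [← Finset.prod_erase_mul _ _ (Finset.mem_univ i), Function.update_self]
    congr 1
    refine Finset.prod_congr rfl fun a ha => ?_
    rw [Function.update_of_ne (Finset.ne_of_mem_erase ha)]
  have h2 : partitionFunction β F = ∑ x,
      (∏ a ∈ Finset.univ.erase i, violationWeight β (F a) x) * violationWeight β (F i) x := by
    rw [partitionFunction_eq]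
    exact Finset.sum_congr rfl fun x _ => (Finset.prod_erase_mul _ _ (Finset.mem_univ i)).symm
  have h3 := h c
  have h4 := h (F i)
  rw [← h1] at h3
  rw [← h2] at h4
  rw [abs_le]
  constructor <;> linarith [h3.1, h3.2, h4.1, h4.2]

variable (k N β) in
/-- The mean logarithm of the partition function of `m` clauses on distinct variables. -/
def clausesMeanLog (m : ℕ) : ℝ :=
  𝔼 d : Fin m → DistinctTuple k N, Real.log (partitionFunction β fun a => toClause (d a))

theorem abs_clausesMeanLog_succ_sub_le (hβ : 0 ≤ β) (h : k ≤ N) (m : ℕ) :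
    |clausesMeanLog k N β (m + 1) - clausesMeanLog k N β m| ≤ β := by
  have := nonempty_distinctTuple h
  have h1 : clausesMeanLog k N β (m + 1) = 𝔼 p : DistinctTuple k N × (Fin m → DistinctTuple k N),
      Real.log (partitionFunction β fun a : Fin (m + 1) =>
        toClause ((Fin.cons p.1 p.2 : Fin (m + 1) → DistinctTuple k N) a)) :=
    (Fintype.expect_equiv (Fin.consEquiv fun _ : Fin (m + 1) => DistinctTuple k N) _ _
      fun p => rfl).symm
  have h2 : clausesMeanLog k N β m = 𝔼 p : DistinctTuple k N × (Fin m → DistinctTuple k N),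
      Real.log (partitionFunction β fun a => toClause (p.2 a)) := by
    rw [expect_prod_type]
    exact (Finset.expect_const Finset.univ_nonempty _).symm
  rw [h1, h2, ← Finset.expect_sub_distrib]
  refine abs_expect_le hβ fun p => ?_
  have h3 := log_sum_mul_mem (β := β) (W := fun x => ∏ a, violationWeight β (toClause (p.2 a)) x)
    (fun x => Finset.prod_pos fun a _ => violationWeight_pos _ _)
    (exp_le_violationWeight hβ (toClause p.1)) (violationWeight_le_one hβ (toClause p.1))
  have h4 : partitionFunction β (fun a : Fin (m + 1) =>
        toClause ((Fin.cons p.1 p.2 : Fin (m + 1) → DistinctTuple k N) a)) =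
      ∑ x, (∏ a, violationWeight β (toClause (p.2 a)) x) * violationWeight β (toClause p.1) x := by
    rw [partitionFunction_eq]
    refine Finset.sum_congr rfl fun x _ => ?_
    rw [Fin.prod_univ_succ, mul_comm]
    rfl
  rw [← h4, ← partitionFunction_eq] at h3
  rw [abs_le]
  constructor <;> linarith [h3.1, h3.2]

theorem abs_sub_le_of_abs_succ_sub_le {e : ℕ → ℝ} {b : ℝ} (he : ∀ m, |e (m + 1) - e m| ≤ b)
    (m n : ℕ) : |e m - e n| ≤ b * |(m : ℝ) - n| := by
  have h (n j : ℕ) : |e (n + j) - e n| ≤ b * j := by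
    induction j with
    | zero => simp
    | succ j ih =>
      have h1 := abs_add_le (e (n + j + 1) - e (n + j)) (e (n + j) - e n)
      rw [sub_add_sub_cancel] at h1
      push_cast
      rw [← add_assoc]
      linarith [he (n + j)]
  rcases le_total n m with hnm | hnm <;> obtain ⟨j, rfl⟩ := Nat.exists_eq_add_of_le hnm
  · simpa using h n j
  · rw [abs_sub_comm]
    simpa using h m j

theorem penalty_litVal (c : DistinctTuple k N) (x : Fin N → Bool) :
    penalty β (fun j => litVal x (c.1 j)) = violationWeight β (toClause c) x := by
  unfold penalty violationWeight
  congr 1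
  simp [Violated, toClause, litVal]

theorem weight_extend_distinct (η : DistinctTuple k N → ℕ) (x : Fin N → Bool) :
    weight β (Function.extend Subtype.val η 0) x =
      ∏ c, violationWeight β (toClause c) x ^ η c := by
  refine (Fintype.prod_of_injective _ Subtype.val_injective _ _ (fun c hc => ?_) fun c => ?_).symm
  · rw [Function.extend_apply' _ _ _ (by simpa using hc), Pi.zero_apply, pow_zero]
  · rw [Subtype.val_injective.extend_apply, penalty_litVal]

variable (k N) in
open Classical in
/-- The tuples in which some variable is repeated. -/
def repeatedTuples : Finset (Tuple k (Fin N)) :=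
  Finset.univ.filter fun c => ¬Function.Injective fun j => (c j).1

/-- Discarding the clauses with a repeated variable, and conditioning on the number of clauses. -/
theorem abs_meanLog_sub_integral_le (hβ : 0 ≤ β) (γ : ℝ≥0) :
    |meanLog k (Fin N) β γ - ∫ m, clausesMeanLog k N β m
      ∂(poissonMeasure (γ * Fintype.card (DistinctTuple k N)))| ≤
      β * (γ * (repeatedTuples k N).card) := by
  have hext (η : Tuple k (Fin N) → ℕ) (c : Tuple k (Fin N)) :
      Function.extend (Subtype.val : DistinctTuple k N → _) (η ∘ Subtype.val) 0 c ≤ η c := by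
    by_cases hc : ∃ d : DistinctTuple k N, d.1 = c
    · obtain ⟨d, rfl⟩ := hc
      rw [Subtype.val_injective.extend_apply]
      rfl
    · rw [Function.extend_apply' _ _ _ hc]
      exact Nat.zero_le _
  have h := abs_integral_sub_integral_extend_le (γ := γ)
    (f := (Subtype.val : DistinctTuple k N → Tuple k (Fin N))) Subtype.val_injective
    (H := fun η => Real.log (∑ x, weight β η x)) (abs_log_sum_weight_le hβ) (C := β)
    (R := repeatedTuples k N) (fun η => ?_) hβ
  · have hi : Integrable (fun η : DistinctTuple k N → ℕ =>
        Real.log (∑ x, weight β (Function.extend Subtype.val η 0) x))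
        (poissonPi (DistinctTuple k N) γ) := by
      refine integrable_poissonPi_of_le (A := Fintype.card (Fin N) * Real.log 2) (B := β)
        fun η => (abs_log_sum_weight_le hβ _).trans (le_of_eq ?_)
      congr 2
      refine (Fintype.sum_of_injective _ Subtype.val_injective _ _ (fun c hc => ?_)
        fun c => ?_).symm
      · rw [Function.extend_apply' _ _ _ (by simpa using hc), Pi.zero_apply, Nat.cast_zero]
      · rw [Subtype.val_injective.extend_apply]
    rw [integral_poissonPi hi] at h
    simp_rw [weight_extend_distinct, prod_pow_counts, ← partitionFunction_eq] at h
    exact h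
  · set η' := Function.extend (Subtype.val : DistinctTuple k N → _) (η ∘ Subtype.val) 0 with hη'
    have hsum : η = η' + (η - η') := by
      funext c
      exact (Nat.add_sub_cancel' (hext η c)).symm
    have h1 := log_sum_weight_add_mem hβ η' (η - η')
    rw [← hsum] at h1
    have h2 : ∑ c, (((η - η') c : ℕ) : ℝ) ≤ ∑ c ∈ repeatedTuples k N, (η c : ℝ) := by
      rw [← Finset.sum_subset (Finset.subset_univ (repeatedTuples k N)) fun c _ hc => ?_]
      · refine Finset.sum_le_sum fun c _ => ?_
        exact_mod_cast Nat.sub_le _ _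
      · have hc' : Function.Injective fun j => (c j).1 := by
          simpa [repeatedTuples] using hc
        have := Subtype.val_injective.extend_apply (η ∘ Subtype.val) 0
          (⟨c, hc'⟩ : DistinctTuple k N)
        rw [Pi.sub_apply, hη', this]
        simp
    have h3 := mul_le_mul_of_nonneg_left h2 hβ
    have h4 : 0 ≤ β * ∑ c ∈ repeatedTuples k N, (η c : ℝ) := by positivity
    rw [abs_le]
    constructor <;> linarith [h1.1, h1.2]

/-- A union bound over the pairs of positions of a uniform tuple. -/
theorem card_repeatedTuples_le (hN : 1 ≤ N) :
    ((repeatedTuples k N).card : ℝ) ≤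
      2 * (k ^ 2 / N) * Fintype.card (Tuple k (Fin N)) := by
  classical
  have : Nonempty (Fin N) := ⟨⟨0, hN⟩⟩
  have h := expect_le_of_injective (e := (Empty.elim : Empty → Fin N)) (fun x => x.elim)
    (H := fun d : Fin k → Fin N × Bool =>
      if Function.Injective fun j => (d j).1 then (0 : ℝ) else 1) (b := 0) (C := 1) (by simp)
    (fun d => by split_ifs <;> norm_num)
    (fun d hd => (if_pos (hd.comp Sum.inr_injective)).le)
  rw [Fintype.expect_eq_sum_div_card, div_le_iff₀ (by positivity)] at h
  refine le_trans (le_of_eq ?_) (h.trans (le_of_eq ?_))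
  · rw [repeatedTuples, Finset.card_filter]
    push_cast
    refine Finset.sum_congr rfl fun c _ => ?_
    split_ifs <;> simp_all
  · rw [Fintype.card_fin, Fintype.card_empty, Fintype.card_fin, Nat.cast_zero]
    ring

theorem card_distinctTuple_add (k N : ℕ) :
    Fintype.card (DistinctTuple k N) + (repeatedTuples k N).card =
      Fintype.card (Tuple k (Fin N)) := by
  classical
  rw [Fintype.card_subtype, repeatedTuples]
  rw [← Finset.card_univ, ← Finset.card_filter_add_card_filter_not (s := Finset.univ)
    (fun c : Tuple k (Fin N) => Function.Injective fun j => (c j).1)]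

/-- The mean free entropy is Lipschitz in the number of clauses, and a Poisson number of clauses
deviates from its mean by at most the standard deviation on average. -/
theorem abs_integral_clausesMeanLog_sub_le (hβ : 0 ≤ β) (h : k ≤ N) (r : ℝ≥0) (M : ℕ) :
    |∫ m, clausesMeanLog k N β m ∂(poissonMeasure r) - clausesMeanLog k N β M| ≤
      β * (Real.sqrt r + |(r : ℝ) - M|) := by
  have hl := abs_sub_le_of_abs_succ_sub_le (abs_clausesMeanLog_succ_sub_le hβ h)
  have hi : Integrable (clausesMeanLog k N β) (poissonMeasure r) := by
    refine integrable_poisson_of_le (A := |clausesMeanLog k N β 0|) (B := β) fun m => ?_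
    have h1 := hl m 0
    have h2 := abs_add_le (clausesMeanLog k N β m - clausesMeanLog k N β 0)
      (clausesMeanLog k N β 0)
    rw [sub_add_cancel] at h2
    rw [Nat.cast_zero, sub_zero, abs_of_nonneg (m.cast_nonneg : (0 : ℝ) ≤ m)] at h1
    linarith
  have hc : clausesMeanLog k N β M = ∫ _ : ℕ, clausesMeanLog k N β M ∂(poissonMeasure r) := by simp
  have hn := integrable_natCast_poisson r
  rw [hc, ← integral_sub hi (integrable_const _)]
  refine abs_integral_le_integral_abs.trans ?_
  have hn' : Integrable (fun m : ℕ => |(m : ℝ) - r|) (poissonMeasure r) :=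
    (hn.sub (integrable_const (r : ℝ))).abs
  refine (integral_mono (g := fun m : ℕ => β * (|(m : ℝ) - r| + |(r : ℝ) - M|))
    (hi.sub (integrable_const _)).abs ((hn'.add (integrable_const _)).const_mul β)
    fun m => ?_).trans ?_
  · refine (hl m M).trans (mul_le_mul_of_nonneg_left ?_ hβ)
    have := abs_add_le ((m : ℝ) - r) ((r : ℝ) - M)
    rwa [sub_add_sub_cancel] at this
  · rw [integral_const_mul, integral_add hn' (integrable_const _)]
    refine mul_le_mul_of_nonneg_left (add_le_add (integral_abs_sub_poisson_le r) ?_) hβ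
    simp

variable {K : ℕ} {α : ℝ≥0}

/-- The mean free entropy of a formula with a given number of clauses, compared with the one of a
Poissonian formula. -/
theorem abs_meanLog_sub_clausesMeanLog_le (hβ : 0 ≤ β) (hN : 1 ≤ N) (h : K + 1 ≤ N) (M : ℕ) :
    |meanLog (K + 1) (Fin N) β (criticalRate K α N) - clausesMeanLog (K + 1) N β M| ≤
      β * (4 * α * (K + 1) ^ 2 + Real.sqrt (α * N) + |(α : ℝ) * N - M|) := by
  set γ := criticalRate K α N with hγ
  have hT : (γ : ℝ) * Fintype.card (Tuple (K + 1) (Fin N)) = α * N := by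
    rw [← criticalRate_mul (K := K) (α := α) hN]
    simp only [Fintype.card_pi, Fintype.card_prod, Fintype.card_fin, Fintype.card_bool,
      Finset.prod_const, Finset.card_univ]
    push_cast
    ring
  have hR : (γ : ℝ) * (repeatedTuples (K + 1) N).card ≤ 2 * α * (K + 1) ^ 2 := by
    have hN0 : (N : ℝ) ≠ 0 := by positivity
    refine (mul_le_mul_of_nonneg_left (card_repeatedTuples_le hN) γ.coe_nonneg).trans
      (le_of_eq ?_)
    rw [mul_left_comm, hT]
    push_cast
    field_simp
  have hR0 : 0 ≤ (γ : ℝ) * (repeatedTuples (K + 1) N).card := by positivity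
  have hadd : (γ : ℝ) * Fintype.card (DistinctTuple (K + 1) N) +
      γ * (repeatedTuples (K + 1) N).card = α * N := by
    rw [← hT, ← card_distinctTuple_add]
    push_cast
    ring
  have h1 := abs_meanLog_sub_integral_le (k := K + 1) (N := N) hβ γ
  have h2 := abs_integral_clausesMeanLog_sub_le hβ h
    (γ * Fintype.card (DistinctTuple (K + 1) N)) M
  have h3 := abs_add_le (meanLog (K + 1) (Fin N) β γ - ∫ m, clausesMeanLog (K + 1) N β m
      ∂(poissonMeasure (γ * Fintype.card (DistinctTuple (K + 1) N))))
    (∫ m, clausesMeanLog (K + 1) N β m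
      ∂(poissonMeasure (γ * Fintype.card (DistinctTuple (K + 1) N))) -
        clausesMeanLog (K + 1) N β M)
  rw [sub_add_sub_cancel] at h3
  refine h3.trans ((add_le_add h1 h2).trans ?_)
  rw [← mul_add]
  refine mul_le_mul_of_nonneg_left ?_ hβ
  push_cast
  set r := (γ : ℝ) * Fintype.card (DistinctTuple (K + 1) N) with hr
  have h4 : Real.sqrt r ≤ Real.sqrt (α * N) := Real.sqrt_le_sqrt (by linarith)
  have h5 := abs_add_le (r - α * N) (α * N - M)
  rw [sub_add_sub_cancel, abs_of_nonpos (by linarith : r - α * N ≤ 0)] at h5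
  linarith

/-- The errors in `abs_meanLog_sub_clausesMeanLog_le` are of smaller order than `N`. -/
theorem tendsto_clausesMeanLog_div {ν : ProbabilityMeasure ℝ} (hK : 1 ≤ K)
    (hα : (α : ℝ) < alphaStar (K + 1)) (hβ : 0 ≤ β)
    (hν : S₂ (K + 1) α (S₁ (K + 1) β ν) = ν) {M : ℕ → ℕ}
    (hM : Tendsto (fun N : ℕ => (M N : ℝ) / N) atTop (𝓝 (α : ℝ))) :
    Tendsto (fun N : ℕ => clausesMeanLog (K + 1) N β (M N) / N) atTop
      (𝓝 (vertexEntropy K α β ν - K * α * clauseEntropy K β ν)) := by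
  have hs : Tendsto (fun N : ℕ => Real.sqrt (α * N) / N) atTop (𝓝 0) := by
    have h1 : Tendsto (fun N : ℕ => Real.sqrt α / Real.sqrt N) atTop (𝓝 0) :=
      tendsto_const_nhds.div_atTop (Real.tendsto_sqrt_atTop.comp tendsto_natCast_atTop_atTop)
    refine h1.congr fun N => ?_
    rw [Real.sqrt_mul α.coe_nonneg, mul_div_assoc, Real.sqrt_div_self, div_eq_mul_inv]
  have hd : Tendsto (fun N : ℕ => |α - (M N : ℝ) / N|) atTop (𝓝 0) := by
    have := (tendsto_const_nhds (x := (α : ℝ))).sub hM |>.abs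
    simpa using this
  have herr := (((tendsto_const_div_atTop_nhds_zero_nat (4 * (α : ℝ) * (K + 1) ^ 2)).add hs).add
    hd).const_mul β
  simp only [add_zero, mul_zero] at herr
  refine tendsto_of_tendsto_of_dist (tendsto_meanLog_div hK hα hβ hν)
    (squeeze_zero' (.of_forall fun _ => dist_nonneg) ?_ herr)
  filter_upwards [eventually_ge_atTop (K + 1)] with N hN
  have hN1 : 1 ≤ N := le_trans (by omega) hN
  have hN0 : (0 : ℝ) < N := by positivity
  have h := abs_meanLog_sub_clausesMeanLog_le (α := α) hβ hN1 hN (M N)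
  rw [Real.dist_eq, ← sub_div, abs_div, abs_of_pos hN0, div_le_iff₀ hN0]
  refine h.trans (le_of_eq ?_)
  have h1 : |(α : ℝ) * N - M N| = |(α : ℝ) - M N / N| * N := by
    rw [← abs_of_pos hN0, ← abs_mul, abs_of_pos hN0]
    congr 1
    field_simp
  rw [h1]
  field_simp

end Comparison

/-! ### Almost sure convergence -/

section AlmostSure

variable {k : ℕ} {β : ℝ}

theorem isProbabilityMeasure_uniformOn_kClauses {N : ℕ} (h : k ≤ N) :
    IsProbabilityMeasure (uniformOn (kClauses k N)) := by
  have := nonempty_distinctTuple h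
  rw [← map_toClause h]
  exact Measure.isProbabilityMeasure_map Measurable.of_discrete.aemeasurable

theorem measureReal_le_abs_log_partitionFunction_sub (hβ : 0 ≤ β) {N : ℕ} (h : k ≤ N) (M : ℕ)
    {c : ℝ≥0} (hc : M * β ^ 2 ≤ c) {ε : ℝ} (hε : 0 ≤ ε) :
    (formulaLaw k N M).real
      {F | ε ≤ |Real.log (partitionFunction β F) - clausesMeanLog k N β M|} ≤
        2 * Real.exp (-ε ^ 2 / (2 * c)) := by
  have := isProbabilityMeasure_uniformOn_kClauses h
  have h1 := measureReal_le_abs_sub_integral (P := uniformOn (kClauses k N)) (M := M)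
    (f := fun F => Real.log (partitionFunction β F)) hβ
    (abs_log_partitionFunction_update_sub_le hβ) hc hε
  rwa [← formulaLaw, integral_formulaLaw h] at h1

/-- Concentration with exponentially small probabilities of deviations of order `N` and the
Borel–Cantelli lemma, which requires no assumption on the joint law of the formulas. -/
theorem ae_tendsto_log_partitionFunction (hβ : 0 ≤ β) {Ω : Type*} [MeasurableSpace Ω]
    {P : Measure Ω} [IsProbabilityMeasure P] {M : ℕ → ℕ} {a φ : ℝ}
    (hM : Tendsto (fun N : ℕ => (M N : ℝ) / N) atTop (𝓝 a))
    (hφ : Tendsto (fun N : ℕ => clausesMeanLog k N β (M N) / N) atTop (𝓝 φ))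
    {F : (N : ℕ) → Ω → (Fin (M N) → Clause N)}
    (hF : ∀ N : ℕ, k ≤ N → HasLaw (F N) (formulaLaw k N (M N)) P) :
    ∀ᵐ ω ∂P, Tendsto
      (fun N : ℕ => 1 / (N : ℝ) * Real.log (partitionFunction β (F N ω))) atTop (𝓝 φ) := by
  -- the summands `1` in `b` make the variance proxy positive even for `a = 0` or `β = 0`
  have ha : 0 ≤ a := ge_of_tendsto' hM fun N => by positivity
  obtain ⟨b, hb⟩ : ∃ b : ℝ≥0, (b : ℝ) = (a + 1) * (β + 1) ^ 2 :=
    ⟨((a + 1) * (β + 1) ^ 2).toNNReal, Real.coe_toNNReal _ (by positivity)⟩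
  have hb0 : 0 < (b : ℝ) := by
    rw [hb]
    positivity
  have hdev (n : ℕ) : ∀ᵐ ω ∂P, ∀ᶠ N in atTop, |Real.log (partitionFunction β (F N ω)) -
      clausesMeanLog k N β (M N)| < 1 / (n + 1 : ℝ) * N := by
    set s : ℕ → Set Ω := fun N => {ω | k ≤ N ∧ (M N : ℝ) ≤ (a + 1) * N ∧
      1 / (n + 1 : ℝ) * N ≤ |Real.log (partitionFunction β (F N ω)) -
        clausesMeanLog k N β (M N)|} with hs
    set q : ℝ := Real.exp (-((1 / (n + 1 : ℝ)) ^ 2 / (2 * b))) with hq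
    have hq1 : q < 1 := by
      rw [hq, Real.exp_lt_one_iff, neg_lt_zero]
      positivity
    have hbound (N : ℕ) : P (s N) ≤ ENNReal.ofReal (2 * q ^ N) := by
      by_cases hN : k ≤ N ∧ (M N : ℝ) ≤ (a + 1) * N
      · have hset : s N = {ω | 1 / (n + 1 : ℝ) * N ≤
            |Real.log (partitionFunction β (F N ω)) - clausesMeanLog k N β (M N)|} := by
          ext ω
          simp only [hs, Set.mem_ofPred_eq, hN.1, hN.2, true_and]
        rw [hset, (hF N hN.1).measure_eq (p := fun G => 1 / (n + 1 : ℝ) * N ≤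
          |Real.log (partitionFunction β G) - clausesMeanLog k N β (M N)|) (Set.toFinite _).measurableSet]
        have := isProbabilityMeasure_uniformOn_kClauses hN.1
        have : IsProbabilityMeasure (formulaLaw k N (M N)) := by
          unfold formulaLaw
          infer_instance
        rw [← ENNReal.ofReal_toReal (measure_ne_top (formulaLaw k N (M N)) _)]
        refine ENNReal.ofReal_le_ofReal ((measureReal_le_abs_log_partitionFunction_sub hβ hN.1
          (M N) (c := b * N) ?_ (by positivity)).trans (le_of_eq ?_))
        · rw [NNReal.coe_mul, hb, NNReal.coe_natCast]
          have h1 : β ^ 2 ≤ (β + 1) ^ 2 := by gcongr; linarith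
          calc (M N : ℝ) * β ^ 2 ≤ ((a + 1) * N) * (β + 1) ^ 2 :=
                mul_le_mul hN.2 h1 (by positivity) (by positivity)
            _ = _ := by ring
        · rw [hq, ← Real.exp_nat_mul]
          congr 2
          push_cast
          rcases Nat.eq_zero_or_pos N with rfl | hN0
          · simp
          · field_simp
      · have : s N = ∅ := by
          ext ω
          simp only [hs, Set.mem_ofPred_eq, Set.mem_empty_iff_false, iff_false]
          exact fun h => hN ⟨h.1, h.2.1⟩
        rw [this, measure_empty]
        exact zero_le
    have hsum : Summable fun N => 2 * q ^ N :=
      (summable_geometric_of_lt_one (Real.exp_pos _).le hq1).mul_left 2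
    have hfin : ∑' N, P (s N) ≠ ⊤ :=
      ne_top_of_le_ne_top hsum.tsum_ofReal_ne_top (ENNReal.tsum_le_tsum hbound)
    have hMa : ∀ᶠ N : ℕ in atTop, (M N : ℝ) ≤ (a + 1) * N := by
      filter_upwards [hM.eventually_le_const (lt_add_one a), eventually_ge_atTop 1] with N h1 h2
      rwa [div_le_iff₀ (by positivity)] at h1
    filter_upwards [ae_eventually_notMem hfin] with ω hω
    filter_upwards [hω, hMa, eventually_ge_atTop k] with N h1 h2 h3
    by_contra! h4
    exact h1 ⟨h3, h2, h4⟩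
  filter_upwards [ae_all_iff.2 hdev] with ω hω
  refine tendsto_of_tendsto_of_dist hφ (Metric.tendsto_nhds.2 fun ε hε => ?_)
  obtain ⟨n, hn⟩ := exists_nat_one_div_lt hε
  filter_upwards [hω n, eventually_ge_atTop 1] with N h1 h2
  have hN0 : (0 : ℝ) < N := by positivity
  rw [Real.dist_eq, sub_zero, abs_of_nonneg dist_nonneg, dist_comm, Real.dist_eq,
    one_div_mul_eq_div, ← sub_div, abs_div, abs_of_pos hN0]
  exact ((div_lt_iff₀ hN0).2 h1).trans hn

end AlmostSure

end RandomKSAT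

end

theorem theorem3 (k : ℕ) (hk : 2 ≤ k) (α : ℝ≥0) (hα : (α : ℝ) < RandomKSAT.alphaStar k)
    (β : ℝ) (hβ : 0 ≤ β) :
    (∃! μ : ProbabilityMeasure ℝ, RandomKSAT.S k α β μ = μ) ∧
    ∀ μ : ProbabilityMeasure ℝ, RandomKSAT.S k α β μ = μ →
      Integrable RandomKSAT.edgeTerm
        ((RandomKSAT.S₂ k α μ : Measure ℝ).prod (μ : Measure ℝ)) ∧
      Integrable (RandomKSAT.clauseTerm k β)
        (Measure.pi fun _ : Fin k => (RandomKSAT.S₂ k α μ : Measure ℝ)) ∧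
      Integrable RandomKSAT.variableTerm (RandomKSAT.poissonSampleLaw k α μ) ∧
      ∀ (Ω : Type*) [MeasurableSpace Ω] (P : Measure Ω) [IsProbabilityMeasure P]
        (M : ℕ → ℕ) (_ : Tendsto (fun N : ℕ => (M N : ℝ) / N) atTop (𝓝 (α : ℝ)))
        (F : (N : ℕ) → Ω → (Fin (M N) → RandomKSAT.Clause N))
        (_ : ∀ N : ℕ, k ≤ N → HasLaw (F N) (RandomKSAT.formulaLaw k N (M N)) P),
        ∀ᵐ ω ∂P, Tendsto
          (fun N : ℕ => 1 / (N : ℝ) * Real.log (RandomKSAT.partitionFunction β (F N ω))) atTop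
          (𝓝 (RandomKSAT.bethe k α β μ (RandomKSAT.S₂ k α μ))) := by
  obtain ⟨K, rfl⟩ : ∃ K, k = K + 1 := ⟨k - 1, by omega⟩
  have hK : 1 ≤ K := by omega
  refine ⟨RandomKSAT.existsUnique_fixed hK hα hβ, fun μ hμ => ?_⟩
  have hμ' : RandomKSAT.S₁ (K + 1) β (RandomKSAT.S₂ (K + 1) α μ) = μ := hμ
  have hν := congrArg (RandomKSAT.S₂ (K + 1) α) hμ'
  refine ⟨RandomKSAT.integrable_edgeTerm hβ hμ', RandomKSAT.integrable_clauseTerm hβ (K + 1),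
    RandomKSAT.integrable_variableTerm hβ hμ', fun Ω _ P _ M hM F hF => ?_⟩
  rw [RandomKSAT.bethe_eq hβ hμ']
  exact RandomKSAT.ae_tendsto_log_partitionFunction hβ hM
    (RandomKSAT.tendsto_clausesMeanLog_div hK hα hβ hν hM) hF
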